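/- Let $M$ be a (Hausdorff, second countable) smooth manifold of dimension $n$ with a smooth positive volume element $dx$, and let $X_1,\dots,X_N$ be smooth vector fields on $M$, with horizontal gradient $\nabla_X=(X_1,\dots,X_N)$. Let $\Omega_1\subset\Omega_2$ be bounded (i.e. relatively compact) domains in $M$ with smooth boundary, $\Omega_1\neq\Omega_2$, and suppose that $X_1,\dots,X_N$ satisfy Hörmander's condition on $\Omega_2$ (the fields and their iterated commutators span the tangent space at every point of $\Omega_2$). Let $p:\overline{\Omega_2}\to(1,\infty)$ be continuous on $\overline{\Omega_2}$ and of class $C^1$ in $\Omega_2$, and let $g$ be a positive bounded measurable function on $\Omega_2$. For $\Omega\in\{\Omega_1,\Omega_2\}$ let $W^{1,p(\cdot)}(\Omega)$ be the space of all $u\in L^{p(\cdot)}(\Omega)$ with weak horizontal gradient $\nabla_Xu\in L^{p(\cdot)}(\Omega)$, normed by $\|u\|_{L^{p(\cdot)}(\Omega)}+\|\nabla_Xu\|_{L^{p(\cdot)}(\Omega)}$ (Luxemburg norms), and let $W^{1,p(\cdot)}_0(\Omega)$ be the closure of $C_0^\infty(\Omega)$ in it. A number $\lambda>0$ is an eigenvalue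 on $\Omega$ if there is $u\in W_0^{1,p(\cdot)}(\Omega)$, $u\neq0$, with $$\int_\Omega|\nabla_Xu|^{p(x)-2}\langle\nabla_Xu,\nabla_X\phi\rangle\,dx-\lambda\int_\Omega g(x)|u|^{p(x)-2}u\,\phi\,dx=0\qquad\text{for all }\phi\in W_0^{1,p(\cdot)}(\Omega);$$ such a $u$ is an eigenfunction corresponding to $\lambda$. Let $\lambda_{1,p}(\Omega)$ denote the least positive eigenvalue on $\Omega$. Suppose that for $i=1,2$ the eigenvalue $\lambda_{1,p}(\Omega_i)>0$ exists and has an eigenfunction $u_i$ with $u_i>0$ a.e. in $\Omega_i$ and $\nabla_Xp\cdot\nabla_Xu_i=0$ a.e. in $\Omega_i$. Then $$\lambda_{1,p}(\Omega_1)>\lambda_{1,p}(\Omega_2).$$ -/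

import Mathlib

open Set Filter MeasureTheory
open scoped Manifold ContDiff Topology ENNReal

noncomputable section

namespace SubLaplacian

/-- A vector field on the `n`-dimensional manifold `M`. -/
abbrev VField (n : ℕ) (M : Type*) [TopologicalSpace M]
    [ChartedSpace (EuclideanSpace ℝ (Fin n)) M] : Type _ :=
  (x : M) → TangentSpace (𝓡 n) x

section Geometry

variable {n N : ℕ} {M : Type*} [TopologicalSpace M]
  [ChartedSpace (EuclideanSpace ℝ (Fin n)) M]

/-- `V` is a smooth vector field. -/
def IsSmoothField [IsManifold (𝓡 n) ∞ M] (V : VField n M) : Prop :=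
  ContMDiff (𝓡 n) (𝓡 n).tangent ∞ (fun x => (⟨x, V x⟩ : TangentBundle (𝓡 n) M))

/-- `V` is one of the `X k` or an iterated commutator of them. -/
inductive IsCommutator (X : Fin N → VField n M) : VField n M → Prop
  | field (k : Fin N) : IsCommutator X (X k)
  | bracket {V W : VField n M} (hV : IsCommutator X V) (hW : IsCommutator X W) :
      IsCommutator X (VectorField.mlieBracket (𝓡 n) V W)

/-- Hörmander's condition on `Ω`: at every point of `Ω` the fields and their iterated commutators
span the tangent space. -/
def HormanderOn (X : Fin N → VField n M) (Ω : Set M) : Prop :=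
  ∀ x ∈ Ω, Submodule.span ℝ {v : TangentSpace (𝓡 n) x | ∃ V, IsCommutator X V ∧ V x = v} = ⊤

/-- `μ` is the measure of a smooth volume element: in every chart it has a smooth, strictly
positive density with respect to Lebesgue measure. -/
def IsSmoothVolume [MeasurableSpace M] (n : ℕ) [ChartedSpace (EuclideanSpace ℝ (Fin n)) M]
    (μ : Measure M) : Prop :=
  ∀ e ∈ atlas (EuclideanSpace ℝ (Fin n)) M, ∃ ρ : EuclideanSpace ℝ (Fin n) → ℝ,
    ContDiffOn ℝ ∞ ρ e.target ∧ (∀ y ∈ e.target, 0 < ρ y) ∧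
    ∀ s ⊆ e.source, MeasurableSet s → μ s = ∫⁻ y in e '' s, ENNReal.ofReal (ρ y)

/-- `Ω` has a smooth boundary: near each boundary point, `Ω` is a strict sublevel set of a smooth
function whose differential does not vanish at that point. -/
def HasSmoothBoundary (n : ℕ) [ChartedSpace (EuclideanSpace ℝ (Fin n)) M] (Ω : Set M) : Prop :=
  ∀ x ∈ frontier Ω, ∃ (U : Set M) (r : M → ℝ), IsOpen U ∧ x ∈ U ∧
    ContMDiffOn (𝓡 n) 𝓘(ℝ, ℝ) ∞ r U ∧ mfderiv (𝓡 n) 𝓘(ℝ, ℝ) r x ≠ 0 ∧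
    ∀ y ∈ U, y ∈ Ω ↔ r y < 0

/-- A bounded (that is, relatively compact) domain with smooth boundary. -/
structure IsSmoothBoundedDomain (n : ℕ) [ChartedSpace (EuclideanSpace ℝ (Fin n)) M]
    (Ω : Set M) : Prop where
  isOpen : IsOpen Ω
  isConnected : IsConnected Ω
  isCompact_closure : IsCompact (closure Ω)
  smoothBoundary : HasSmoothBoundary n Ω

/-- `C₀^∞(Ω)`. -/
structure IsTestFunction (n : ℕ) [ChartedSpace (EuclideanSpace ℝ (Fin n)) M]
    (Ω : Set M) (φ : M → ℝ) : Prop where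
  smooth : ContMDiff (𝓡 n) 𝓘(ℝ, ℝ) ∞ φ
  compact : HasCompactSupport φ
  support_subset : tsupport φ ⊆ Ω

/-- The classical horizontal gradient `∇_X f = (X₁ f, …, X_N f)` of a differentiable function. -/
def hgrad (X : Fin N → VField n M) (f : M → ℝ) (x : M) : EuclideanSpace ℝ (Fin N) :=
  WithLp.toLp 2 fun k => (mfderiv (𝓡 n) 𝓘(ℝ, ℝ) f x (X k x) : ℝ)

/-- The `j`-th coefficient `a_j` of `V = ∑ a_j ∂/∂y_j` in the chart `e`, as a function of the
coordinates. -/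
def coeff (e : OpenPartialHomeomorph M (EuclideanSpace ℝ (Fin n))) (V : VField n M)
    (j : Fin n) (y : EuclideanSpace ℝ (Fin n)) : ℝ :=
  let v : EuclideanSpace ℝ (Fin n) := mfderiv (𝓡 n) (𝓡 n) e (e.symm y) (V (e.symm y))
  v j

/-- The formal adjoint `V^* φ = -∑ ∂(a_j φ)/∂y_j` in the chart `e`. -/
def formalAdjoint (e : OpenPartialHomeomorph M (EuclideanSpace ℝ (Fin n))) (V : VField n M)
    (φ : EuclideanSpace ℝ (Fin n) → ℝ) (y : EuclideanSpace ℝ (Fin n)) : ℝ :=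
  -∑ j, fderiv ℝ (fun z => coeff e V j z * φ z) y (EuclideanSpace.single j 1)

/-- `w = V u` in the sense of distributions on `Ω`. -/
def IsWeakDeriv (V : VField n M) (Ω : Set M) (u w : M → ℝ) : Prop :=
  ∀ e ∈ atlas (EuclideanSpace ℝ (Fin n)) M, ∀ φ : EuclideanSpace ℝ (Fin n) → ℝ,
    ContDiff ℝ ∞ φ → HasCompactSupport φ → tsupport φ ⊆ e.target ∩ e.symm ⁻¹' Ω →
      ∫ y, w (e.symm y) * φ y = ∫ y, u (e.symm y) * formalAdjoint e V φ y

end Geometry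

section Spaces

variable {n N : ℕ} {M : Type*} [TopologicalSpace M]
  [ChartedSpace (EuclideanSpace ℝ (Fin n)) M] [MeasurableSpace M]

/-- `G` is the weak horizontal gradient of `u` on `Ω`. -/
structure IsWeakGrad (μ : Measure M) (X : Fin N → VField n M) (Ω : Set M)
    (u : M → ℝ) (G : M → EuclideanSpace ℝ (Fin N)) : Prop where
  locInt : LocallyIntegrableOn u Ω μ
  locInt_grad : LocallyIntegrableOn G Ω μ
  weak : ∀ k, IsWeakDeriv (X k) Ω u (fun x => G x k)

open Classical in
/-- The weak horizontal gradient `∇_X u` on `Ω` (unique up to null sets; `0` if there is none). -/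
def weakGrad (μ : Measure M) (X : Fin N → VField n M) (Ω : Set M) (u : M → ℝ) :
    M → EuclideanSpace ℝ (Fin N) :=
  if h : ∃ G, IsWeakGrad μ X Ω u G then h.choose else 0

/-- Membership in the variable exponent Lebesgue space `L^{p(·)}(Ω)`. -/
def MemLvar {F : Type*} [NormedAddCommGroup F] (μ : Measure M) (p : M → ℝ) (Ω : Set M)
    (f : M → F) : Prop :=
  AEStronglyMeasurable f (μ.restrict Ω) ∧ ∫⁻ x in Ω, ENNReal.ofReal (‖f x‖ ^ p x) ∂μ < ⊤

/-- The Luxemburg norm on `L^{p(·)}(Ω)`. -/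
def luxNorm {F : Type*} [NormedAddCommGroup F] (μ : Measure M) (p : M → ℝ) (Ω : Set M)
    (f : M → F) : ℝ :=
  sInf {t : ℝ | 0 < t ∧ ∫⁻ x in Ω, ENNReal.ofReal ((‖f x‖ / t) ^ p x) ∂μ ≤ 1}

/-- Membership in the variable exponent Sobolev space `W^{1,p(·)}(Ω)`. -/
structure MemW (μ : Measure M) (X : Fin N → VField n M) (p : M → ℝ) (Ω : Set M)
    (u : M → ℝ) : Prop where
  memL : MemLvar μ p Ω u
  hasGrad : ∃ G, IsWeakGrad μ X Ω u G
  memL_grad : MemLvar μ p Ω (weakGrad μ X Ω u)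

/-- Membership in `W₀^{1,p(·)}(Ω)`, the closure of `C₀^∞(Ω)` in `W^{1,p(·)}(Ω)`. -/
structure MemW0 (μ : Measure M) (X : Fin N → VField n M) (p : M → ℝ) (Ω : Set M)
    (u : M → ℝ) : Prop where
  memW : MemW μ X p Ω u
  approx : ∃ φ : ℕ → M → ℝ, (∀ i, IsTestFunction n Ω (φ i)) ∧
    Tendsto (fun i => luxNorm μ p Ω (fun x => u x - φ i x)
      + luxNorm μ p Ω (fun x => weakGrad μ X Ω u x - hgrad X (φ i) x)) atTop (𝓝 0)

/-- `u ∈ W₀^{1,p(·)}(Ω)` and `lam > 0` satisfy, in the weak sense, the Dirichlet problem for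
`∑ X_k^* (|∇_X u|^{p(x)-2} X_k u) = lam g |u|^{p(x)-2} u` in `Ω`, `u = 0` on `∂Ω`. -/
structure IsWeakSolution (μ : Measure M) (X : Fin N → VField n M) (p g : M → ℝ) (Ω : Set M)
    (u : M → ℝ) (lam : ℝ) : Prop where
  pos : 0 < lam
  memW0 : MemW0 μ X p Ω u
  eqn : ∀ φ : M → ℝ, MemW0 μ X p Ω φ →
    (∫ x in Ω, ‖weakGrad μ X Ω u x‖ ^ (p x - 2)
        * inner ℝ (weakGrad μ X Ω u x) (weakGrad μ X Ω φ x) ∂μ)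
      - lam * ∫ x in Ω, g x * |u x| ^ (p x - 2) * u x * φ x ∂μ = 0

/-- The set of (positive) eigenvalues of the Dirichlet problem on `Ω`. -/
def eigenvalues (μ : Measure M) (X : Fin N → VField n M) (p g : M → ℝ) (Ω : Set M) : Set ℝ :=
  {lam | ∃ u : M → ℝ, ¬ (u =ᵐ[μ.restrict Ω] 0) ∧ IsWeakSolution μ X p g Ω u lam}

/-- The principal eigenvalue `λ_{1,p}(Ω)`: the least positive eigenvalue. It is only meaningful
when the infimum is attained, that is, when there is a corresponding eigenfunction. -/
def principalEigenvalue (μ : Measure M) (X : Fin N → VField n M) (p g : M → ℝ) (Ω : Set M) : ℝ :=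
  sInf (eigenvalues μ X p g Ω)

/-- `u` is a principal eigenfunction on `Ω`: a solution, positive in `Ω`, of the Dirichlet problem
with `lam = λ_{1,p}(Ω)`. -/
structure IsPrincipalEigenfunction (μ : Measure M) (X : Fin N → VField n M) (p g : M → ℝ)
    (Ω : Set M) (u : M → ℝ) : Prop where
  solution : IsWeakSolution μ X p g Ω u (principalEigenvalue μ X p g Ω)
  positive : ∀ᵐ x ∂(μ.restrict Ω), 0 < u x

end Spaces

end SubLaplacian

end

/-! Write `λ₁`, `λ₂` for the two principal eigenvalues and suppose `λ₁ ≤ λ₂`. Test the equation of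
`u₂` with a regularization of `|φ|^p u₂^(1-p)`, where `φ` is a test function on the smaller domain.
Differentiating the variable exponent produces multiples of `∇_X p`, and these drop out because `∇_X
p` is orthogonal to `∇_X u₂`. What remains is Picone's identity with a nonnegative remainder
(`picone_inequality`). Letting `φ → u₁` and using Fatou's lemma gives `∫ R + λ₂ ∫ g u₁^p ≤ ∫ ‖∇_X
u₁‖^p = λ₁ ∫ g u₁^p` over `Ω₁` (`picone_limit` and the energy identity of `u₁`). Hence `R = 0`
almost everywhere, and the equality cases of Young and Cauchy–Schwarz yield `∇_X u₁ = (u₁/u₂) ∇_X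
u₂` (`grad_eq_smul_of_le`).

The contradiction does not go through a Harnack inequality or a strong maximum principle. Let `U` be
`u₁` extended by zero to `Ω₂`. Then `‖∇_X U‖ = U h` with `h = ‖∇_X u₂‖/u₂`, and `h` is locally
integrable on `Ω₂`: this is the logarithmic Caccioppoli estimate, read off from the same Picone
inequality with a cutoff in place of `φ` (`lintegral_norm_div_lt_top`). The functions `U²/(U²+κ)`
tend to the indicator of `Ω₁` as `κ → 0`; their gradients are bounded by `2h` and tend to zero. So
the indicator of `Ω₁` has zero horizontal gradient in `Ω₂` (`isWeakDeriv_indicator_one`).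

Hörmander's condition forbids this. The smooth fields along which a distribution has zero derivative
form a class closed under brackets and under combinations with smooth coefficients, so all constant
fields in a chart belong to it near each point (`exists_annihilates_const_of_hormander`), and the
indicator is locally constant almost everywhere. Since `Ω₂` is connected and `Ω₁ ≠ Ω₂`, some
boundary point of `Ω₁` lies in `Ω₂`; smoothness of the boundary puts open pieces of both `Ω₁` and
its exterior arbitrarily near that point (`not_isWeakDeriv_indicator`).

Analytically, everything about `W₀^{1,p(·)}` is done with pairs `(u, G)` that are limits of test
functions in the modular (`IsW0Limit`), which avoids duality and reflexivity. -/

noncomputable section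

namespace SubLaplacian

/-! ### Young's inequality and the pointwise Picone remainder. -/

section Pointwise

/-- The remainder in Young's inequality `p y^(p-1) x ≤ x^p + (p-1) y^p`. -/
theorem young_remainder_pos {p x y : ℝ} (hp : 1 < p) (hx : 0 ≤ x) (hy : 0 ≤ y) (hxy : x ≠ y) :
    0 < x ^ p - p * y ^ (p - 1) * x + (p - 1) * y ^ p := by
  rcases hy.eq_or_lt with rfl | hy
  · have hx' : 0 < x := lt_of_le_of_ne hx (Ne.symm hxy)
    rw [Real.zero_rpow (by linarith), Real.zero_rpow (by linarith)]
    have := Real.rpow_pos_of_pos hx' p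
    simpa using this
  have h1 : x / y - 1 ≠ 0 := by
    rw [sub_ne_zero, Ne, div_eq_one_iff_eq hy.ne']; exact hxy
  have h2 := one_add_mul_self_lt_rpow_one_add (s := x / y - 1)
    (by have := div_nonneg hx hy.le; linarith) h1 hp
  have h3 : (1 + (x / y - 1)) ^ p * y ^ p = x ^ p := by
    rw [add_sub_cancel, Real.div_rpow hx hy.le, div_mul_cancel₀ _ (Real.rpow_pos_of_pos hy p).ne']
  have h4 : y ^ p = y ^ (p - 1) * y := by
    rw [← Real.rpow_add_one hy.ne']; congr 1; ring
  have h5 := mul_lt_mul_of_pos_right h2 (Real.rpow_pos_of_pos hy p)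
  rw [h3] at h5
  have h6 : (1 + p * (x / y - 1)) * y ^ p = p * y ^ (p - 1) * x - (p - 1) * y ^ p := by
    rw [h4]; field_simp; ring
  linarith

theorem young_remainder_nonneg {p x y : ℝ} (hp : 1 < p) (hx : 0 ≤ x) (hy : 0 ≤ y) :
    0 ≤ x ^ p - p * y ^ (p - 1) * x + (p - 1) * y ^ p := by
  by_cases h : x = y
  · subst h
    rcases hx.eq_or_lt with rfl | hx
    · rw [Real.zero_rpow (by linarith)]; simp
    have h4 : x ^ p = x ^ (p - 1) * x := by
      rw [← Real.rpow_add_one hx.ne']; congr 1; ring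
    rw [h4]; apply le_of_eq; ring
  · exact (young_remainder_pos hp hx hy h).le

/-- Two cases: if `y ≤ 2p/(p-1) · x` the first term alone suffices; otherwise the mixed term is at
most half of `(p-1) y^p`, so the remainder absorbs `y^p`. This coercivity later turns Picone's
inequality into a bound on the logarithmic gradient. -/
theorem rpow_le_young_remainder {p x y : ℝ} (hp : 1 < p) (hx : 0 ≤ x) (hy : 0 ≤ y) :
    y ^ p ≤ (2 * p / (p - 1)) ^ p * x ^ p
      + 2 / (p - 1) * (x ^ p - p * y ^ (p - 1) * x + (p - 1) * y ^ p) := by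
  have hp1 : 0 < p - 1 := by linarith
  have hK : 0 ≤ 2 * p / (p - 1) := by positivity
  have hR := young_remainder_nonneg hp hx hy
  have hR' : 0 ≤ 2 / (p - 1) * (x ^ p - p * y ^ (p - 1) * x + (p - 1) * y ^ p) := by positivity
  rcases le_total y (2 * p / (p - 1) * x) with h | h
  · have := Real.rpow_le_rpow hy h (by linarith : (0:ℝ) ≤ p)
    rw [Real.mul_rpow hK hx] at this
    linarith
  · rcases hy.eq_or_lt with rfl | hy
    · rw [Real.zero_rpow (by linarith : p ≠ 0)] at *
      positivity
    have h4 : y ^ p = y ^ (p - 1) * y := by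
      rw [← Real.rpow_add_one hy.ne']; congr 1; ring
    have h7 : 2 * p * x ≤ (p - 1) * y := by
      rw [div_mul_eq_mul_div, div_le_iff₀ hp1] at h; linarith
    have h8 : 2 * (p * y ^ (p - 1) * x) ≤ (p - 1) * y ^ p := by
      rw [h4]
      have := mul_le_mul_of_nonneg_left h7 (Real.rpow_pos_of_pos hy (p - 1)).le
      linarith
    have hx0 : 0 ≤ x ^ p := Real.rpow_nonneg hx p
    have h9 : (p - 1) / 2 * y ^ p ≤ x ^ p - p * y ^ (p - 1) * x + (p - 1) * y ^ p := by linarith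
    have h10 := mul_le_mul_of_nonneg_left h9 (by positivity : 0 ≤ 2 / (p - 1))
    have h11 : 2 / (p - 1) * ((p - 1) / 2 * y ^ p) = y ^ p := by field_simp
    rw [h11] at h10
    have : 0 ≤ (2 * p / (p - 1)) ^ p * x ^ p := by positivity
    linarith

variable {F : Type*} [NormedAddCommGroup F] [InnerProductSpace ℝ F]

/-- The Picone remainder with gradients `a`, `b`, quotient `s` and sign factor `τ`. -/
def piconeRemainder (p s τ : ℝ) (a b : F) : ℝ :=
  ‖a‖ ^ p - p * s ^ (p - 1) * τ * (‖b‖ ^ (p - 2) * inner ℝ b a) + (p - 1) * (s * ‖b‖) ^ p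

/-- Cauchy–Schwarz, with `b = 0` treated apart because the exponent `p - 2` may be negative. -/
theorem norm_rpow_mul_inner_le {p : ℝ} (hp : 1 < p) (a b : F) :
    |‖b‖ ^ (p - 2) * inner ℝ b a| ≤ ‖b‖ ^ (p - 1) * ‖a‖ := by
  rcases eq_or_ne b 0 with rfl | hb
  · simp [Real.zero_rpow (show p - 1 ≠ 0 by linarith)]
  rw [abs_mul, abs_of_nonneg (by positivity)]
  have h : ‖b‖ ^ (p - 1) = ‖b‖ ^ (p - 2) * ‖b‖ := by
    rw [← Real.rpow_add_one (norm_ne_zero_iff.2 hb)]; congr 1; ring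
  rw [h, mul_assoc]
  exact mul_le_mul_of_nonneg_left (abs_real_inner_le_norm b a) (by positivity)

/-- The factor `τ` will be the smoothed sign `φ/√(φ²+δ²)` or its limit `1`. Only `|τ| ≤ 1` matters:
Cauchy–Schwarz then reduces the vector remainder to the scalar one with `x = ‖a‖` and `y = s‖b‖`. -/
theorem young_remainder_le_piconeRemainder {p s τ : ℝ} (hp : 1 < p) (hs : 0 ≤ s) (hτ : |τ| ≤ 1)
    (a b : F) :
    ‖a‖ ^ p - p * (s * ‖b‖) ^ (p - 1) * ‖a‖ + (p - 1) * (s * ‖b‖) ^ p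
      ≤ piconeRemainder p s τ a b := by
  have h := norm_rpow_mul_inner_le hp a b
  have h2 : τ * (‖b‖ ^ (p - 2) * inner ℝ b a) ≤ ‖b‖ ^ (p - 1) * ‖a‖ := by
    refine (le_abs_self _).trans ?_
    rw [abs_mul]
    exact (mul_le_of_le_one_left (abs_nonneg _) hτ).trans h
  unfold piconeRemainder
  rw [Real.mul_rpow (z := p - 1) hs (norm_nonneg b)]
  have h3 := mul_le_mul_of_nonneg_left h2 (by positivity : 0 ≤ p * s ^ (p - 1))
  have e1 : p * s ^ (p - 1) * (τ * (‖b‖ ^ (p - 2) * inner ℝ b a))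
    = p * s ^ (p - 1) * τ * (‖b‖ ^ (p - 2) * inner ℝ b a) := by ring
  have e2 : p * s ^ (p - 1) * (‖b‖ ^ (p - 1) * ‖a‖)
    = p * (s ^ (p - 1) * ‖b‖ ^ (p - 1)) * ‖a‖ := by ring
  linarith

theorem piconeRemainder_nonneg {p s τ : ℝ} (hp : 1 < p) (hs : 0 ≤ s) (hτ : |τ| ≤ 1) (a b : F) :
    0 ≤ piconeRemainder p s τ a b :=
  (young_remainder_nonneg hp (norm_nonneg a) (by positivity : 0 ≤ s * ‖b‖)).trans
    (young_remainder_le_piconeRemainder hp hs hτ a b)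

theorem rpow_le_piconeRemainder {p s τ : ℝ} (hp : 1 < p) (hs : 0 ≤ s) (hτ : |τ| ≤ 1) (a b : F) :
    (s * ‖b‖) ^ p ≤ (2 * p / (p - 1)) ^ p * ‖a‖ ^ p + 2 / (p - 1) * piconeRemainder p s τ a b := by
  have hp1 : 0 < p - 1 := by linarith
  refine (rpow_le_young_remainder hp (norm_nonneg a) (by positivity)).trans ?_
  gcongr
  exact young_remainder_le_piconeRemainder hp hs hτ a b

/-- The equality case of Picone's inequality. -/
theorem eq_smul_of_piconeRemainder_eq_zero {p s : ℝ} (hp : 1 < p) (hs : 0 < s) {a b : F}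
    (h : piconeRemainder p s 1 a b = 0) : a = s • b := by
  -- Young's inequality is strict off the diagonal, so a vanishing remainder forces equal norms.
  -- What is left of the remainder is then the defect in Cauchy–Schwarz.
  have h1 : ‖a‖ = s * ‖b‖ := by
    by_contra hne
    have := young_remainder_pos hp (norm_nonneg a) (by positivity) hne
    have := young_remainder_le_piconeRemainder hp hs.le (by simp : |(1:ℝ)| ≤ 1) a b
    linarith
  rcases eq_or_ne b 0 with rfl | hb
  · simpa using h1
  have hb' : 0 < ‖b‖ := norm_pos_iff.2 hb
  unfold piconeRemainder at h
  rw [h1] at h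
  have e0 : (s * ‖b‖) ^ p = s ^ (p - 1) * s * (‖b‖ ^ (p - 2) * ‖b‖ * ‖b‖) := by
    rw [Real.mul_rpow hs.le hb'.le, ← Real.rpow_add_one hs.ne', ← Real.rpow_add_one hb'.ne',
      ← Real.rpow_add_one hb'.ne']
    congr 2 <;> ring
  rw [e0] at h
  have h2 : p * s ^ (p - 1) * ‖b‖ ^ (p - 2) * (s * ‖b‖ * ‖b‖ - inner ℝ b a) = 0 := by
    rw [← h]; ring
  have h3 : inner ℝ b a = s * ‖b‖ * ‖b‖ := by
    have : p * s ^ (p - 1) * ‖b‖ ^ (p - 2) ≠ 0 := by positivity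
    rcases mul_eq_zero.1 h2 with h | h
    · exact absurd h this
    · linarith
  have h4 : ‖a - s • b‖ ^ 2 = 0 := by
    rw [norm_sub_sq_real, h1, norm_smul, Real.norm_of_nonneg hs.le, inner_smul_right,
      real_inner_comm, h3]
    ring
  simpa [sub_eq_zero] using h4

end Pointwise

/-! ### The modular of a variable exponent and its limit theorems. -/

section Modular

variable {α : Type*} [MeasurableSpace α] {F : Type*} [NormedAddCommGroup F]

/-- The modular `∫ ‖f‖^p` of the variable exponent Lebesgue space. -/
def modular (ν : Measure α) (p : α → ℝ) (f : α → F) : ℝ≥0∞ :=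
  ∫⁻ x, ENNReal.ofReal (‖f x‖ ^ p x) ∂ν

/-- `p` is a measurable exponent with values in `(1, P]`. -/
structure IsExponent (ν : Measure α) (p : α → ℝ) (P : ℝ) : Prop where
  aemeasurable : AEMeasurable p ν
  one_lt : ∀ᵐ x ∂ν, 1 < p x
  le : ∀ᵐ x ∂ν, p x ≤ P

variable {ν : Measure α} {p : α → ℝ} {P : ℝ}

theorem IsExponent.restrict {ν' : Measure α} (hp : IsExponent ν p P) (h : ν' ≤ ν) :
    IsExponent ν' p P :=
  ⟨hp.aemeasurable.mono_measure h, ae_mono h hp.one_lt, ae_mono h hp.le⟩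

theorem aemeasurable_norm_rpow (hp : AEMeasurable p ν) {f : α → F}
    (hf : AEStronglyMeasurable f ν) :
    AEMeasurable (fun x => ENNReal.ofReal (‖f x‖ ^ p x)) ν :=
  (hf.norm.aemeasurable.pow hp).ennreal_ofReal

theorem add_rpow_le_two_rpow {a b p : ℝ} (ha : 0 ≤ a) (hb : 0 ≤ b) (hp : 0 ≤ p) :
    (a + b) ^ p ≤ 2 ^ p * (a ^ p + b ^ p) := by
  rcases le_total a b with h | h
  · calc (a + b) ^ p ≤ (2 * b) ^ p := by gcongr; linarith
      _ = 2 ^ p * b ^ p := Real.mul_rpow (by norm_num) hb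
      _ ≤ _ := by gcongr; linarith [Real.rpow_nonneg ha p]
  · calc (a + b) ^ p ≤ (2 * a) ^ p := by gcongr; linarith
      _ = 2 ^ p * a ^ p := Real.mul_rpow (by norm_num) ha
      _ ≤ _ := by gcongr; linarith [Real.rpow_nonneg hb p]

theorem modular_add_le (hp : IsExponent ν p P) {f g : α → F} (hf : AEStronglyMeasurable f ν) :
    modular ν p (fun x => f x + g x)
      ≤ ENNReal.ofReal (2 ^ P) * (modular ν p f + modular ν p g) := by
  unfold modular
  rw [← lintegral_add_left' (aemeasurable_norm_rpow hp.aemeasurable hf),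
    ← lintegral_const_mul' _ _ ENNReal.ofReal_ne_top]
  refine lintegral_mono_ae ?_
  filter_upwards [hp.one_lt, hp.le] with x h1 h2
  rw [← ENNReal.ofReal_add (by positivity) (by positivity),
    ← ENNReal.ofReal_mul (by positivity)]
  refine ENNReal.ofReal_le_ofReal ?_
  calc ‖f x + g x‖ ^ p x ≤ (‖f x‖ + ‖g x‖) ^ p x :=
        Real.rpow_le_rpow (norm_nonneg _) (norm_add_le _ _) (by linarith)
    _ ≤ 2 ^ p x * (‖f x‖ ^ p x + ‖g x‖ ^ p x) :=
        add_rpow_le_two_rpow (norm_nonneg _) (norm_nonneg _) (by linarith)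
    _ ≤ _ := by gcongr; norm_num

theorem modular_neg (f : α → F) : modular ν p (fun x => -f x) = modular ν p f := by
  simp [modular]

theorem modular_sub_le (hp : IsExponent ν p P) {f g : α → F} (hf : AEStronglyMeasurable f ν) :
    modular ν p (fun x => f x - g x)
      ≤ ENNReal.ofReal (2 ^ P) * (modular ν p f + modular ν p g) := by
  have := modular_add_le hp (g := fun x => -g x) hf
  simpa only [modular_neg, ← sub_eq_add_neg] using this

theorem modular_congr {f g : α → F} (h : f =ᵐ[ν] g) : modular ν p f = modular ν p g := by
  refine lintegral_congr_ae ?_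
  filter_upwards [h] with x hx
  rw [hx]

theorem modular_smul_le [NormedSpace ℝ F] (hp : IsExponent ν p P) {c : α → ℝ} {C : ℝ}
    (hC : 1 ≤ C) (hc : ∀ᵐ x ∂ν, |c x| ≤ C) (f : α → F) :
    modular ν p (fun x => c x • f x) ≤ ENNReal.ofReal (C ^ P) * modular ν p f := by
  unfold modular
  rw [← lintegral_const_mul' _ _ ENNReal.ofReal_ne_top]
  refine lintegral_mono_ae ?_
  filter_upwards [hp.one_lt, hp.le, hc] with x h1 h2 h3
  rw [← ENNReal.ofReal_mul (by positivity)]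
  refine ENNReal.ofReal_le_ofReal ?_
  rw [norm_smul, Real.mul_rpow (norm_nonneg _) (norm_nonneg _)]
  gcongr
  calc ‖c x‖ ^ p x ≤ C ^ p x := Real.rpow_le_rpow (norm_nonneg _) h3 (by linarith)
    _ ≤ C ^ P := Real.rpow_le_rpow_of_exponent_le hC h2

theorem modular_lt_top_of_bounded [IsFiniteMeasure ν] (hp : IsExponent ν p P) {f : α → F} {C : ℝ}
    (h : ∀ᵐ x ∂ν, ‖f x‖ ≤ C) : modular ν p f < ⊤ := by
  -- The base is enlarged to at least 1 so that raising the exponent from `p x` to `P` can only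
  -- increase the power.
  have : modular ν p f ≤ ∫⁻ _, ENNReal.ofReal ((max C 1) ^ P) ∂ν := by
    refine lintegral_mono_ae ?_
    filter_upwards [h, hp.one_lt, hp.le] with x h0 h1 h2
    refine ENNReal.ofReal_le_ofReal ?_
    calc ‖f x‖ ^ p x ≤ (max C 1) ^ p x :=
          Real.rpow_le_rpow (norm_nonneg _) (h0.trans (le_max_left _ _)) (by linarith)
      _ ≤ _ := Real.rpow_le_rpow_of_exponent_le (le_max_right _ _) h2
  refine this.trans_lt ?_
  rw [lintegral_const]
  exact ENNReal.mul_lt_top ENNReal.ofReal_lt_top (measure_lt_top _ _)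

theorem tendsto_modular_zero_of_dominated (hp : IsExponent ν p P) {f : ℕ → α → F}
    (hf : ∀ i, AEStronglyMeasurable (f i) ν) {b : α → ℝ} (hb : modular ν p b < ⊤)
    (hfb : ∀ i, ∀ᵐ x ∂ν, ‖f i x‖ ≤ b x)
    (hlim : ∀ᵐ x ∂ν, Tendsto (fun i => f i x) atTop (𝓝 0)) :
    Tendsto (fun i => modular ν p (f i)) atTop (𝓝 0) := by
  have := tendsto_lintegral_of_dominated_convergence' (μ := ν) (f := fun _ => 0)
    (F := fun i x => ENNReal.ofReal (‖f i x‖ ^ p x))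
    (fun x => ENNReal.ofReal (‖b x‖ ^ p x))
    (fun i => aemeasurable_norm_rpow hp.aemeasurable (hf i))
    (fun i => ?_) hb.ne ?_
  · simpa [modular] using this
  · filter_upwards [hfb i, hp.one_lt] with x h1 h2
    exact ENNReal.ofReal_le_ofReal
      (Real.rpow_le_rpow (norm_nonneg _) (h1.trans (le_abs_self _)) (by linarith))
  · filter_upwards [hlim, hp.one_lt] with x h1 h2
    have h3 : Tendsto (fun i => ‖f i x‖ ^ p x) atTop (𝓝 (0 ^ p x)) :=
      (by simpa using h1.norm : Tendsto (fun i => ‖f i x‖) atTop (𝓝 0)).rpow_const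
        (Or.inr (by linarith))
    rw [Real.zero_rpow (by linarith)] at h3
    simpa using ENNReal.tendsto_ofReal h3

/-- The functions `‖f i‖ ^ p` tend to zero in `L¹`, hence in measure, hence almost everywhere along
a subsequence; the power `1 / p x` then removes the exponent pointwise. -/
theorem exists_subseq_tendsto_ae_of_modular (hp : IsExponent ν p P) {f : ℕ → α → F}
    (hf : ∀ i, AEStronglyMeasurable (f i) ν)
    (h : Tendsto (fun i => modular ν p (f i)) atTop (𝓝 0)) :
    ∃ ns : ℕ → ℕ, StrictMono ns ∧ ∀ᵐ x ∂ν, Tendsto (fun i => f (ns i) x) atTop (𝓝 0) := by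
  have h1 : TendstoInMeasure ν (fun i x => ‖f i x‖ ^ p x) atTop (fun _ => 0) := by
    refine tendstoInMeasure_of_tendsto_eLpNorm (p := 1) one_ne_zero
      (fun i => (hf i).norm.aemeasurable.pow hp.aemeasurable |>.aestronglyMeasurable)
      aestronglyMeasurable_const ?_
    refine h.congr fun i => ?_
    rw [eLpNorm_one_eq_lintegral_enorm]
    refine lintegral_congr fun x => ?_
    simp only [Pi.sub_apply, sub_zero]
    rw [Real.enorm_eq_ofReal (by positivity)]
  obtain ⟨ns, h2, h3⟩ := h1.exists_seq_tendsto_ae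
  refine ⟨ns, h2, ?_⟩
  filter_upwards [h3, hp.one_lt] with x h4 h5
  have h6 := h4.rpow_const (p := (p x)⁻¹) (Or.inr (by positivity))
  rw [Real.zero_rpow (by positivity)] at h6
  rw [tendsto_zero_iff_norm_tendsto_zero]
  refine h6.congr fun i => ?_
  rw [Real.rpow_rpow_inv (norm_nonneg _) (by linarith)]

/-- For `a ≥ δ` write `a = a^(1-p) a^p` and use `a^(1-p) ≤ δ^(1-p) ≤ δ^(1-P)`. This takes the place
of Hölder's inequality: it compares `L¹` with the modular without any dual exponent. -/
theorem enorm_le_add_modular {p a : ℝ} (hp : 1 < p) (ha : 0 ≤ a) {δ : ℝ} (hδ : 0 < δ)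
    (hδ1 : δ ≤ 1) {P : ℝ} (hP : p ≤ P) : a ≤ δ + δ ^ (1 - P) * a ^ p := by
  rcases le_total a δ with h | h
  · have : 0 ≤ δ ^ (1 - P) * a ^ p := by positivity
    linarith
  · have ha' : 0 < a := hδ.trans_le h
    have h1 : a = a ^ (1 - p) * a ^ p := by
      rw [← Real.rpow_add ha']; simp
    have h2 : a ^ (1 - p) ≤ δ ^ (1 - p) :=
      Real.rpow_le_rpow_of_nonpos hδ h (by linarith)
    have h3 : δ ^ (1 - p) ≤ δ ^ (1 - P) :=
      Real.rpow_le_rpow_of_exponent_ge hδ hδ1 (by linarith)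
    have h4 : a ^ (1 - p) * a ^ p ≤ δ ^ (1 - P) * a ^ p := by gcongr; linarith
    linarith

theorem lintegral_enorm_le_modular (hp : IsExponent ν p P) (f : α → F) {δ : ℝ} (hδ : 0 < δ)
    (hδ1 : δ ≤ 1) : ∫⁻ x, ‖f x‖ₑ ∂ν
      ≤ ENNReal.ofReal δ * ν univ + ENNReal.ofReal (δ ^ (1 - P)) * modular ν p f := by
  unfold modular
  rw [← lintegral_const_mul' _ _ ENNReal.ofReal_ne_top, ← lintegral_const,
    ← lintegral_add_left' aemeasurable_const]
  refine lintegral_mono_ae ?_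
  filter_upwards [hp.one_lt, hp.le] with x h1 h2
  rw [← ofReal_norm, ← ENNReal.ofReal_mul (by positivity),
    ← ENNReal.ofReal_add (by positivity) (by positivity)]
  exact ENNReal.ofReal_le_ofReal (enorm_le_add_modular h1 (norm_nonneg _) hδ hδ1 h2)

theorem integrable_of_modular_lt_top [IsFiniteMeasure ν] (hp : IsExponent ν p P) {f : α → F}
    (hf : AEStronglyMeasurable f ν) (h : modular ν p f < ⊤) : Integrable f ν := by
  refine ⟨hf, (lintegral_enorm_le_modular hp f one_pos le_rfl).trans_lt ?_⟩
  exact ENNReal.add_lt_top.2 ⟨ENNReal.mul_lt_top ENNReal.ofReal_lt_top (measure_lt_top _ _),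
    ENNReal.mul_lt_top ENNReal.ofReal_lt_top h⟩

theorem tendsto_lintegral_enorm_of_modular [IsFiniteMeasure ν] (hp : IsExponent ν p P)
    {f : ℕ → α → F} (h : Tendsto (fun i => modular ν p (f i)) atTop (𝓝 0)) :
    Tendsto (fun i => ∫⁻ x, ‖f i x‖ₑ ∂ν) atTop (𝓝 0) := by
  rw [ENNReal.tendsto_nhds_zero]
  intro ε hε
  -- `δ` is fixed first, using that `ν` is finite; only afterwards is the modular made small against
  -- the large factor `δ^(1-P)`.
  obtain ⟨δ, hδ, hδ1, hδ2⟩ : ∃ δ : ℝ, 0 < δ ∧ δ ≤ 1 ∧ ENNReal.ofReal δ * ν univ ≤ ε / 2 := by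
    have : Tendsto (fun δ : ℝ => ENNReal.ofReal δ * ν univ) (𝓝[>] 0) (𝓝 (ENNReal.ofReal 0 * ν univ)) :=
      ENNReal.Tendsto.mul_const
        (ENNReal.tendsto_ofReal (tendsto_nhdsWithin_of_tendsto_nhds tendsto_id))
        (Or.inr (measure_ne_top _ _))
    rw [ENNReal.ofReal_zero, zero_mul] at this
    have h2 := (ENNReal.tendsto_nhds_zero.1 this) (ε / 2) (by simpa using hε.ne')
    obtain ⟨δ, h3, h4⟩ := (h2.and (Ioc_mem_nhdsGT (zero_lt_one' ℝ))).exists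
    exact ⟨δ, h4.1, h4.2, h3⟩
  have h5 : Tendsto (fun i => ENNReal.ofReal (δ ^ (1 - P)) * modular ν p (f i)) atTop (𝓝 0) := by
    have := ENNReal.Tendsto.const_mul (a := ENNReal.ofReal (δ ^ (1 - P))) h
      (Or.inr ENNReal.ofReal_ne_top)
    simpa using this
  filter_upwards [(ENNReal.tendsto_nhds_zero.1 h5) (ε / 2) (by simpa using hε.ne')] with i hi
  calc _ ≤ _ := lintegral_enorm_le_modular hp (f i) hδ hδ1
    _ ≤ ε / 2 + ε / 2 := add_le_add hδ2 hi
    _ = ε := ENNReal.add_halves ε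

end Modular

/-! ### Luxemburg norm against modular. -/

section Luxemburg

variable {M : Type*} [MeasurableSpace M] {F : Type*} [NormedAddCommGroup F]
  {μ : Measure M} {p : M → ℝ} {P : ℝ} {Ω : Set M}

theorem luxNorm_nonneg (f : M → F) : 0 ≤ luxNorm μ p Ω f :=
  Real.sInf_nonneg fun _ ht => ht.1.le

/-- For `s ≤ 1` one has `s^p ≤ s`, so the modular of `f` is at most `s` times that of `f / s`.
Together with `luxNorm_le_of_modular_le` this makes convergence to zero in norm and in modular
interchangeable. -/
theorem modular_le_of_luxNorm_lt (hp : IsExponent (μ.restrict Ω) p P) {f : M → F}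
    (hf : modular (μ.restrict Ω) p f < ⊤) {t : ℝ} (ht1 : t ≤ 1) (ht : luxNorm μ p Ω f < t) :
    modular (μ.restrict Ω) p f ≤ ENNReal.ofReal t := by
  -- The infimum is informative only over a nonempty set, since `sInf ∅ = 0`; finiteness of the
  -- modular supplies the member `max 1 m`.
  have hne : {t : ℝ | 0 < t ∧
      ∫⁻ x in Ω, ENNReal.ofReal ((‖f x‖ / t) ^ p x) ∂μ ≤ 1}.Nonempty := by
    set m := (modular (μ.restrict Ω) p f).toReal with hm
    have hT : 0 < max 1 m := lt_max_of_lt_left one_pos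
    refine ⟨max 1 m, hT, ?_⟩
    have : ∫⁻ x in Ω, ENNReal.ofReal ((‖f x‖ / max 1 m) ^ p x) ∂μ
        ≤ ENNReal.ofReal ((max 1 m)⁻¹) * modular (μ.restrict Ω) p f := by
      unfold modular
      rw [← lintegral_const_mul' _ _ ENNReal.ofReal_ne_top]
      refine lintegral_mono_ae ?_
      filter_upwards [hp.one_lt] with x h1
      rw [← ENNReal.ofReal_mul (by positivity)]
      refine ENNReal.ofReal_le_ofReal ?_
      rw [Real.div_rpow (norm_nonneg _) hT.le, div_eq_inv_mul]
      gcongr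
      exact Real.self_le_rpow_of_one_le (le_max_left _ _) h1.le
    refine this.trans ?_
    rw [← ENNReal.ofReal_toReal hf.ne, ← ENNReal.ofReal_mul (by positivity)]
    rw [← ENNReal.ofReal_one]
    refine ENNReal.ofReal_le_ofReal ?_
    rw [inv_mul_le_iff₀ hT, mul_one]
    exact le_max_right _ _
  obtain ⟨s, ⟨hs0, hs⟩, hst⟩ := exists_lt_of_csInf_lt hne ht
  have hs1 : s ≤ 1 := hst.le.trans ht1
  calc modular (μ.restrict Ω) p f
      ≤ ENNReal.ofReal s * ∫⁻ x in Ω, ENNReal.ofReal ((‖f x‖ / s) ^ p x) ∂μ := by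
        unfold modular
        rw [← lintegral_const_mul' _ _ ENNReal.ofReal_ne_top]
        refine lintegral_mono_ae ?_
        filter_upwards [hp.one_lt] with x h1
        rw [← ENNReal.ofReal_mul (by positivity)]
        refine ENNReal.ofReal_le_ofReal ?_
        rw [Real.div_rpow (norm_nonneg _) hs0.le]
        have h2 : s ^ p x ≤ s := Real.rpow_le_self_of_le_one hs0.le hs1 h1.le
        have h3 : 0 < s ^ p x := Real.rpow_pos_of_pos hs0 _
        rw [mul_div_assoc', le_div_iff₀ h3, mul_comm]
        gcongr
    _ ≤ ENNReal.ofReal s * 1 := by gcongr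
    _ ≤ ENNReal.ofReal t := by rw [mul_one]; exact ENNReal.ofReal_le_ofReal hst.le

theorem tendsto_modular_of_tendsto_luxNorm (hp : IsExponent (μ.restrict Ω) p P) {f : ℕ → M → F}
    (hf : ∀ i, modular (μ.restrict Ω) p (f i) < ⊤)
    (h : Tendsto (fun i => luxNorm μ p Ω (f i)) atTop (𝓝 0)) :
    Tendsto (fun i => modular (μ.restrict Ω) p (f i)) atTop (𝓝 0) := by
  rw [ENNReal.tendsto_nhds_zero]
  intro ε hε
  obtain ⟨t, ht0, ht1, ht2⟩ : ∃ t : ℝ, 0 < t ∧ t ≤ 1 ∧ ENNReal.ofReal t ≤ ε := by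
    rcases eq_or_ne ε ⊤ with rfl | h
    · exact ⟨1, one_pos, le_rfl, le_top⟩
    · refine ⟨min 1 ε.toReal, lt_min one_pos (ENNReal.toReal_pos hε.ne' h), min_le_left _ _, ?_⟩
      exact ENNReal.ofReal_le_of_le_toReal (min_le_right _ _)
  filter_upwards [h.eventually_lt_const ht0] with i hi
  exact (modular_le_of_luxNorm_lt hp (hf i) ht1 hi).trans ht2

theorem luxNorm_le_of_modular_le (hp : IsExponent (μ.restrict Ω) p P) {f : M → F} {t : ℝ}
    (ht : 0 < t) (ht1 : t ≤ 1) (h : modular (μ.restrict Ω) p f ≤ ENNReal.ofReal (t ^ P)) :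
    luxNorm μ p Ω f ≤ t := by
  refine csInf_le ⟨0, fun s hs => hs.1.le⟩ ⟨ht, ?_⟩
  have hP : 0 < t ^ P := Real.rpow_pos_of_pos ht P
  calc ∫⁻ x in Ω, ENNReal.ofReal ((‖f x‖ / t) ^ p x) ∂μ
      ≤ ENNReal.ofReal ((t ^ P)⁻¹) * modular (μ.restrict Ω) p f := by
        unfold modular
        rw [← lintegral_const_mul' _ _ ENNReal.ofReal_ne_top]
        refine lintegral_mono_ae ?_
        filter_upwards [hp.le] with x h1
        rw [← ENNReal.ofReal_mul (by positivity)]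
        refine ENNReal.ofReal_le_ofReal ?_
        rw [Real.div_rpow (norm_nonneg _) ht.le, div_eq_inv_mul]
        exact mul_le_mul_of_nonneg_right
          (inv_anti₀ hP (Real.rpow_le_rpow_of_exponent_ge ht ht1 h1)) (by positivity)
    _ ≤ ENNReal.ofReal ((t ^ P)⁻¹) * ENNReal.ofReal (t ^ P) := by gcongr
    _ = 1 := by
      rw [← ENNReal.ofReal_mul (by positivity), inv_mul_cancel₀ hP.ne', ENNReal.ofReal_one]

theorem tendsto_luxNorm_of_tendsto_modular (hp : IsExponent (μ.restrict Ω) p P) {f : ℕ → M → F}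
    (h : Tendsto (fun i => modular (μ.restrict Ω) p (f i)) atTop (𝓝 0)) :
    Tendsto (fun i => luxNorm μ p Ω (f i)) atTop (𝓝 0) := by
  rw [Metric.tendsto_atTop']
  intro ε hε
  set t := min 1 (ε / 2) with ht
  have ht0 : 0 < t := lt_min one_pos (by linarith)
  have h1 := (ENNReal.tendsto_nhds_zero.1 h) (ENNReal.ofReal (t ^ P))
    (by simpa using Real.rpow_pos_of_pos ht0 P)
  obtain ⟨N, hN⟩ := eventually_atTop.1 h1
  refine ⟨N, fun i hi => ?_⟩
  rw [Real.dist_eq, sub_zero, abs_of_nonneg (luxNorm_nonneg _)]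
  have := luxNorm_le_of_modular_le hp ht0 (min_le_left _ _) (hN i hi.le)
  have h2 : t ≤ ε / 2 := min_le_right _ _
  linarith

end Luxemburg

/-! ### Vector fields in charts. -/

theorem two_le_smooth : minSmoothness ℝ 2 ≤ ((⊤ : ℕ∞) : WithTop ℕ∞) := by
  rw [minSmoothness_of_isRCLikeNormedField]
  exact WithTop.coe_le_coe.2 (le_top : (2 : ℕ∞) ≤ ⊤)

theorem mlieBracket_eq_lieBracket {E : Type*} [NormedAddCommGroup E] [NormedSpace ℝ E]
    (V W : (x : E) → TangentSpace 𝓘(ℝ, E) x) (y : E) :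
    VectorField.mlieBracket 𝓘(ℝ, E) V W y = VectorField.lieBracket ℝ (E := E) V W y := by
  rw [← VectorField.mlieBracketWithin_univ, VectorField.mlieBracketWithin_eq_lieBracketWithin]
  exact congrFun VectorField.lieBracketWithin_univ y

theorem isManifold_minSmoothness {n : ℕ} (M : Type*) [TopologicalSpace M]
    [ChartedSpace (EuclideanSpace ℝ (Fin n)) M] [IsManifold (𝓡 n) ∞ M] :
    IsManifold (𝓡 n) (minSmoothness ℝ 2) M :=
  IsManifold.of_le (n := ∞) two_le_smooth

section ChartField

variable {n N : ℕ} {M : Type*} [TopologicalSpace M]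
  [ChartedSpace (EuclideanSpace ℝ (Fin n)) M] [IsManifold (𝓡 n) ∞ M]

/-- The coordinate representation of a vector field in the chart `e`. -/
def chartField (e : OpenPartialHomeomorph M (EuclideanSpace ℝ (Fin n))) (V : VField n M)
    (y : EuclideanSpace ℝ (Fin n)) : EuclideanSpace ℝ (Fin n) :=
  mfderiv (𝓡 n) (𝓡 n) e (e.symm y) (V (e.symm y))

variable {e : OpenPartialHomeomorph M (EuclideanSpace ℝ (Fin n))}

theorem mdifferentiable_atlas (he : e ∈ atlas (EuclideanSpace ℝ (Fin n)) M) :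
    e.MDifferentiable (𝓡 n) (𝓡 n) :=
  haveI : IsManifold (𝓡 n) 1 M := IsManifold.of_le (n := ∞) (by simp)
  mdifferentiable_of_mem_atlas he

theorem contMDiffOn_atlas (he : e ∈ atlas (EuclideanSpace ℝ (Fin n)) M) :
    ContMDiffOn (𝓡 n) (𝓡 n) ∞ e e.source :=
  contMDiffOn_of_mem_maximalAtlas (IsManifold.subset_maximalAtlas he)

theorem contMDiffOn_atlas_symm (he : e ∈ atlas (EuclideanSpace ℝ (Fin n)) M) :
    ContMDiffOn (𝓡 n) (𝓡 n) ∞ e.symm e.target :=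
  contMDiffOn_symm_of_mem_maximalAtlas (IsManifold.subset_maximalAtlas he)

/-- The differentials of `e.symm` and `e` compose to the identity, so the derivative along `V` can
be computed from `f ∘ e.symm`. -/
theorem mfderiv_apply_eq_fderiv (he : e ∈ atlas (EuclideanSpace ℝ (Fin n)) M) (V : VField n M)
    {f : M → ℝ} {y : EuclideanSpace ℝ (Fin n)} (hy : y ∈ e.target)
    (hf : MDifferentiableAt (𝓡 n) 𝓘(ℝ, ℝ) f (e.symm y)) :
    (mfderiv (𝓡 n) 𝓘(ℝ, ℝ) f (e.symm y) (V (e.symm y)) : ℝ)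
      = fderiv ℝ (f ∘ e.symm) y (chartField e V y) := by
  have hme := mdifferentiable_atlas (M := M) he
  have h1 := mfderiv_comp y (I := 𝓡 n) (I' := 𝓡 n) (I'' := 𝓘(ℝ, ℝ)) hf
    (hme.mdifferentiableAt_symm hy)
  rw [mfderiv_eq_fderiv] at h1
  have h2 := hme.symm_comp_deriv (e.map_target hy)
  rw [e.right_inv hy] at h2
  have h3 := DFunLike.congr_fun h2 (V (e.symm y))
  have h4 := DFunLike.congr_fun h1 (chartField e V y)
  refine Eq.trans ?_ h4.symm
  unfold chartField
  exact congrArg _ h3.symm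

/-- The differentials of `e` and `e.symm` are mutually inverse, so pushing forward by `e` is pulling
back by `e.symm`. Smoothness and compatibility with brackets become instances of general facts about
`mpullback`. -/
theorem chartField_eq_mpullback (he : e ∈ atlas (EuclideanSpace ℝ (Fin n)) M) (V : VField n M)
    {y : EuclideanSpace ℝ (Fin n)} (hy : y ∈ e.target) :
    chartField e V y = VectorField.mpullback (𝓡 n) (𝓡 n) e.symm V y := by
  have hme := mdifferentiable_atlas (M := M) he
  have h1 := hme.comp_symm_deriv hy
  have h2 := hme.symm_comp_deriv (e.map_target hy)
  rw [e.right_inv hy] at h2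
  rw [VectorField.mpullback_apply]
  rw [ContinuousLinearMap.inverse_eq h2 h1]
  rfl

theorem isInvertible_mfderiv_symm (he : e ∈ atlas (EuclideanSpace ℝ (Fin n)) M)
    {y : EuclideanSpace ℝ (Fin n)} (hy : y ∈ e.target) :
    (mfderiv (𝓡 n) (𝓡 n) e.symm y).IsInvertible := by
  have hme := mdifferentiable_atlas (M := M) he
  have h1 := hme.comp_symm_deriv hy
  have h2 := hme.symm_comp_deriv (e.map_target hy)
  rw [e.right_inv hy] at h2
  exact ContinuousLinearMap.IsInvertible.of_inverse h2 h1

theorem contDiffOn_chartField (he : e ∈ atlas (EuclideanSpace ℝ (Fin n)) M) {V : VField n M}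
    (hV : IsSmoothField V) : ContDiffOn ℝ ∞ (chartField e V) e.target := by
  refine contMDiffOn_vectorSpace_iff_contDiffOn.1 fun y hy => ?_
  have h1 := ContMDiffAt.mpullback_vectorField_preimage (I := 𝓡 n) (I' := 𝓡 n)
    (f := e.symm) (x₀ := y) (m := ∞) (n := ∞) (V := V) (hV (e.symm y))
    ((contMDiffOn_atlas_symm he).contMDiffAt (e.open_target.mem_nhds hy))
    (isInvertible_mfderiv_symm he hy) (by simp)
  refine (h1.congr_of_eventuallyEq ?_).contMDiffWithinAt
  filter_upwards [e.open_target.mem_nhds hy] with z hz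
  rw [chartField_eq_mpullback he V hz]

theorem chartField_mlieBracket (he : e ∈ atlas (EuclideanSpace ℝ (Fin n)) M) {V W : VField n M}
    (hV : IsSmoothField V) (hW : IsSmoothField W) {y : EuclideanSpace ℝ (Fin n)}
    (hy : y ∈ e.target) :
    chartField e (VectorField.mlieBracket (𝓡 n) V W) y
      = VectorField.lieBracket ℝ (chartField e V) (chartField e W) y := by
  have := isManifold_minSmoothness (n := n) M
  rw [chartField_eq_mpullback he _ hy, VectorField.mpullback_mlieBracket (n := ∞)
    ((hV (e.symm y)).mdifferentiableAt (by simp)) ((hW (e.symm y)).mdifferentiableAt (by simp))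
    ((contMDiffOn_atlas_symm he).contMDiffAt (e.open_target.mem_nhds hy)) two_le_smooth]
  refine Eq.trans ?_ (mlieBracket_eq_lieBracket _ _ y)
  refine Filter.EventuallyEq.mlieBracket_vectorField_eq ?_ ?_ <;>
  · filter_upwards [e.open_target.mem_nhds hy] with z hz
    exact (chartField_eq_mpullback he _ hz).symm

theorem IsCommutator.isSmoothField {X : Fin N → VField n M} (hX : ∀ k, IsSmoothField (X k))
    {V : VField n M} (hV : IsCommutator X V) : IsSmoothField V := by
  induction hV with
  | field k => exact hX k
  | bracket _ _ hV hW =>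
    have := isManifold_minSmoothness (n := n) M
    have : IsManifold (𝓡 n) ((⊤ : ℕ∞) + 1) M := by simpa
    intro x
    exact ContMDiffAt.mlieBracket_vectorField (m := ⊤) (n := ⊤) (hV x) (hW x) (by simp)

end ChartField

/-! ### The volume measure in charts. -/

section ChartMeasure

variable {n : ℕ} {M : Type*} [TopologicalSpace M] [MeasurableSpace M] [BorelSpace M]
  {μ : Measure M} {e : OpenPartialHomeomorph M (EuclideanSpace ℝ (Fin n))}

theorem measurableSet_target_inter_preimage {S : Set M} (hS : MeasurableSet S) :
    MeasurableSet (e.target ∩ e.symm ⁻¹' S) := by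
  have h := (continuousOn_iff_continuous_domRestrict.1 e.continuousOn_symm).measurable hS
  have := MeasurableSet.subtype_image e.open_target.measurableSet h
  rwa [domRestrict_eq, preimage_comp, Subtype.image_preimage_coe] at this

theorem measurableSet_source_inter_preimage {A : Set (EuclideanSpace ℝ (Fin n))}
    (hA : MeasurableSet A) : MeasurableSet (e.source ∩ e ⁻¹' A) := by
  have h := (continuousOn_iff_continuous_domRestrict.1 e.continuousOn).measurable hA
  have := MeasurableSet.subtype_image e.open_source.measurableSet h
  rwa [domRestrict_eq, preimage_comp, Subtype.image_preimage_coe] at this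

theorem measurableSet_chart_image {S : Set M} (hS : MeasurableSet S) (hSe : S ⊆ e.source) :
    MeasurableSet (e '' S) := by
  rw [e.image_eq_target_inter_inv_preimage hSe]
  exact measurableSet_target_inter_preimage hS

theorem aemeasurable_chart {S : Set M} (hS : MeasurableSet S) (hSe : S ⊆ e.source) :
    AEMeasurable e (μ.restrict S) :=
  (e.continuousOn.mono hSe).aemeasurable hS

theorem map_chart_restrict {ρ : EuclideanSpace ℝ (Fin n) → ℝ}
    (h : ∀ s ⊆ e.source, MeasurableSet s → μ s = ∫⁻ y in e '' s, ENNReal.ofReal (ρ y))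
    {S : Set M} (hS : MeasurableSet S) (hSe : S ⊆ e.source) :
    (μ.restrict S).map e
      = (volume.restrict (e '' S)).withDensity (fun y => ENNReal.ofReal (ρ y)) := by
  ext A hA
  rw [Measure.map_apply_of_aemeasurable (aemeasurable_chart hS hSe) hA,
    withDensity_apply _ hA, Measure.restrict_restrict hA, Measure.restrict_apply' hS]
  have h1 : e ⁻¹' A ∩ S = (e.source ∩ e ⁻¹' A) ∩ S := by
    ext x; simp only [mem_inter_iff, mem_preimage]
    exact ⟨fun hx => ⟨⟨hSe hx.2, hx.1⟩, hx.2⟩, fun hx => ⟨hx.1.2, hx.2⟩⟩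
  rw [h (e ⁻¹' A ∩ S) (inter_subset_right.trans hSe)
    (h1 ▸ (measurableSet_source_inter_preimage hA).inter hS), inter_comm (e ⁻¹' A),
    image_inter_preimage, inter_comm]

variable [ChartedSpace (EuclideanSpace ℝ (Fin n)) M]

/-- The density is strictly positive on the chart, so its integral vanishes only over a Lebesgue
null set. With the converse that follows, almost-everywhere statements move freely between `M` and
coordinates. -/
theorem volume_chart_image_eq_zero (hμ : IsSmoothVolume n μ)
    (he : e ∈ atlas (EuclideanSpace ℝ (Fin n)) M) {S : Set M} (hSe : S ⊆ e.source)
    (h0 : μ S = 0) : volume (e '' S) = 0 := by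
  obtain ⟨ρ, hρ, hρ0, hρμ⟩ := hμ e he
  -- `S` need not be measurable; it is replaced by a measurable hull cut to the chart domain, where
  -- the density formula applies.
  set T := toMeasurable μ S ∩ e.source
  have hT : MeasurableSet T := (measurableSet_toMeasurable _ _).inter e.open_source.measurableSet
  have hST : S ⊆ T := subset_inter (subset_toMeasurable _ _) hSe
  have hT0 : μ T = 0 :=
    measure_mono_null inter_subset_left (by rw [measure_toMeasurable, h0])
  refine measure_mono_null (image_mono hST) ?_
  have hTm := measurableSet_chart_image hT inter_subset_right
  have hTt : e '' T ⊆ e.target := by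
    rintro _ ⟨x, hx, rfl⟩; exact e.map_source hx.2
  rw [hρμ T inter_subset_right hT, lintegral_eq_zero_iff'] at hT0
  · have h3 : ∀ᵐ y ∂(volume.restrict (e '' T)), False := by
      filter_upwards [hT0, ae_restrict_mem hTm] with y hy hyT
      have h5 := hρ0 y (hTt hyT)
      simp only [Pi.zero_apply, ENNReal.ofReal_eq_zero] at hy
      linarith
    simpa using h3
  · exact ((hρ.continuousOn.mono hTt).aemeasurable hTm).ennreal_ofReal

theorem measure_eq_zero_of_volume_chart_image (hμ : IsSmoothVolume n μ)
    (he : e ∈ atlas (EuclideanSpace ℝ (Fin n)) M) {S : Set M} (hSe : S ⊆ e.source)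
    (h0 : volume (e '' S) = 0) : μ S = 0 := by
  obtain ⟨ρ, hρ, hρ0, hρμ⟩ := hμ e he
  set T := e.source ∩ e ⁻¹' (toMeasurable volume (e '' S))
  have hT : MeasurableSet T := measurableSet_source_inter_preimage (measurableSet_toMeasurable _ _)
  have hST : S ⊆ T := fun x hx => ⟨hSe hx, subset_toMeasurable _ _ (mem_image_of_mem e hx)⟩
  refine measure_mono_null hST ?_
  rw [hρμ T inter_subset_left hT]
  refine setLIntegral_measure_zero _ _ (measure_mono_null (t := toMeasurable volume (e '' S)) ?_ ?_)
  · rintro _ ⟨x, hx, rfl⟩; exact hx.2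
  · rw [measure_toMeasurable, h0]

/-- A continuous density is bounded on a small coordinate ball. This is what makes the measure of a
relatively compact domain finite. -/
theorem isLocallyFiniteMeasure_of_isSmoothVolume (hμ : IsSmoothVolume n μ) :
    IsLocallyFiniteMeasure μ := by
  refine ⟨fun x => ?_⟩
  set e := chartAt (EuclideanSpace ℝ (Fin n)) x
  obtain ⟨ρ, hρ, hρ0, hρμ⟩ := hμ e (chart_mem_atlas _ x)
  have hx : e x ∈ e.target := mem_chart_target _ x
  have h1 : ∀ᶠ y in 𝓝 (e x), ρ y < ρ (e x) + 1 :=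
    (hρ.continuousOn.continuousAt (e.open_target.mem_nhds hx)).eventually_lt_const (by linarith)
  obtain ⟨r, hr, hr2⟩ := Metric.eventually_nhds_iff_ball.1 h1
  have hS : IsOpen (e.source ∩ e ⁻¹' (Metric.ball (e x) r)) :=
    e.isOpen_inter_preimage Metric.isOpen_ball
  refine ⟨_, hS.mem_nhds ⟨mem_chart_source _ x, Metric.mem_ball_self hr⟩, ?_⟩
  rw [hρμ _ inter_subset_left hS.measurableSet]
  have h2 : e '' (e.source ∩ e ⁻¹' (Metric.ball (e x) r)) ⊆ Metric.ball (e x) r := by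
    rintro _ ⟨z, hz, rfl⟩; exact hz.2
  calc _ ≤ ∫⁻ y in Metric.ball (e x) r, ENNReal.ofReal (ρ y) := lintegral_mono_set h2
    _ ≤ ∫⁻ y in Metric.ball (e x) r, ENNReal.ofReal (ρ (e x) + 1) := by
        refine setLIntegral_mono measurable_const fun y hy => ?_
        exact ENNReal.ofReal_le_ofReal (hr2 y hy).le
    _ < ⊤ := by
        rw [setLIntegral_const]
        exact ENNReal.mul_lt_top ENNReal.ofReal_lt_top measure_ball_lt_top

theorem ae_comp_symm (hμ : IsSmoothVolume n μ) (he : e ∈ atlas (EuclideanSpace ℝ (Fin n)) M)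
    {Ω : Set M} (hΩ : MeasurableSet Ω) {q : M → Prop} (h : ∀ᵐ x ∂(μ.restrict Ω), q x) :
    ∀ᵐ y ∂(volume.restrict (e.target ∩ e.symm ⁻¹' Ω)), q (e.symm y) := by
  rw [ae_restrict_iff' hΩ, ae_iff] at h
  rw [ae_restrict_iff' (measurableSet_target_inter_preimage hΩ), ae_iff]
  refine measure_mono_null ?_ (volume_chart_image_eq_zero hμ he
    (S := e.source ∩ {x | ¬(x ∈ Ω → q x)}) inter_subset_left
    (measure_mono_null inter_subset_right h))
  intro y hy
  simp only [mem_ofPred_eq, Classical.not_imp] at hy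
  refine ⟨e.symm y, ⟨e.map_target hy.1.1, ?_⟩, e.right_inv hy.1.1⟩
  simp only [mem_ofPred_eq, Classical.not_imp]
  exact ⟨hy.1.2, hy.2⟩

theorem aestronglyMeasurable_comp_symm (hμ : IsSmoothVolume n μ)
    (he : e ∈ atlas (EuclideanSpace ℝ (Fin n)) M) {Ω : Set M} (hΩ : MeasurableSet Ω)
    {F : Type*} [NormedAddCommGroup F] {h : M → F}
    (hh : AEStronglyMeasurable h (μ.restrict Ω)) :
    AEStronglyMeasurable (fun y => h (e.symm y))
      (volume.restrict (e.target ∩ e.symm ⁻¹' Ω)) := by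
  refine AEStronglyMeasurable.congr (f := fun y => hh.mk h (e.symm y)) ?_ ?_
  · refine hh.stronglyMeasurable_mk.aestronglyMeasurable.comp_aemeasurable
      (f := e.symm) ?_
    exact (e.continuousOn_symm.mono inter_subset_left).aemeasurable
      (measurableSet_target_inter_preimage hΩ)
  · filter_upwards [ae_comp_symm hμ he hΩ hh.ae_eq_mk] with y hy
    exact hy.symm

/-- On a compact set the density has a positive minimum, so Lebesgue measure is dominated there by a
multiple of `μ`. -/
theorem exists_lintegral_comp_symm_le [T2Space M] (hμ : IsSmoothVolume n μ)
    (he : e ∈ atlas (EuclideanSpace ℝ (Fin n)) M) {K : Set (EuclideanSpace ℝ (Fin n))}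
    (hK : IsCompact K) (hKe : K ⊆ e.target) :
    ∃ C : ℝ≥0∞, C ≠ ⊤ ∧ ∀ {F : Type} [NormedAddCommGroup F] {h : M → F},
      AEStronglyMeasurable h (μ.restrict (e.symm '' K)) →
      ∫⁻ y in K, ‖h (e.symm y)‖ₑ ≤ C * ∫⁻ x in e.symm '' K, ‖h x‖ₑ ∂μ := by
  obtain ⟨ρ, hρ, hρ0, hρμ⟩ := hμ e he
  rcases K.eq_empty_or_nonempty with rfl | hKne
  · exact ⟨0, by simp, by simp⟩
  obtain ⟨y₀, hy₀, hmin⟩ := hK.exists_isMinOn hKne (hρ.continuousOn.mono hKe)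
  have hc : 0 < ρ y₀ := hρ0 _ (hKe hy₀)
  have hSc : IsCompact (e.symm '' K) := hK.image_of_continuousOn (e.continuousOn_symm.mono hKe)
  have hS : MeasurableSet (e.symm '' K) := hSc.isClosed.measurableSet
  have hSe : e.symm '' K ⊆ e.source := by
    rintro _ ⟨y, hy, rfl⟩; exact e.map_target (hKe hy)
  have himg : e '' (e.symm '' K) = K := by
    rw [image_image]
    exact (image_congr fun y hy => e.right_inv (hKe hy)).trans (image_id' K)
  have hmap := map_chart_restrict hρμ hS hSe
  rw [himg] at hmap
  refine ⟨ENNReal.ofReal ((ρ y₀)⁻¹), ENNReal.ofReal_ne_top, ?_⟩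
  intro F _ h hh
  have hm1 : AEStronglyMeasurable (fun y => h (e.symm y)) (volume.restrict K) := by
    exact (aestronglyMeasurable_comp_symm hμ he hS hh).mono_measure
      (Measure.restrict_mono (subset_inter hKe (subset_preimage_image _ _)) le_rfl)
  have hm2 : AEMeasurable (fun y => ENNReal.ofReal (ρ y)) (volume.restrict K) :=
    ((hρ.continuousOn.mono hKe).aemeasurable hK.measurableSet).ennreal_ofReal
  have h1 : ∫⁻ x in e.symm '' K, ‖h x‖ₑ ∂μ
      = ∫⁻ y in K, ENNReal.ofReal (ρ y) * ‖h (e.symm y)‖ₑ := by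
    have h2 : ∫⁻ x in e.symm '' K, ‖h x‖ₑ ∂μ
        = ∫⁻ x in e.symm '' K, ‖h (e.symm (e x))‖ₑ ∂μ := by
      refine setLIntegral_congr_fun hS fun x hx => ?_
      simp only [e.left_inv (hSe hx)]
    rw [h2, ← lintegral_map' (f := fun y => ‖h (e.symm y)‖ₑ) (g := e) ?_
      (aemeasurable_chart hS hSe), hmap]
    · rw [lintegral_withDensity_eq_lintegral_mul₀ hm2 hm1.enorm]
      rfl
    · rw [hmap]
      exact hm1.enorm.mono_ac (withDensity_absolutelyContinuous _ _)
  rw [h1, ← lintegral_const_mul' _ _ ENNReal.ofReal_ne_top]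
  refine setLIntegral_mono_ae' hK.measurableSet (Eventually.of_forall fun y hy => ?_)
  rw [← mul_assoc, ← ENNReal.ofReal_mul (by positivity)]
  refine le_mul_of_one_le_left (zero_le) ?_
  rw [← ENNReal.ofReal_one]
  refine ENNReal.ofReal_le_ofReal ?_
  rw [inv_mul_eq_div, one_le_div hc]
  exact hmin hy

end ChartMeasure

/-! ### Divergence and integration by parts in coordinates. -/

section Euclidean

variable {n : ℕ}

/-- The divergence of the vector field `φ a`. -/
def divMul (a : EuclideanSpace ℝ (Fin n) → EuclideanSpace ℝ (Fin n))
    (φ : EuclideanSpace ℝ (Fin n) → ℝ) (y : EuclideanSpace ℝ (Fin n)) : ℝ :=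
  ∑ j, fderiv ℝ (fun z => a z j * φ z) y (EuclideanSpace.single j 1)

theorem formalAdjoint_eq_neg_divMul {M : Type*} [TopologicalSpace M]
    [ChartedSpace (EuclideanSpace ℝ (Fin n)) M]
    (e : OpenPartialHomeomorph M (EuclideanSpace ℝ (Fin n))) (V : VField n M)
    (φ : EuclideanSpace ℝ (Fin n) → ℝ) (y : EuclideanSpace ℝ (Fin n)) :
    formalAdjoint e V φ y = -divMul (chartField e V) φ y := rfl

variable {O : Set (EuclideanSpace ℝ (Fin n))} {a b : EuclideanSpace ℝ (Fin n) → EuclideanSpace ℝ (Fin n)} {φ : EuclideanSpace ℝ (Fin n) → ℝ} {m : WithTop ℕ∞}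

/-- Off the support of `φ` the product vanishes locally, so the behaviour of `h` outside `O` is
irrelevant. -/
theorem contDiff_mul_of_tsupport_subset (hO : IsOpen O) {h : EuclideanSpace ℝ (Fin n) → ℝ} (hh : ContDiffOn ℝ m h O)
    (hφ : ContDiff ℝ m φ) (hs : tsupport φ ⊆ O) : ContDiff ℝ m (fun z => h z * φ z) := by
  rw [← contMDiff_iff_contDiff]
  refine contMDiff_of_tsupport fun y hy => contMDiffAt_iff_contDiffAt.2 ?_
  have hy' : y ∈ O := hs (closure_mono (Function.support_mul_subset_right h φ) hy)
  exact (hh.contDiffAt (hO.mem_nhds hy')).mul hφ.contDiffAt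

theorem contDiffOn_coord (ha : ContDiffOn ℝ m a O) (j : Fin n) :
    ContDiffOn ℝ m (fun z => a z j) O :=
  (EuclideanSpace.proj (𝕜 := ℝ) j : EuclideanSpace ℝ (Fin n) →L[ℝ] ℝ).contDiff.comp_contDiffOn ha

theorem contDiff_divMul (hO : IsOpen O) (ha : ContDiffOn ℝ ∞ a O) (hφ : ContDiff ℝ ∞ φ)
    (hs : tsupport φ ⊆ O) : ContDiff ℝ ∞ (divMul a φ) := by
  refine ContDiff.sum fun j _ => ?_
  have h := contDiff_mul_of_tsupport_subset hO (contDiffOn_coord ha j) hφ hs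
  exact (h.fderiv_right (m := ∞) (by simp)).clm_apply contDiff_const

theorem tsupport_divMul_subset : tsupport (divMul a φ) ⊆ tsupport φ := by
  refine closure_minimal (fun y hy => ?_) (isClosed_tsupport φ)
  by_contra hy'
  refine hy (Finset.sum_eq_zero fun j _ => ?_)
  have : (fun z => a z j * φ z) =ᶠ[𝓝 y] fun _ => 0 := by
    filter_upwards [(isClosed_tsupport φ).isOpen_compl.mem_nhds hy'] with z hz
    rw [image_eq_zero_of_notMem_tsupport hz, mul_zero]
  rw [this.fderiv_eq]
  simp

theorem hasCompactSupport_divMul (hc : HasCompactSupport φ) : HasCompactSupport (divMul a φ) :=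
  hc.of_isClosed_subset (isClosed_tsupport _) tsupport_divMul_subset

theorem sum_coord_mul_fderiv (f : EuclideanSpace ℝ (Fin n) → ℝ) (y v : EuclideanSpace ℝ (Fin n)) :
    ∑ j, v j * fderiv ℝ f y (EuclideanSpace.single j 1) = fderiv ℝ f y v := by
  conv_rhs => rw [← (EuclideanSpace.basisFun (Fin n) ℝ).sum_repr v]
  simp [map_sum]

theorem continuous_mul_of_tsupport_subset (hO : IsOpen O) {h : EuclideanSpace ℝ (Fin n) → ℝ} (hh : ContinuousOn h O)
    (hφ : Continuous φ) (hs : tsupport φ ⊆ O) : Continuous (fun z => h z * φ z) := by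
  rw [← contDiff_zero (𝕜 := ℝ)] at hφ ⊢
  exact contDiff_mul_of_tsupport_subset hO (contDiffOn_zero.2 hh) hφ hs

/-- Integration by parts in each coordinate. Both `a` and `f` are controlled only on `O`; the
compact support of `φ` in `O` makes every `a_j φ` globally `C¹` and removes boundary terms. -/
theorem integral_fderiv_mul_eq_neg_divMul (hO : IsOpen O) (ha : ContDiffOn ℝ 1 a O) {f : EuclideanSpace ℝ (Fin n) → ℝ}
    (hf : ContDiffOn ℝ 1 f O) (hφ : ContDiff ℝ 1 φ) (hc : HasCompactSupport φ)
    (hs : tsupport φ ⊆ O) :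
    ∫ y, fderiv ℝ f y (a y) * φ y = -∫ y, f y * divMul a φ y := by
  have key : ∀ j, Integrable (fun y => fderiv ℝ f y (EuclideanSpace.single j 1) * (a y j * φ y)) ∧
      Integrable (fun y => f y * fderiv ℝ (fun z => a z j * φ z) y (EuclideanSpace.single j 1)) ∧
      ∫ y, f y * fderiv ℝ (fun z => a z j * φ z) y (EuclideanSpace.single j 1)
        = -∫ y, fderiv ℝ f y (EuclideanSpace.single j 1) * (a y j * φ y) := by
    intro j
    have hA := contDiff_mul_of_tsupport_subset hO (contDiffOn_coord ha j) hφ hs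
    have hAs : tsupport (fun z => a z j * φ z) ⊆ tsupport φ :=
      closure_mono (Function.support_mul_subset_right _ φ)
    have hAc : HasCompactSupport (fun z => a z j * φ z) := hc.mul_left
    have hAd : Continuous (fun y => fderiv ℝ (fun z => a z j * φ z) y (EuclideanSpace.single j 1)) :=
      (hA.continuous_fderiv one_ne_zero).clm_apply continuous_const
    have hAdc : HasCompactSupport
        (fun y => fderiv ℝ (fun z => a z j * φ z) y (EuclideanSpace.single j 1)) :=
      hAc.fderiv_apply ℝ _
    have hAds : tsupport (fun y => fderiv ℝ (fun z => a z j * φ z) y (EuclideanSpace.single j 1))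
        ⊆ O := (tsupport_fderiv_apply_subset ℝ _).trans (hAs.trans hs)
    have hfd : ContinuousOn (fun y => fderiv ℝ f y (EuclideanSpace.single j 1)) O :=
      (hf.continuousOn_fderiv_of_isOpen hO le_rfl).clm_apply continuousOn_const
    have h1 : Integrable (fun y => fderiv ℝ f y (EuclideanSpace.single j 1) * (a y j * φ y)) :=
      (continuous_mul_of_tsupport_subset hO hfd hA.continuous (hAs.trans hs)).integrable_of_hasCompactSupport
        hAc.mul_left
    have h2 : Integrable
        (fun y => f y * fderiv ℝ (fun z => a z j * φ z) y (EuclideanSpace.single j 1)) :=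
      (continuous_mul_of_tsupport_subset hO hf.continuousOn hAd hAds).integrable_of_hasCompactSupport
        hAdc.mul_left
    have h3 : Integrable (fun y => f y * (a y j * φ y)) :=
      (continuous_mul_of_tsupport_subset hO hf.continuousOn hA.continuous
        (hAs.trans hs)).integrable_of_hasCompactSupport hAc.mul_left
    refine ⟨h1, h2, integral_mul_fderiv_eq_neg_fderiv_mul_of_integrable h1 h2 h3
      (fun x hx => ?_) (fun x _ => hA.differentiable one_ne_zero x)⟩
    exact (hf.contDiffAt (hO.mem_nhds (hs (hAs hx)))).differentiableAt one_ne_zero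
  have e1 : ∀ y, fderiv ℝ f y (a y) * φ y
      = ∑ j, fderiv ℝ f y (EuclideanSpace.single j 1) * (a y j * φ y) := by
    intro y
    rw [← sum_coord_mul_fderiv f y (a y), Finset.sum_mul]
    exact Finset.sum_congr rfl fun j _ => by ring
  simp_rw [e1, divMul, Finset.mul_sum]
  rw [integral_finsetSum _ fun j _ => (key j).1, integral_finsetSum _ fun j _ => (key j).2.1,
    ← Finset.sum_neg_distrib]
  refine Finset.sum_congr rfl fun j _ => ?_
  rw [(key j).2.2, neg_neg]

end Euclidean

/-! ### The classical horizontal gradient of `C¹` functions. -/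

section HGrad

variable {n N : ℕ} {M : Type*} [TopologicalSpace M]
  [ChartedSpace (EuclideanSpace ℝ (Fin n)) M]

/-- `C¹` functions with compact support in `Ω`. -/
structure IsC1TestFunction (n : ℕ) [ChartedSpace (EuclideanSpace ℝ (Fin n)) M]
    (Ω : Set M) (φ : M → ℝ) : Prop where
  smooth : ContMDiff (𝓡 n) 𝓘(ℝ, ℝ) 1 φ
  compact : HasCompactSupport φ
  support_subset : tsupport φ ⊆ Ω

theorem IsTestFunction.isC1 {Ω : Set M} {φ : M → ℝ} (h : IsTestFunction n Ω φ) :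
    IsC1TestFunction n Ω φ :=
  ⟨h.smooth.of_le (by simp), h.compact, h.support_subset⟩

theorem hgrad_apply (X : Fin N → VField n M) (f : M → ℝ) (x : M) (k : Fin N) :
    hgrad X f x k = (mfderiv (𝓡 n) 𝓘(ℝ, ℝ) f x (X k x) : ℝ) := rfl

theorem hgrad_congr_of_eventuallyEq {X : Fin N → VField n M} {f g : M → ℝ} {x : M}
    (h : f =ᶠ[𝓝 x] g) : hgrad X f x = hgrad X g x := by
  unfold hgrad
  rw [h.mfderiv_eq]
  rfl

theorem hgrad_const {X : Fin N → VField n M} (c : ℝ) (x : M) :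
    hgrad X (fun _ : M => c) x = 0 := by
  ext k
  rw [hgrad_apply, mfderiv_const]
  rfl

theorem hgrad_eq_zero_of_notMem_tsupport {X : Fin N → VField n M} {f : M → ℝ} {x : M}
    (hx : x ∉ tsupport f) : hgrad X f x = 0 := by
  have : f =ᶠ[𝓝 x] fun _ => 0 := by
    filter_upwards [(isClosed_tsupport f).isOpen_compl.mem_nhds hx] with z hz
    exact image_eq_zero_of_notMem_tsupport hz
  rw [hgrad_congr_of_eventuallyEq this, hgrad_const]

theorem hgrad_add {X : Fin N → VField n M} {f g : M → ℝ} {x : M}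
    (hf : MDifferentiableAt (𝓡 n) 𝓘(ℝ, ℝ) f x) (hg : MDifferentiableAt (𝓡 n) 𝓘(ℝ, ℝ) g x) :
    hgrad X (fun y => f y + g y) x = hgrad X f x + hgrad X g x := by
  ext k
  have h := (hf.hasMFDerivAt.add hg.hasMFDerivAt).mfderiv
  rw [PiLp.add_apply, hgrad_apply, hgrad_apply, hgrad_apply]
  exact DFunLike.congr_fun h (X k x)

theorem IsC1TestFunction.exists_norm_le {Ω : Set M} {φ : M → ℝ} (h : IsC1TestFunction n Ω φ) :
    ∃ C, ∀ x, ‖φ x‖ ≤ C :=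
  h.smooth.continuous.bounded_above_of_compact_support h.compact

variable [IsManifold (𝓡 n) ∞ M] {X : Fin N → VField n M}
  {e : OpenPartialHomeomorph M (EuclideanSpace ℝ (Fin n))}

theorem contDiffOn_comp_symm (he : e ∈ atlas (EuclideanSpace ℝ (Fin n)) M) {Ω : Set M}
    {f : M → ℝ} {m : ℕ∞} (hf : ContMDiffOn (𝓡 n) 𝓘(ℝ, ℝ) m f Ω) :
    ContDiffOn ℝ m (f ∘ e.symm) (e.target ∩ e.symm ⁻¹' Ω) := by
  rw [← contMDiffOn_iff_contDiffOn]
  exact hf.comp (((contMDiffOn_atlas_symm he).of_le (mod_cast le_top)).mono inter_subset_left)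
    inter_subset_right

theorem isOpen_target_inter {Ω : Set M} (hΩ : IsOpen Ω) : IsOpen (e.target ∩ e.symm ⁻¹' Ω) :=
  e.isOpen_inter_preimage_symm hΩ

theorem continuousOn_hgrad (hX : ∀ k, IsSmoothField (X k)) {Ω : Set M} (hΩ : IsOpen Ω)
    {f : M → ℝ} (hf : ContMDiffOn (𝓡 n) 𝓘(ℝ, ℝ) 1 f Ω) : ContinuousOn (hgrad X f) Ω := by
  refine ContinuousOn.comp (t := univ)
    (g := (WithLp.toLp 2 : (Fin N → ℝ) → EuclideanSpace ℝ (Fin N)))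
    (PiLp.continuous_toLp 2 _).continuousOn ?_ (mapsTo_univ _ _)
  refine continuousOn_pi.2 fun k x hx => ContinuousAt.continuousWithinAt ?_
  set e := chartAt (EuclideanSpace ℝ (Fin n)) x
  have he : e ∈ atlas (EuclideanSpace ℝ (Fin n)) M := chart_mem_atlas _ x
  have hxe : x ∈ e.source := mem_chart_source _ x
  have hO := isOpen_target_inter (e := e) hΩ
  have hexO : e x ∈ e.target ∩ e.symm ⁻¹' Ω :=
    ⟨e.map_source hxe, by rw [mem_preimage, e.left_inv hxe]; exact hx⟩
  have h1 : ContinuousAt (fun y => fderiv ℝ (f ∘ e.symm) y (chartField e (X k) y)) (e x) := by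
    refine ContinuousOn.continuousAt (ContinuousOn.clm_apply ?_ ?_) (hO.mem_nhds hexO)
    · exact (contDiffOn_comp_symm he hf).continuousOn_fderiv_of_isOpen hO le_rfl
    · exact (contDiffOn_chartField he (hX k)).continuousOn.mono inter_subset_left
  refine (h1.comp (e.continuousAt hxe)).congr ?_
  filter_upwards [e.open_source.mem_nhds hxe, hΩ.mem_nhds hx] with z hz hzΩ
  have h2 := mfderiv_apply_eq_fderiv he (X k) (e.map_source hz) (f := f) (by
    rw [e.left_inv hz]
    exact (hf.contMDiffAt (hΩ.mem_nhds hzΩ)).mdifferentiableAt one_ne_zero)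
  rw [e.left_inv hz] at h2
  exact h2.symm

theorem IsC1TestFunction.continuous_hgrad (hX : ∀ k, IsSmoothField (X k)) {Ω : Set M}
    {φ : M → ℝ} (h : IsC1TestFunction n Ω φ) : Continuous (hgrad X φ) := by
  rw [← continuousOn_univ]
  exact continuousOn_hgrad hX isOpen_univ h.smooth.contMDiffOn

theorem IsC1TestFunction.exists_norm_hgrad_le (hX : ∀ k, IsSmoothField (X k)) {Ω : Set M}
    {φ : M → ℝ} (h : IsC1TestFunction n Ω φ) : ∃ C, ∀ x, ‖hgrad X φ x‖ ≤ C := by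
  refine (h.continuous_hgrad hX).bounded_above_of_compact_support ?_
  refine h.compact.mono' fun x hx => ?_
  by_contra hx'
  exact hx (hgrad_eq_zero_of_notMem_tsupport hx')

/-- A `C¹` function has its classical derivatives as weak derivatives. -/
theorem isWeakDeriv_of_contMDiffOn {V : VField n M} (hV : IsSmoothField V) {Ω : Set M}
    (hΩ : IsOpen Ω) {f : M → ℝ} (hf : ContMDiffOn (𝓡 n) 𝓘(ℝ, ℝ) 1 f Ω) :
    IsWeakDeriv V Ω f (fun x => (mfderiv (𝓡 n) 𝓘(ℝ, ℝ) f x (V x) : ℝ)) := by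
  intro e he φ hφ hc hs
  have hO := isOpen_target_inter (e := e) hΩ
  have h1 := integral_fderiv_mul_eq_neg_divMul hO
    (((contDiffOn_chartField he hV).of_le (by simp)).mono inter_subset_left)
    (contDiffOn_comp_symm he hf) (hφ.of_le (by simp)) hc hs
  simp_rw [formalAdjoint_eq_neg_divMul, mul_neg, integral_neg]
  refine Eq.trans (integral_congr_ae (Eventually.of_forall fun y => ?_)) h1
  by_cases hy : y ∈ tsupport φ
  · have h2 := hs hy
    beta_reduce
    rw [mfderiv_apply_eq_fderiv he V h2.1
      ((hf.contMDiffAt (hΩ.mem_nhds h2.2)).mdifferentiableAt one_ne_zero)]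
  · beta_reduce
    rw [image_eq_zero_of_notMem_tsupport hy]
    exact (mul_zero _).trans (mul_zero _).symm

end HGrad

/-! ### Stability and uniqueness of weak derivatives. -/

section WeakLimit

variable {n N : ℕ} {M : Type*} [TopologicalSpace M] [T2Space M]
  [ChartedSpace (EuclideanSpace ℝ (Fin n)) M]
  [MeasurableSpace M] [BorelSpace M] {μ : Measure M}
  {e : OpenPartialHomeomorph M (EuclideanSpace ℝ (Fin n))}

theorem locallyIntegrableOn_lintegral_lt_top {F : Type*} [NormedAddCommGroup F] {Ω K : Set M}
    {h : M → F} (hh : LocallyIntegrableOn h Ω μ) (hK : IsCompact K) (hKΩ : K ⊆ Ω) :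
    ∫⁻ x in K, ‖h x‖ₑ ∂μ < ⊤ :=
  (hh.integrableOn_compact_subset hKΩ hK).2

theorem image_symm_tsupport {Ω : Set M} {φ : EuclideanSpace ℝ (Fin n) → ℝ}
    (hc : HasCompactSupport φ) (hs : tsupport φ ⊆ e.target ∩ e.symm ⁻¹' Ω) :
    IsCompact (e.symm '' tsupport φ) ∧ e.symm '' tsupport φ ⊆ Ω :=
  ⟨IsCompact.image_of_continuousOn hc (e.continuousOn_symm.mono fun _ hy => (hs hy).1),
    by rintro _ ⟨y, hy, rfl⟩; exact (hs hy).2⟩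

theorem aestronglyMeasurable_comp_symm_mul (hμ : IsSmoothVolume n μ)
    (he : e ∈ atlas (EuclideanSpace ℝ (Fin n)) M) {Ω : Set M} (hΩ : IsOpen Ω) {h : M → ℝ}
    (hh : AEStronglyMeasurable h (μ.restrict Ω)) {φ : EuclideanSpace ℝ (Fin n) → ℝ}
    (hφ : Continuous φ) (hs : tsupport φ ⊆ e.target ∩ e.symm ⁻¹' Ω) :
    AEStronglyMeasurable (fun y => h (e.symm y) * φ y) volume := by
  have h1 := (aestronglyMeasurable_comp_symm hμ he hΩ.measurableSet hh).mul
    (hφ.aestronglyMeasurable (μ := volume.restrict (e.target ∩ e.symm ⁻¹' Ω)))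
  have h2 := (aestronglyMeasurable_indicator_iff
    (measurableSet_target_inter_preimage hΩ.measurableSet)).2 h1
  refine h2.congr (Eventually.of_forall fun y => ?_)
  by_cases hy : y ∈ e.target ∩ e.symm ⁻¹' Ω
  · rw [indicator_of_mem hy]; rfl
  · beta_reduce
    rw [indicator_of_notMem hy, image_eq_zero_of_notMem_tsupport (fun h => hy (hs h)), mul_zero]

/-- Pairing with a test function in a chart is continuous for local `L¹` convergence. -/
theorem exists_lintegral_comp_symm_mul_le (hμ : IsSmoothVolume n μ)
    (he : e ∈ atlas (EuclideanSpace ℝ (Fin n)) M) {Ω : Set M}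
    {φ : EuclideanSpace ℝ (Fin n) → ℝ}
    (hφ : Continuous φ) (hc : HasCompactSupport φ) (hs : tsupport φ ⊆ e.target ∩ e.symm ⁻¹' Ω) :
    ∃ C : ℝ≥0∞, C ≠ ⊤ ∧ ∀ h : M → ℝ, AEStronglyMeasurable h (μ.restrict Ω) →
      ∫⁻ y, ‖h (e.symm y) * φ y‖ₑ ≤ C * ∫⁻ x in e.symm '' tsupport φ, ‖h x‖ₑ ∂μ := by
  obtain ⟨C, hC, hle⟩ := exists_lintegral_comp_symm_le hμ he hc (fun y hy => (hs hy).1)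
  obtain ⟨B, hB⟩ := hφ.bounded_above_of_compact_support hc
  refine ⟨ENNReal.ofReal B * C, ENNReal.mul_ne_top ENNReal.ofReal_ne_top hC, fun h hh => ?_⟩
  have h1 : ∫⁻ y, ‖h (e.symm y) * φ y‖ₑ
      ≤ ∫⁻ y in tsupport φ, ENNReal.ofReal B * ‖h (e.symm y)‖ₑ := by
    rw [← lintegral_indicator (isClosed_tsupport φ).measurableSet]
    refine lintegral_mono fun y => ?_
    by_cases hy : y ∈ tsupport φ
    · rw [indicator_of_mem hy, enorm_mul, mul_comm]
      gcongr
      rw [← ofReal_norm]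
      exact ENNReal.ofReal_le_ofReal (hB y)
    · rw [image_eq_zero_of_notMem_tsupport hy]; simp
  refine h1.trans ?_
  rw [lintegral_const_mul' _ _ ENNReal.ofReal_ne_top, mul_assoc]
  gcongr
  exact hle (hh.mono_measure (Measure.restrict_mono (image_symm_tsupport hc hs).2 le_rfl))

theorem integrable_comp_symm_mul (hμ : IsSmoothVolume n μ)
    (he : e ∈ atlas (EuclideanSpace ℝ (Fin n)) M) {Ω : Set M} (hΩ : IsOpen Ω) {h : M → ℝ}
    (hm : AEStronglyMeasurable h (μ.restrict Ω))
    (hh : LocallyIntegrableOn h Ω μ) {φ : EuclideanSpace ℝ (Fin n) → ℝ}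
    (hφ : Continuous φ) (hc : HasCompactSupport φ) (hs : tsupport φ ⊆ e.target ∩ e.symm ⁻¹' Ω) :
    Integrable (fun y => h (e.symm y) * φ y) := by
  obtain ⟨C, hC, hle⟩ := exists_lintegral_comp_symm_mul_le hμ he hφ hc hs
  have hK := image_symm_tsupport hc hs
  exact ⟨aestronglyMeasurable_comp_symm_mul hμ he hΩ hm hφ hs,
    (hle h hm).trans_lt (ENNReal.mul_lt_top hC.lt_top
      (locallyIntegrableOn_lintegral_lt_top hh hK.1 hK.2))⟩

theorem tendsto_integral_comp_symm_mul (hμ : IsSmoothVolume n μ)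
    (he : e ∈ atlas (EuclideanSpace ℝ (Fin n)) M) {Ω : Set M} (hΩ : IsOpen Ω) {f : M → ℝ}
    {fi : ℕ → M → ℝ} (hm : AEStronglyMeasurable f (μ.restrict Ω))
    (hmi : ∀ i, AEStronglyMeasurable (fi i) (μ.restrict Ω))
    (hfi : ∀ i, LocallyIntegrableOn (fi i) Ω μ) (hf : LocallyIntegrableOn f Ω μ)
    (hlim : ∀ K ⊆ Ω, IsCompact K →
      Tendsto (fun i => ∫⁻ x in K, ‖fi i x - f x‖ₑ ∂μ) atTop (𝓝 0))
    {φ : EuclideanSpace ℝ (Fin n) → ℝ}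
    (hφ : Continuous φ) (hc : HasCompactSupport φ) (hs : tsupport φ ⊆ e.target ∩ e.symm ⁻¹' Ω) :
    Tendsto (fun i => ∫ y, fi i (e.symm y) * φ y) atTop (𝓝 (∫ y, f (e.symm y) * φ y)) := by
  obtain ⟨C, hC, hle⟩ := exists_lintegral_comp_symm_mul_le hμ he hφ hc hs
  have hK := image_symm_tsupport hc hs
  refine tendsto_integral_of_L1 _ (integrable_comp_symm_mul hμ he hΩ hm hf hφ hc hs).1
    (Eventually.of_forall fun i => integrable_comp_symm_mul hμ he hΩ (hmi i) (hfi i) hφ hc hs) ?_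
  have h0 : Tendsto (fun i => C * ∫⁻ x in e.symm '' tsupport φ, ‖fi i x - f x‖ₑ ∂μ) atTop (𝓝 0) := by
    have := ENNReal.Tendsto.const_mul (a := C) (hlim _ hK.2 hK.1) (Or.inr hC)
    simpa using this
  refine tendsto_of_tendsto_of_tendsto_of_le_of_le tendsto_const_nhds h0 (fun _ => zero_le) ?_
  intro i
  refine le_trans (lintegral_mono fun y => ?_) (hle (fun x => fi i x - f x) ((hmi i).sub hm))
  rw [sub_mul]

/-- Each side of the defining identity is a pairing with a continuous function of compact support in
a chart: the test function on one side, its formal adjoint image on the other. Such pairings are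
continuous under local `L¹` convergence. -/
theorem IsWeakDeriv.of_tendsto [IsManifold (𝓡 n) ∞ M] (hμ : IsSmoothVolume n μ) {V : VField n M}
    (hV : IsSmoothField V) {Ω : Set M} (hΩ : IsOpen Ω) {u w : M → ℝ} {ui wi : ℕ → M → ℝ}
    (hum : AEStronglyMeasurable u (μ.restrict Ω)) (hwm : AEStronglyMeasurable w (μ.restrict Ω))
    (hu : LocallyIntegrableOn u Ω μ) (hw : LocallyIntegrableOn w Ω μ)
    (huim : ∀ i, AEStronglyMeasurable (ui i) (μ.restrict Ω))
    (hwim : ∀ i, AEStronglyMeasurable (wi i) (μ.restrict Ω))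
    (hui : ∀ i, LocallyIntegrableOn (ui i) Ω μ) (hwi : ∀ i, LocallyIntegrableOn (wi i) Ω μ)
    (hweak : ∀ i, IsWeakDeriv V Ω (ui i) (wi i))
    (hulim : ∀ K ⊆ Ω, IsCompact K →
      Tendsto (fun i => ∫⁻ x in K, ‖ui i x - u x‖ₑ ∂μ) atTop (𝓝 0))
    (hwlim : ∀ K ⊆ Ω, IsCompact K →
      Tendsto (fun i => ∫⁻ x in K, ‖wi i x - w x‖ₑ ∂μ) atTop (𝓝 0)) :
    IsWeakDeriv V Ω u w := by
  intro e he φ hφ hc hs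
  have hO := isOpen_target_inter (e := e) hΩ
  have hcf := (contDiffOn_chartField he hV).mono
    (inter_subset_left : e.target ∩ e.symm ⁻¹' Ω ⊆ e.target)
  have hfa : formalAdjoint e V φ = fun y => -divMul (chartField e V) φ y :=
    funext fun y => formalAdjoint_eq_neg_divMul e V φ y
  have h1 := tendsto_integral_comp_symm_mul hμ he hΩ hwm hwim hwi hw hwlim hφ.continuous hc hs
  have h2 := tendsto_integral_comp_symm_mul hμ he hΩ hum huim hui hu hulim
    (φ := formalAdjoint e V φ)
    (by rw [hfa]; exact (contDiff_divMul hO hcf hφ hs).continuous.neg)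
    (by rw [hfa]; exact (hasCompactSupport_divMul hc).neg)
    (by
      rw [hfa]
      refine Subset.trans (b := tsupport (divMul (chartField e V) φ)) ?_
        (tsupport_divMul_subset.trans hs)
      exact closure_mono fun y hy => neg_ne_zero.1 hy)
  refine tendsto_nhds_unique h1 (h2.congr fun i => ?_)
  exact (hweak i e he φ hφ hc hs).symm

/-- The fundamental lemma of the calculus of variations applied in each chart; second countability
then assembles the local null sets into a global one. -/
theorem ae_eq_of_integral_comp_symm [SecondCountableTopology M]
    (hμ : IsSmoothVolume n μ) {Ω : Set M} (hΩ : IsOpen Ω) {f g : M → ℝ}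
    (hf : LocallyIntegrableOn f Ω μ) (hg : LocallyIntegrableOn g Ω μ)
    (hfm : AEStronglyMeasurable f (μ.restrict Ω)) (hgm : AEStronglyMeasurable g (μ.restrict Ω))
    (h : ∀ e ∈ atlas (EuclideanSpace ℝ (Fin n)) M, ∀ φ : EuclideanSpace ℝ (Fin n) → ℝ,
      ContDiff ℝ ∞ φ → HasCompactSupport φ → tsupport φ ⊆ e.target ∩ e.symm ⁻¹' Ω →
        ∫ y, f (e.symm y) * φ y = ∫ y, g (e.symm y) * φ y) :
    f =ᵐ[μ.restrict Ω] g := by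
  rw [EventuallyEq, ae_restrict_iff' hΩ.measurableSet, ae_iff]
  refine measure_null_of_locally_null _ fun x hx => ?_
  set e := chartAt (EuclideanSpace ℝ (Fin n)) x
  have he : e ∈ atlas (EuclideanSpace ℝ (Fin n)) M := chart_mem_atlas _ x
  refine ⟨_, inter_mem_nhdsWithin _ (e.open_source.mem_nhds (mem_chart_source _ x)), ?_⟩
  have hO := e.isOpen_inter_preimage_symm hΩ
  have hloc : LocallyIntegrableOn (fun y => f (e.symm y) - g (e.symm y))
      (e.target ∩ e.symm ⁻¹' Ω) := by
    rw [locallyIntegrableOn_iff hO.isLocallyClosed]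
    intro K hKO hK
    have hKe : K ⊆ e.target := hKO.trans inter_subset_left
    obtain ⟨C, hC, hle⟩ := exists_lintegral_comp_symm_le hμ he hK hKe
    have hK' : e.symm '' K ⊆ Ω := by rintro _ ⟨y, hy, rfl⟩; exact (hKO hy).2
    have hKc : IsCompact (e.symm '' K) :=
      hK.image_of_continuousOn (e.continuousOn_symm.mono hKe)
    refine ⟨(aestronglyMeasurable_comp_symm hμ he hΩ.measurableSet (hfm.sub hgm)).mono_measure
      (Measure.restrict_mono hKO le_rfl), ?_⟩
    exact (hle ((hfm.sub hgm).mono_measure (Measure.restrict_mono hK' le_rfl))).trans_lt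
      (ENNReal.mul_lt_top hC.lt_top (locallyIntegrableOn_lintegral_lt_top (hf.sub hg) hKc hK'))
  have h0 := hO.ae_eq_zero_of_integral_contDiff_smul_eq_zero hloc fun φ hφ hc hs => by
    have h1 := h e he φ hφ hc hs
    have i1 := integrable_comp_symm_mul hμ he hΩ hfm hf hφ.continuous hc hs
    have i2 := integrable_comp_symm_mul hμ he hΩ hgm hg hφ.continuous hc hs
    rw [← sub_eq_zero, ← integral_sub i1 i2] at h1
    rw [← h1]
    refine integral_congr_ae (Eventually.of_forall fun y => ?_)
    simp only [smul_eq_mul]; ring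
  refine measure_eq_zero_of_volume_chart_image hμ he inter_subset_right ?_
  rw [ae_iff] at h0
  refine measure_mono_null ?_ h0
  rintro _ ⟨z, ⟨hz, hze⟩, rfl⟩
  simp only [mem_ofPred_eq, Classical.not_imp] at hz ⊢
  refine ⟨⟨e.map_source hze, by rw [mem_preimage, e.left_inv hze]; exact hz.1⟩, ?_⟩
  rw [e.left_inv hze, sub_eq_zero]
  exact hz.2

end WeakLimit

/-! ### The space `W₀` as a set of modular limits. -/

section W0

variable {n N : ℕ} {M : Type*} [TopologicalSpace M]
  [ChartedSpace (EuclideanSpace ℝ (Fin n)) M] [MeasurableSpace M]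

/-- `(u, G)` is a limit of `(φ i, ∇_X (φ i))` with test functions `φ i`, in the sense of the
modular. -/
structure IsW0Limit (μ : Measure M) (X : Fin N → VField n M) (p : M → ℝ) (Ω : Set M)
    (u : M → ℝ) (G : M → EuclideanSpace ℝ (Fin N)) : Prop where
  aesm : AEStronglyMeasurable u (μ.restrict Ω)
  aesm_grad : AEStronglyMeasurable G (μ.restrict Ω)
  approx : ∀ ε : ℝ≥0∞, ε ≠ 0 → ∃ φ : M → ℝ, IsTestFunction n Ω φ ∧
    modular (μ.restrict Ω) p (fun x => u x - φ x) ≤ ε ∧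
    modular (μ.restrict Ω) p (fun x => G x - hgrad X φ x) ≤ ε

variable {μ : Measure M} {X : Fin N → VField n M} {p : M → ℝ} {Ω : Set M} {P : ℝ}
  {u : M → ℝ} {G : M → EuclideanSpace ℝ (Fin N)}

theorem IsW0Limit.exists_seq (h : IsW0Limit μ X p Ω u G) :
    ∃ φ : ℕ → M → ℝ, (∀ i, IsTestFunction n Ω (φ i)) ∧
      Tendsto (fun i => modular (μ.restrict Ω) p (fun x => u x - φ i x)) atTop (𝓝 0) ∧
      Tendsto (fun i => modular (μ.restrict Ω) p (fun x => G x - hgrad X (φ i) x))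
        atTop (𝓝 0) := by
  choose φ h1 h2 h3 using fun i : ℕ => h.approx ((i : ℝ≥0∞) + 1)⁻¹
    (ENNReal.inv_ne_zero.2 (by simp))
  have h0 : Tendsto (fun i : ℕ => ((i : ℝ≥0∞) + 1)⁻¹) atTop (𝓝 0) := by
    have := (tendsto_add_atTop_iff_nat 1).2 ENNReal.tendsto_inv_nat_nhds_zero
    simpa using this
  exact ⟨φ, h1, tendsto_of_tendsto_of_tendsto_of_le_of_le tendsto_const_nhds h0
    (fun _ => zero_le) h2, tendsto_of_tendsto_of_tendsto_of_le_of_le tendsto_const_nhds h0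
    (fun _ => zero_le) h3⟩

variable [BorelSpace M]

theorem IsC1TestFunction.aesm {φ : M → ℝ} (h : IsC1TestFunction n Ω φ) :
    AEStronglyMeasurable φ (μ.restrict Ω) :=
  (h.smooth.continuous.stronglyMeasurable_of_hasCompactSupport h.compact).aestronglyMeasurable

theorem IsC1TestFunction.aesm_hgrad [IsManifold (𝓡 n) ∞ M] (hX : ∀ k, IsSmoothField (X k))
    {φ : M → ℝ} (h : IsC1TestFunction n Ω φ) :
    AEStronglyMeasurable (hgrad X φ) (μ.restrict Ω) :=
  ((h.continuous_hgrad hX).measurable).aestronglyMeasurable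

theorem IsC1TestFunction.modular_lt_top [IsFiniteMeasure (μ.restrict Ω)]
    (hp : IsExponent (μ.restrict Ω) p P) {φ : M → ℝ} (h : IsC1TestFunction n Ω φ) :
    modular (μ.restrict Ω) p φ < ⊤ := by
  obtain ⟨C, hC⟩ := h.exists_norm_le
  exact modular_lt_top_of_bounded hp (Eventually.of_forall hC)

theorem IsC1TestFunction.modular_hgrad_lt_top [IsManifold (𝓡 n) ∞ M]
    (hX : ∀ k, IsSmoothField (X k)) [IsFiniteMeasure (μ.restrict Ω)]
    (hp : IsExponent (μ.restrict Ω) p P) {φ : M → ℝ} (h : IsC1TestFunction n Ω φ) :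
    modular (μ.restrict Ω) p (hgrad X φ) < ⊤ := by
  obtain ⟨C, hC⟩ := h.exists_norm_hgrad_le hX
  exact modular_lt_top_of_bounded hp (Eventually.of_forall hC)

theorem modular_lt_top_of_sub {F : Type*} [NormedAddCommGroup F]
    (hp : IsExponent (μ.restrict Ω) p P) {f g : M → F}
    (hg : AEStronglyMeasurable g (μ.restrict Ω))
    (h : modular (μ.restrict Ω) p (fun x => f x - g x) < ⊤)
    (h' : modular (μ.restrict Ω) p g < ⊤) : modular (μ.restrict Ω) p f < ⊤ := by
  have h1 := modular_add_le hp (f := g) (g := fun x => f x - g x) hg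
  simp only [add_sub_cancel] at h1
  exact h1.trans_lt (ENNReal.mul_lt_top ENNReal.ofReal_lt_top (ENNReal.add_lt_top.2 ⟨h', h⟩))

variable [IsManifold (𝓡 n) ∞ M]

theorem IsW0Limit.modular_lt_top [IsFiniteMeasure (μ.restrict Ω)]
    (hp : IsExponent (μ.restrict Ω) p P) (h : IsW0Limit μ X p Ω u G) :
    modular (μ.restrict Ω) p u < ⊤ := by
  obtain ⟨φ, h1, h2, h3⟩ := h.approx 1 one_ne_zero
  exact modular_lt_top_of_sub hp h1.isC1.aesm (h2.trans_lt ENNReal.one_lt_top)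
    (h1.isC1.modular_lt_top hp)

theorem IsW0Limit.modular_grad_lt_top [IsFiniteMeasure (μ.restrict Ω)]
    (hX : ∀ k, IsSmoothField (X k))
    (hp : IsExponent (μ.restrict Ω) p P) (h : IsW0Limit μ X p Ω u G) :
    modular (μ.restrict Ω) p G < ⊤ := by
  obtain ⟨φ, h1, h2, h3⟩ := h.approx 1 one_ne_zero
  exact modular_lt_top_of_sub hp (h1.isC1.aesm_hgrad hX) (h3.trans_lt ENNReal.one_lt_top)
    (h1.isC1.modular_hgrad_lt_top hX hp)

/-- The set of pairs `(u, G)` of the definition is closed under modular limits. -/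
theorem IsW0Limit.of_approx (hp : IsExponent (μ.restrict Ω) p P)
    (hu : AEStronglyMeasurable u (μ.restrict Ω)) (hG : AEStronglyMeasurable G (μ.restrict Ω))
    {f : ℕ → M → ℝ} {H : ℕ → M → EuclideanSpace ℝ (Fin N)}
    (hf : ∀ i, IsW0Limit μ X p Ω (f i) (H i))
    (h1 : Tendsto (fun i => modular (μ.restrict Ω) p (fun x => u x - f i x)) atTop (𝓝 0))
    (h2 : Tendsto (fun i => modular (μ.restrict Ω) p (fun x => G x - H i x)) atTop (𝓝 0)) :
    IsW0Limit μ X p Ω u G := by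
  refine ⟨hu, hG, fun ε hε => ?_⟩
  set c := ENNReal.ofReal (2 ^ P)
  have hc : c ≠ ⊤ := ENNReal.ofReal_ne_top
  obtain ⟨δ, hδ, hδε⟩ : ∃ δ : ℝ≥0∞, δ ≠ 0 ∧ c * (δ + δ) ≤ ε := by
    have : Tendsto (fun δ : ℝ≥0∞ => c * (δ + δ)) (𝓝[>] 0) (𝓝 (c * (0 + 0))) :=
      ENNReal.Tendsto.const_mul ((tendsto_nhdsWithin_of_tendsto_nhds
        (tendsto_id.add tendsto_id))) (Or.inr hc)
    simp only [add_zero, mul_zero] at this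
    obtain ⟨δ, h3, h4⟩ := ((ENNReal.tendsto_nhds_zero.1 this ε (pos_iff_ne_zero.2 hε)).and
      self_mem_nhdsWithin).exists
    exact ⟨δ, (pos_iff_ne_zero.1 h4), h3⟩
  obtain ⟨i, hi1, hi2⟩ := ((ENNReal.tendsto_nhds_zero.1 h1 δ (pos_iff_ne_zero.2 hδ)).and
    (ENNReal.tendsto_nhds_zero.1 h2 δ (pos_iff_ne_zero.2 hδ))).exists
  obtain ⟨φ, h3, h4, h5⟩ := (hf i).approx δ hδ
  refine ⟨φ, h3, ?_, ?_⟩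
  · have := modular_add_le hp (f := fun x => u x - f i x) (g := fun x => f i x - φ x)
      (hu.sub (hf i).aesm)
    simp only [sub_add_sub_cancel] at this
    exact this.trans ((mul_le_mul_right (add_le_add hi1 h4) c).trans hδε)
  · have := modular_add_le hp (f := fun x => G x - H i x) (g := fun x => H i x - hgrad X φ x)
      (hG.sub (hf i).aesm_grad)
    simp only [sub_add_sub_cancel] at this
    exact this.trans ((mul_le_mul_right (add_le_add hi2 h5) c).trans hδε)

theorem IsW0Limit.congr_grad (h : IsW0Limit μ X p Ω u G) {G' : M → EuclideanSpace ℝ (Fin N)}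
    (hG : G =ᵐ[μ.restrict Ω] G') : IsW0Limit μ X p Ω u G' := by
  refine ⟨h.aesm, h.aesm_grad.congr hG, fun ε hε => ?_⟩
  obtain ⟨φ, h1, h2, h3⟩ := h.approx ε hε
  refine ⟨φ, h1, h2, ?_⟩
  rwa [← modular_congr (f := fun x => G x - hgrad X φ x)]
  filter_upwards [hG] with x hx
  rw [hx]

theorem isTestFunction_zero : IsTestFunction n Ω (fun _ : M => (0 : ℝ)) := by
  refine ⟨contMDiff_const, HasCompactSupport.zero, ?_⟩
  simp [tsupport]

theorem isW0Limit_zero (hp : IsExponent (μ.restrict Ω) p P) :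
    IsW0Limit μ X p Ω (fun _ => 0) (fun _ => 0) := by
  refine ⟨aestronglyMeasurable_const, aestronglyMeasurable_const, fun ε _ =>
    ⟨fun _ => 0, isTestFunction_zero, ?_, ?_⟩⟩
  all_goals
    refine le_of_eq_of_le ?_ zero_le
    rw [modular, ← lintegral_zero (μ := μ.restrict Ω)]
    refine lintegral_congr_ae ?_
    filter_upwards [hp.one_lt] with x hx
    simp [hgrad_const, Real.zero_rpow (by linarith : p x ≠ 0)]

theorem IsTestFunction.add {φ ψ : M → ℝ} (h : IsTestFunction n Ω φ) (h' : IsTestFunction n Ω ψ) :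
    IsTestFunction n Ω (fun x => φ x + ψ x) :=
  ⟨h.smooth.add h'.smooth, h.compact.add h'.compact,
    (tsupport_add φ ψ).trans (union_subset h.support_subset h'.support_subset)⟩

theorem IsW0Limit.add (hp : IsExponent (μ.restrict Ω) p P) (hX : ∀ k, IsSmoothField (X k))
    {u' : M → ℝ}
    {G' : M → EuclideanSpace ℝ (Fin N)} (h : IsW0Limit μ X p Ω u G)
    (h' : IsW0Limit μ X p Ω u' G') :
    IsW0Limit μ X p Ω (fun x => u x + u' x) (fun x => G x + G' x) := by
  refine ⟨h.aesm.add h'.aesm, h.aesm_grad.add h'.aesm_grad, fun ε hε => ?_⟩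
  set c := ENNReal.ofReal (2 ^ P)
  have hc : c ≠ ⊤ := ENNReal.ofReal_ne_top
  obtain ⟨δ, hδ, hδε⟩ : ∃ δ : ℝ≥0∞, δ ≠ 0 ∧ c * (δ + δ) ≤ ε := by
    have : Tendsto (fun δ : ℝ≥0∞ => c * (δ + δ)) (𝓝[>] 0) (𝓝 (c * (0 + 0))) :=
      ENNReal.Tendsto.const_mul ((tendsto_nhdsWithin_of_tendsto_nhds
        (tendsto_id.add tendsto_id))) (Or.inr hc)
    simp only [add_zero, mul_zero] at this
    obtain ⟨δ, h3, h4⟩ := ((ENNReal.tendsto_nhds_zero.1 this ε (pos_iff_ne_zero.2 hε)).and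
      self_mem_nhdsWithin).exists
    exact ⟨δ, (pos_iff_ne_zero.1 h4), h3⟩
  obtain ⟨φ, h1, h2, h3⟩ := h.approx δ hδ
  obtain ⟨φ', h1', h2', h3'⟩ := h'.approx δ hδ
  refine ⟨fun x => φ x + φ' x, h1.add h1', ?_, ?_⟩
  · have := modular_add_le hp (f := fun x => u x - φ x) (g := fun x => u' x - φ' x)
      (h.aesm.sub h1.isC1.aesm)
    simp only [← add_sub_add_comm] at this
    exact this.trans ((mul_le_mul_right (add_le_add h2 h2') c).trans hδε)
  · have := modular_add_le hp (f := fun x => G x - hgrad X φ x)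
      (g := fun x => G' x - hgrad X φ' x) (h.aesm_grad.sub (h1.isC1.aesm_hgrad hX))
    simp only [← add_sub_add_comm] at this
    have e : ∀ x, hgrad X (fun y => φ y + φ' y) x = hgrad X φ x + hgrad X φ' x := fun x =>
      hgrad_add (h1.isC1.smooth.mdifferentiable one_ne_zero x)
        (h1'.isC1.smooth.mdifferentiable one_ne_zero x)
    simp only [e]
    exact this.trans ((mul_le_mul_right (add_le_add h3 h3') c).trans hδε)

/-- Finite modulars allow norm convergence to be read as modular convergence. Carrying the gradient
as part of the pair frees the later limit arguments from the arbitrary choice inside `weakGrad`. -/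
theorem MemW0.isW0Limit [IsFiniteMeasure (μ.restrict Ω)] (hX : ∀ k, IsSmoothField (X k))
    (hp : IsExponent (μ.restrict Ω) p P) (h : MemW0 μ X p Ω u) :
    IsW0Limit μ X p Ω u (weakGrad μ X Ω u) := by
  obtain ⟨φ, hφ, hlim⟩ := h.approx
  refine ⟨h.memW.memL.1, h.memW.memL_grad.1, fun ε hε => ?_⟩
  have hm1 : ∀ i, modular (μ.restrict Ω) p (fun x => u x - φ i x) < ⊤ := fun i =>
    (modular_sub_le hp h.memW.memL.1).trans_lt (ENNReal.mul_lt_top ENNReal.ofReal_lt_top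
      (ENNReal.add_lt_top.2 ⟨h.memW.memL.2, (hφ i).isC1.modular_lt_top hp⟩))
  have hm2 : ∀ i, modular (μ.restrict Ω) p (fun x => weakGrad μ X Ω u x - hgrad X (φ i) x) < ⊤ :=
    fun i => (modular_sub_le hp h.memW.memL_grad.1).trans_lt
      (ENNReal.mul_lt_top ENNReal.ofReal_lt_top (ENNReal.add_lt_top.2
        ⟨h.memW.memL_grad.2, (hφ i).isC1.modular_hgrad_lt_top hX hp⟩))
  have hl1 := tendsto_of_tendsto_of_tendsto_of_le_of_le tendsto_const_nhds hlim
    (fun i => luxNorm_nonneg _) (fun i => le_add_of_nonneg_right (luxNorm_nonneg _))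
  have hl2 := tendsto_of_tendsto_of_tendsto_of_le_of_le tendsto_const_nhds hlim
    (fun i => luxNorm_nonneg _) (fun i => le_add_of_nonneg_left (luxNorm_nonneg _))
  obtain ⟨i, hi1, hi2⟩ := ((ENNReal.tendsto_nhds_zero.1
    (tendsto_modular_of_tendsto_luxNorm hp hm1 hl1) ε (pos_iff_ne_zero.2 hε)).and
    (ENNReal.tendsto_nhds_zero.1
      (tendsto_modular_of_tendsto_luxNorm hp hm2 hl2) ε (pos_iff_ne_zero.2 hε))).exists
  exact ⟨φ i, hφ i, hi1, hi2⟩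

variable [T2Space M]

/-- Modular convergence on a set of finite measure implies `L¹` convergence, which preserves the
weak derivative identities of the test functions. -/
theorem IsW0Limit.isWeakGrad [IsFiniteMeasure (μ.restrict Ω)] (hμ : IsSmoothVolume n μ)
    (hX : ∀ k, IsSmoothField (X k)) (hΩ : IsOpen Ω)
    (hp : IsExponent (μ.restrict Ω) p P) (h : IsW0Limit μ X p Ω u G) :
    IsWeakGrad μ X Ω u G := by
  obtain ⟨φ, hφ, h1, h2⟩ := h.exists_seq
  have hu : IntegrableOn u Ω μ := integrable_of_modular_lt_top hp h.aesm (h.modular_lt_top hp)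
  have hG : IntegrableOn G Ω μ :=
    integrable_of_modular_lt_top hp h.aesm_grad (h.modular_grad_lt_top hX hp)
  have hφi : ∀ i, IntegrableOn (φ i) Ω μ := fun i =>
    integrable_of_modular_lt_top hp (hφ i).isC1.aesm ((hφ i).isC1.modular_lt_top hp)
  have hφg : ∀ i, IntegrableOn (hgrad X (φ i)) Ω μ := fun i =>
    integrable_of_modular_lt_top hp ((hφ i).isC1.aesm_hgrad hX)
      ((hφ i).isC1.modular_hgrad_lt_top hX hp)
  have hcoord : ∀ {H : M → EuclideanSpace ℝ (Fin N)} (k : Fin N), IntegrableOn H Ω μ →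
      IntegrableOn (fun x => H x k) Ω μ := fun k hH =>
    (EuclideanSpace.proj (𝕜 := ℝ) k : EuclideanSpace ℝ (Fin N) →L[ℝ] ℝ).integrable_comp hH
  refine ⟨hu.locallyIntegrableOn, hG.locallyIntegrableOn, fun k => ?_⟩
  refine IsWeakDeriv.of_tendsto hμ (hX k) hΩ (ui := φ) (wi := fun i x => hgrad X (φ i) x k)
    hu.1 (hcoord k hG).1 hu.locallyIntegrableOn (hcoord k hG).locallyIntegrableOn
    (fun i => (hφi i).1) (fun i => (hcoord k (hφg i)).1)
    (fun i => (hφi i).locallyIntegrableOn) (fun i => (hcoord k (hφg i)).locallyIntegrableOn)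
    (fun i => isWeakDeriv_of_contMDiffOn (hX k) hΩ (hφ i).isC1.smooth.contMDiffOn) ?_ ?_
  · intro K hK _
    refine tendsto_of_tendsto_of_tendsto_of_le_of_le tendsto_const_nhds
      (tendsto_lintegral_enorm_of_modular hp h1) (fun _ => zero_le) fun i => ?_
    refine (lintegral_mono_set hK).trans (lintegral_mono fun x => ?_)
    rw [← enorm_neg, neg_sub]
  · intro K hK _
    refine tendsto_of_tendsto_of_tendsto_of_le_of_le tendsto_const_nhds
      (tendsto_lintegral_enorm_of_modular hp h2) (fun _ => zero_le) fun i => ?_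
    refine (lintegral_mono_set hK).trans (lintegral_mono fun x => ?_)
    rw [← enorm_neg, neg_sub, ← PiLp.sub_apply, ← ofReal_norm, ← ofReal_norm]
    exact ENNReal.ofReal_le_ofReal (PiLp.norm_apply_le _ k)

theorem IsWeakGrad.ae_eq [SecondCountableTopology M] (hμ : IsSmoothVolume n μ)
    (hΩ : IsOpen Ω) {G' : M → EuclideanSpace ℝ (Fin N)}
    (hGm : AEStronglyMeasurable G (μ.restrict Ω))
    (hGm' : AEStronglyMeasurable G' (μ.restrict Ω))
    (h : IsWeakGrad μ X Ω u G) (h' : IsWeakGrad μ X Ω u G') : G =ᵐ[μ.restrict Ω] G' := by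
  have hL : ∀ k : Fin N, Continuous fun v : EuclideanSpace ℝ (Fin N) => v k := fun k =>
    (EuclideanSpace.proj (𝕜 := ℝ) k : EuclideanSpace ℝ (Fin N) →L[ℝ] ℝ).continuous
  have hcoord : ∀ {H : M → EuclideanSpace ℝ (Fin N)} (k : Fin N), LocallyIntegrableOn H Ω μ →
      LocallyIntegrableOn (fun x => H x k) Ω μ := fun k hH x hx => by
    obtain ⟨s, hs, hi⟩ := hH x hx
    exact ⟨s, hs,
      (EuclideanSpace.proj (𝕜 := ℝ) k : EuclideanSpace ℝ (Fin N) →L[ℝ] ℝ).integrable_comp hi⟩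
  have key : ∀ k, (fun x => G x k) =ᵐ[μ.restrict Ω] fun x => G' x k := fun k => by
    refine ae_eq_of_integral_comp_symm hμ hΩ (hcoord k h.locInt_grad) (hcoord k h'.locInt_grad)
      ((hL k).comp_aestronglyMeasurable hGm) ((hL k).comp_aestronglyMeasurable hGm') ?_
    intro e he φ h1 h2 h3
    rw [h.weak k e he φ h1 h2 h3, h'.weak k e he φ h1 h2 h3]
  filter_upwards [ae_all_iff.2 key] with x hx
  ext k
  exact hx k

/-- Uniqueness of weak gradients identifies any limit `G` with the chosen representative, so
explicit chain rule formulas may be inserted into the weak equation. -/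
theorem IsW0Limit.weakGrad_ae_eq [SecondCountableTopology M] [IsFiniteMeasure (μ.restrict Ω)]
    (hμ : IsSmoothVolume n μ) (hX : ∀ k, IsSmoothField (X k)) (hΩ : IsOpen Ω)
    (hp : IsExponent (μ.restrict Ω) p P) (h : IsW0Limit μ X p Ω u G) :
    weakGrad μ X Ω u =ᵐ[μ.restrict Ω] G := by
  have hw := h.isWeakGrad hμ hX hΩ hp
  have hex : ∃ G, IsWeakGrad μ X Ω u G := ⟨G, hw⟩
  have hwg : IsWeakGrad μ X Ω u (weakGrad μ X Ω u) := by
    unfold weakGrad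
    rw [dif_pos hex]
    exact hex.choose_spec
  exact hwg.ae_eq hμ hΩ (hwg.locInt_grad.aestronglyMeasurable) h.aesm_grad hw

theorem IsW0Limit.memW0 [SecondCountableTopology M] [IsFiniteMeasure (μ.restrict Ω)]
    (hμ : IsSmoothVolume n μ) (hX : ∀ k, IsSmoothField (X k)) (hΩ : IsOpen Ω)
    (hp : IsExponent (μ.restrict Ω) p P) (h : IsW0Limit μ X p Ω u G) :
    MemW0 μ X p Ω u := by
  have hae := h.weakGrad_ae_eq hμ hX hΩ hp
  have h' := h.congr_grad hae.symm
  obtain ⟨φ, hφ, h1, h2⟩ := h'.exists_seq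
  refine ⟨⟨⟨h.aesm, h.modular_lt_top hp⟩, ⟨G, h.isWeakGrad hμ hX hΩ hp⟩,
    ⟨h'.aesm_grad, h'.modular_grad_lt_top hX hp⟩⟩, φ, hφ, ?_⟩
  have := (tendsto_luxNorm_of_tendsto_modular hp h1).add (tendsto_luxNorm_of_tendsto_modular hp h2)
  simpa using this

end W0

/-! ### Mollification of `C¹` functions of compact support. -/

section Mollify

open scoped Convolution

variable {n : ℕ}

/-- Convolve with a bump whose radius is adapted to the uniform continuity of both `F` and its
derivative; the derivative of the convolution is the convolution of the derivative. -/
theorem exists_contDiff_approx {F : EuclideanSpace ℝ (Fin n) → ℝ} (hF : ContDiff ℝ 1 F)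
    (hc : HasCompactSupport F) {δ ε : ℝ} (hδ : 0 < δ) (hε : 0 < ε) :
    ∃ Φ : EuclideanSpace ℝ (Fin n) → ℝ, ContDiff ℝ ∞ Φ ∧
      (Function.support Φ ⊆ Metric.cthickening δ (tsupport F)) ∧
      (∀ y, |F y - Φ y| ≤ ε) ∧ ∀ y, ‖fderiv ℝ F y - fderiv ℝ Φ y‖ ≤ ε := by
  have hu1 := hc.uniformContinuous_of_continuous hF.continuous
  have hu2 := (hc.fderiv (𝕜 := ℝ)).uniformContinuous_of_continuous
    (hF.continuous_fderiv one_ne_zero)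
  obtain ⟨r1, hr1, h1⟩ := Metric.uniformContinuous_iff.1 hu1 ε hε
  obtain ⟨r2, hr2, h2⟩ := Metric.uniformContinuous_iff.1 hu2 ε hε
  set r := min δ (min r1 r2)
  have hr : 0 < r := lt_min hδ (lt_min hr1 hr2)
  let ψ : ContDiffBump (0 : EuclideanSpace ℝ (Fin n)) := ⟨r / 2, r, by linarith, by linarith⟩
  set Φ := ψ.normed volume ⋆[ContinuousLinearMap.lsmul ℝ ℝ, volume] F with hΦ
  have hloc : LocallyIntegrable (ψ.normed volume) volume :=
    ψ.continuous_normed.locallyIntegrable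
  have hder : ∀ y, HasFDerivAt Φ
      ((ψ.normed volume ⋆[ContinuousLinearMap.lsmul ℝ ℝ, volume] fderiv ℝ F) y) y := by
    intro y
    exact hc.hasFDerivAt_convolution_right (ContinuousLinearMap.lsmul ℝ ℝ) hloc hF y
  refine ⟨Φ, ?_, ?_, fun y => ?_, fun y => ?_⟩
  · exact ψ.hasCompactSupport_normed.contDiff_convolution_left _ ψ.contDiff_normed
      hF.continuous.locallyIntegrable
  · intro y hy
    obtain ⟨b, hb, k, hk, rfl⟩ := support_convolution_subset _ hy
    rw [ψ.support_normed_eq, mem_ball_zero_iff] at hb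
    refine Metric.mem_cthickening_of_dist_le _ k δ _ (subset_tsupport _ hk) ?_
    simp only [dist_eq_norm, add_sub_cancel_right]
    exact hb.le.trans (min_le_left _ _)
  · have := ψ.dist_normed_convolution_le (μ := volume) (x₀ := y) (g := F) (ε := ε)
      hF.continuous.aestronglyMeasurable fun x hx =>
        (h1 (lt_of_lt_of_le hx ((min_le_right _ _).trans (min_le_left _ _)))).le
    rw [Real.dist_eq] at this
    rw [abs_sub_comm]
    exact this
  · have := ψ.dist_normed_convolution_le (μ := volume) (x₀ := y) (g := fderiv ℝ F) (ε := ε)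
      (hF.continuous_fderiv one_ne_zero).aestronglyMeasurable fun x hx =>
        (h2 (lt_of_lt_of_le hx ((min_le_right _ _).trans (min_le_right _ _)))).le
    rw [(hder y).fderiv, norm_sub_rev, ← dist_eq_norm]
    exact this

end Mollify

/-! ### `C¹` functions with compact support belong to `W₀`. -/

section C1

variable {n N : ℕ} {M : Type*} [TopologicalSpace M] [T2Space M]
  [ChartedSpace (EuclideanSpace ℝ (Fin n)) M] [MeasurableSpace M] [BorelSpace M]
  [IsManifold (𝓡 n) ∞ M]
  {μ : Measure M} {X : Fin N → VField n M} {p : M → ℝ} {Ω : Set M} {P : ℝ}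

theorem euclidean_norm_le_sum (v : EuclideanSpace ℝ (Fin N)) : ‖v‖ ≤ ∑ k, |v k| := by
  conv_lhs => rw [← (EuclideanSpace.basisFun (Fin N) ℝ).sum_repr v]
  refine (norm_sum_le _ _).trans (Finset.sum_le_sum fun k _ => ?_)
  rw [norm_smul]
  simp

theorem isW0Limit_of_uniform [IsFiniteMeasure (μ.restrict Ω)] (hX : ∀ k, IsSmoothField (X k))
    (hp : IsExponent (μ.restrict Ω) p P) {f : M → ℝ} (hf : IsC1TestFunction n Ω f) {C : ℝ}
    (h : ∀ ε : ℝ, 0 < ε → ∃ φ, IsTestFunction n Ω φ ∧ (∀ x, |f x - φ x| ≤ ε) ∧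
      ∀ x, ‖hgrad X f x - hgrad X φ x‖ ≤ C * ε) :
    IsW0Limit μ X p Ω f (hgrad X f) := by
  -- The bound at `ε = 1` shows `C ≥ 0` as soon as `M` has a point; on an empty `M` there is nothing
  -- to estimate.
  have hC : 0 ≤ C ∨ ∀ x : M, False := by
    obtain ⟨φ, -, -, h1⟩ := h 1 one_pos
    by_cases hM : Nonempty M
    · obtain ⟨x⟩ := hM
      left; simpa using (norm_nonneg _).trans (h1 x)
    · right; exact fun x => hM ⟨x⟩
  choose φ h1 h2 h3 using fun i : ℕ => h (1 / ((i : ℝ) + 1)) Nat.one_div_pos_of_nat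
  have h0 : Tendsto (fun i : ℕ => 1 / ((i : ℝ) + 1)) atTop (𝓝 0) :=
    tendsto_one_div_add_atTop_nhds_zero_nat
  have hle : ∀ i : ℕ, 1 / ((i : ℝ) + 1) ≤ 1 := fun i => by
    rw [div_le_one (by positivity)]; linarith [(Nat.cast_nonneg i : (0:ℝ) ≤ i)]
  have l1 : Tendsto (fun i => modular (μ.restrict Ω) p (fun x => f x - φ i x)) atTop (𝓝 0) := by
    refine tendsto_modular_zero_of_dominated hp (fun i => hf.aesm.sub (h1 i).isC1.aesm)
      (b := fun _ => 1) (modular_lt_top_of_bounded hp (C := 1) (by simp))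
      (fun i => Eventually.of_forall fun x => (h2 i x).trans (hle i))
      (Eventually.of_forall fun x => squeeze_zero_norm (fun i => h2 i x) h0)
  have l2 : Tendsto (fun i => modular (μ.restrict Ω) p
      (fun x => hgrad X f x - hgrad X (φ i) x)) atTop (𝓝 0) := by
    refine tendsto_modular_zero_of_dominated hp
      (fun i => (hf.aesm_hgrad hX).sub ((h1 i).isC1.aesm_hgrad hX))
      (b := fun _ => |C|) (modular_lt_top_of_bounded hp (C := |C|) (by simp))
      (fun i => Eventually.of_forall fun x => (h3 i x).trans ?_)
      (Eventually.of_forall fun x => squeeze_zero_norm (fun i => h3 i x) ?_)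
    · rcases hC with hC | hC
      · exact (mul_le_of_le_one_right hC (hle i)).trans (le_abs_self C)
      · exact (hC x).elim
    · simpa using h0.const_mul C
  refine ⟨hf.aesm, hf.aesm_hgrad hX, fun ε hε => ?_⟩
  obtain ⟨i, hi1, hi2⟩ := ((ENNReal.tendsto_nhds_zero.1 l1 ε (pos_iff_ne_zero.2 hε)).and
    (ENNReal.tendsto_nhds_zero.1 l2 ε (pos_iff_ne_zero.2 hε))).exists
  exact ⟨φ i, h1 i, hi1, hi2⟩

/-- Transport to the chart, mollify there and carry the result back. The coordinate fields are
bounded on a compact neighbourhood of the support, so `C¹` closeness in coordinates controls the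
difference of horizontal gradients. -/
theorem IsC1TestFunction.isW0Limit_of_chart [IsFiniteMeasure (μ.restrict Ω)]
    (hX : ∀ k, IsSmoothField (X k)) (hΩ : IsOpen Ω)
    (hp : IsExponent (μ.restrict Ω) p P) {f : M → ℝ} (hf : IsC1TestFunction n Ω f)
    {e : OpenPartialHomeomorph M (EuclideanSpace ℝ (Fin n))}
    (he : e ∈ atlas (EuclideanSpace ℝ (Fin n)) M) (hfe : tsupport f ⊆ e.source) :
    IsW0Limit μ X p Ω f (hgrad X f) := by
  set O := e.target ∩ e.symm ⁻¹' Ω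
  have hO : IsOpen O := isOpen_target_inter hΩ
  set K := e '' tsupport f
  have hK : IsCompact K := IsCompact.image_of_continuousOn hf.compact (e.continuousOn.mono hfe)
  have hKO : K ⊆ O := by
    rintro _ ⟨x, hx, rfl⟩
    exact ⟨e.map_source (hfe hx), by
      rw [mem_preimage, e.left_inv (hfe hx)]; exact hf.support_subset hx⟩
  set F : EuclideanSpace ℝ (Fin n) → ℝ := e.target.indicator (f ∘ e.symm) with hFdef
  have hFt : ∀ y ∈ e.target, F =ᶠ[𝓝 y] f ∘ e.symm := fun y hy => by
    filter_upwards [e.open_target.mem_nhds hy] with z hz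
    rw [hFdef, indicator_of_mem hz]
  have hF0 : ∀ y, y ∉ K → F y = 0 := fun y hy => by
    by_cases hyt : y ∈ e.target
    · rw [hFdef, indicator_of_mem hyt]
      exact image_eq_zero_of_notMem_tsupport (f := f) fun h => hy ⟨e.symm y, h, e.right_inv hyt⟩
    · rw [hFdef, indicator_of_notMem hyt]
  have hFC : ContDiff ℝ 1 F := by
    rw [contDiff_iff_contDiffAt]
    intro y
    by_cases hy : y ∈ K
    · have hyt := (hKO hy).1
      refine ContDiffAt.congr_of_eventuallyEq ?_ (hFt y hyt)
      exact (contDiffOn_comp_symm he (hf.smooth.contMDiffOn (s := Ω))).contDiffAt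
        (hO.mem_nhds (hKO hy))
    · refine ContDiffAt.congr_of_eventuallyEq contDiffAt_const
        (f := fun _ => (0 : ℝ)) ?_
      filter_upwards [hK.isClosed.isOpen_compl.mem_nhds hy] with z hz
      exact hF0 z hz
  have hFs : tsupport F ⊆ K := closure_minimal (fun y hy => by
    by_contra h; exact hy (hF0 y h)) hK.isClosed
  have hFc : HasCompactSupport F := hK.of_isClosed_subset (isClosed_tsupport _) hFs
  obtain ⟨δ, hδ, hδO⟩ := hFc.exists_cthickening_subset_open hO (hFs.trans hKO)
  set K' := Metric.cthickening δ (tsupport F)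
  have hK' : IsCompact K' := IsCompact.cthickening hFc
  have hK't : K' ⊆ e.target := hδO.trans inter_subset_left
  obtain ⟨A, hA⟩ : ∃ A, ∀ k, ∀ y ∈ K', ‖chartField e (X k) y‖ ≤ A := by
    have : ∀ k, ∃ A, ∀ y ∈ K', ‖chartField e (X k) y‖ ≤ A := fun k =>
      hK'.exists_bound_of_continuousOn ((contDiffOn_chartField he (hX k)).continuousOn.mono hK't)
    choose A hA using this
    exact ⟨∑ k, |A k|, fun k y hy => (hA k y hy).trans ((le_abs_self _).trans
      (Finset.single_le_sum (f := fun k => |A k|) (fun _ _ => abs_nonneg _)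
        (Finset.mem_univ k)))⟩
  have hS : IsCompact (e.symm '' K') := hK'.image_of_continuousOn (e.continuousOn_symm.mono hK't)
  have hSΩ : e.symm '' K' ⊆ Ω := by rintro _ ⟨y, hy, rfl⟩; exact (hδO hy).2
  have hSe : e.symm '' K' ⊆ e.source := by
    rintro _ ⟨y, hy, rfl⟩; exact e.map_target (hK't hy)
  -- The Euclidean norm is at most the sum of the `N` components, each of which will be at most `|A|
  -- ε`.
  refine isW0Limit_of_uniform hX hp hf (C := ∑ _k : Fin N, |A|) fun ε hε => ?_
  obtain ⟨Φ, hΦ, hΦs, hΦ1, hΦ2⟩ := exists_contDiff_approx hFC hFc hδ hε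
  set φ : M → ℝ := e.source.indicator (Φ ∘ e) with hφdef
  have hφ0 : ∀ x, x ∉ e.symm '' K' → φ x = 0 := fun x hx => by
    by_cases hxs : x ∈ e.source
    · rw [hφdef, indicator_of_mem hxs]
      by_contra h
      exact hx ⟨e x, hΦs h, e.left_inv hxs⟩
    · rw [hφdef, indicator_of_notMem hxs]
  have hφs : tsupport φ ⊆ e.symm '' K' := closure_minimal (fun y hy => by
    by_contra h; exact hy (hφ0 y h)) hS.isClosed
  have hφsm : ContMDiff (𝓡 n) 𝓘(ℝ, ℝ) ∞ φ := by
    intro x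
    by_cases hx : x ∈ e.source
    · have h1 : ContMDiffAt (𝓡 n) 𝓘(ℝ, ℝ) ∞ (Φ ∘ e) x :=
        (contMDiffAt_iff_contDiffAt.2 hΦ.contDiffAt).comp x
          ((contMDiffOn_atlas he).contMDiffAt (e.open_source.mem_nhds hx))
      refine h1.congr_of_eventuallyEq ?_
      filter_upwards [e.open_source.mem_nhds hx] with z hz
      rw [hφdef, indicator_of_mem hz]
    · refine ContMDiffAt.congr_of_eventuallyEq (f := fun _ => (0 : ℝ)) contMDiffAt_const ?_
      filter_upwards [hS.isClosed.isOpen_compl.mem_nhds fun h => hx (hSe h)] with z hz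
      exact hφ0 z hz
  have hφT : IsTestFunction n Ω φ :=
    ⟨hφsm, hS.of_isClosed_subset (isClosed_tsupport _) hφs, hφs.trans hSΩ⟩
  refine ⟨φ, hφT, fun x => ?_, fun x => ?_⟩
  · by_cases hx : x ∈ e.source
    · have := hΦ1 (e x)
      rw [hFdef, indicator_of_mem (e.map_source hx), Function.comp_apply, e.left_inv hx] at this
      rw [hφdef, indicator_of_mem hx]
      exact this
    · rw [hφdef, indicator_of_notMem hx, image_eq_zero_of_notMem_tsupport fun h => hx (hfe h)]
      simpa using hε.le
  · by_cases hx : x ∈ e.source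
    · refine (euclidean_norm_le_sum _).trans ?_
      rw [Finset.sum_mul]
      refine Finset.sum_le_sum fun k _ => ?_
      have hxt := e.map_source hx
      have e1 := mfderiv_apply_eq_fderiv he (X k) hxt (f := f)
        (hf.smooth.mdifferentiable one_ne_zero _)
      have e2 := mfderiv_apply_eq_fderiv he (X k) hxt (f := φ)
        (hφT.isC1.smooth.mdifferentiable one_ne_zero _)
      rw [e.left_inv hx, ← (hFt _ hxt).fderiv_eq] at e1
      have hφe : φ ∘ e.symm =ᶠ[𝓝 (e x)] Φ := by
        filter_upwards [e.open_target.mem_nhds hxt] with z hz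
        rw [hφdef, Function.comp_apply, indicator_of_mem (e.map_target hz),
          Function.comp_apply, e.right_inv hz]
      rw [e.left_inv hx, hφe.fderiv_eq] at e2
      have e3 : (hgrad X f x - hgrad X φ x) k
          = (fderiv ℝ F (e x) - fderiv ℝ Φ (e x)) (chartField e (X k) (e x)) := by
        rw [PiLp.sub_apply, hgrad_apply, hgrad_apply, sub_apply]
        exact congrArg₂ (fun a b : ℝ => a - b) e1 e2
      rw [e3]
      by_cases hxK : e x ∈ K'
      · rw [← Real.norm_eq_abs]
        refine (ContinuousLinearMap.le_opNorm _ _).trans ?_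
        rw [mul_comm]
        gcongr
        · exact (hA k _ hxK).trans (le_abs_self A)
        · exact hΦ2 _
      · have z1 : fderiv ℝ F (e x) = 0 := by
          by_contra h
          exact hxK (Metric.self_subset_cthickening _ (support_fderiv_subset ℝ h))
        have z2 : fderiv ℝ Φ (e x) = 0 := by
          by_contra h
          exact hxK ((closure_minimal hΦs Metric.isClosed_cthickening)
            (support_fderiv_subset ℝ h))
        rw [z1, z2]
        simp only [sub_zero, ContinuousLinearMap.zero_apply, abs_zero]
        positivity
    · rw [hgrad_eq_zero_of_notMem_tsupport fun h => hx (hfe h),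
        hgrad_eq_zero_of_notMem_tsupport fun h => hx (hSe (hφs h))]
      simp only [sub_zero, norm_zero]
      have : 0 ≤ ∑ _k : Fin N, |A| := Finset.sum_nonneg fun _ _ => abs_nonneg _
      positivity

theorem isW0Limit_sum {ι : Type*} [IsFiniteMeasure (μ.restrict Ω)]
    (hX : ∀ k, IsSmoothField (X k)) (hp : IsExponent (μ.restrict Ω) p P) (s : Finset ι)
    {f : ι → M → ℝ} (hf : ∀ i ∈ s, IsC1TestFunction n Ω (f i))
    (h : ∀ i ∈ s, IsW0Limit μ X p Ω (f i) (hgrad X (f i))) :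
    ContMDiff (𝓡 n) 𝓘(ℝ, ℝ) 1 (fun x => ∑ i ∈ s, f i x) ∧
    IsW0Limit μ X p Ω (fun x => ∑ i ∈ s, f i x) (hgrad X (fun x => ∑ i ∈ s, f i x)) := by
  classical
  induction s using Finset.induction_on with
  | empty =>
    simp only [Finset.sum_empty]
    refine ⟨contMDiff_const, ?_⟩
    convert isW0Limit_zero (X := X) hp using 1
    ext1 x
    exact hgrad_const 0 x
  | insert i s hi ih =>
    obtain ⟨h1, h2⟩ := ih (fun j hj => hf j (Finset.mem_insert_of_mem hj))
      (fun j hj => h j (Finset.mem_insert_of_mem hj))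
    simp only [Finset.sum_insert hi]
    have h3 := (hf i (Finset.mem_insert_self i s)).smooth
    refine ⟨h3.add h1, ?_⟩
    convert (h i (Finset.mem_insert_self i s)).add hp hX h2 using 1
    ext1 x
    exact hgrad_add (h3.mdifferentiable one_ne_zero x) (h1.mdifferentiable one_ne_zero x)

/-- `C¹` functions with compact support are limits of test functions. -/
theorem IsC1TestFunction.isW0Limit [SecondCountableTopology M] [IsFiniteMeasure (μ.restrict Ω)]
    (hX : ∀ k, IsSmoothField (X k)) (hΩ : IsOpen Ω)
    (hp : IsExponent (μ.restrict Ω) p P) {f : M → ℝ} (hf : IsC1TestFunction n Ω f) :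
    IsW0Limit μ X p Ω f (hgrad X f) := by
  have : LocallyCompactSpace M := ChartedSpace.locallyCompactSpace (EuclideanSpace ℝ (Fin n)) M
  -- A smooth partition of unity reduces matters to supports inside one chart; by compactness only
  -- finitely many of its members meet the support of `f`.
  obtain ⟨ρ, hρ⟩ := SmoothPartitionOfUnity.exists_isSubordinate (𝓡 n) (isClosed_tsupport f)
    (fun x : M => (chartAt (EuclideanSpace ℝ (Fin n)) x).source)
    (fun x => (chartAt (EuclideanSpace ℝ (Fin n)) x).open_source)
    (fun x _ => mem_iUnion.2 ⟨x, mem_chart_source _ x⟩)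
  have hfin : {i | (Function.support (ρ i) ∩ tsupport f).Nonempty}.Finite :=
    ρ.locallyFinite.finite_nonempty_inter_compact hf.compact
  set s := hfin.toFinset
  have hsum : f = fun x => ∑ i ∈ s, ρ i x * f x := by
    funext x
    by_cases hx : x ∈ tsupport f
    · rw [← Finset.sum_mul]
      have h1 := ρ.sum_eq_one hx
      rw [finsum_eq_sum_of_support_subset _ (s := s)] at h1
      · rw [h1, one_mul]
      · intro i hi
        simp only [s, Finite.coe_toFinset]
        exact ⟨x, hi, hx⟩
    · simp [image_eq_zero_of_notMem_tsupport hx]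
  have hC1 : ∀ i, IsC1TestFunction n Ω (fun x => ρ i x * f x) := fun i =>
    ⟨((ρ i).contMDiff.of_le (by simp)).mul hf.smooth, hf.compact.mul_left,
      (closure_mono (Function.support_mul_subset_right _ f)).trans hf.support_subset⟩
  have key := isW0Limit_sum hX hp s (f := fun i x => ρ i x * f x) (fun i _ => hC1 i)
    fun i _ => (hC1 i).isW0Limit_of_chart hX hΩ hp (chart_mem_atlas _ i)
      ((closure_mono (Function.support_mul_subset_left (ρ i) f)).trans (hρ i))
  rw [← hsum] at key
  exact key.2

end C1

/-! ### Chain rules for the horizontal gradient and for limits. -/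

section Chain

variable {n N : ℕ} {M : Type*} [TopologicalSpace M]
  [ChartedSpace (EuclideanSpace ℝ (Fin n)) M] [IsManifold (𝓡 n) ∞ M]

/-- The curve is, in the chart, the straight line in the direction of the coordinate field. Testing
along it turns the chain rule for `hgrad` into calculus of one real variable. -/
theorem exists_curve (V : VField n M) (x : M) : ∃ γ : ℝ → M, γ 0 = x ∧
    ∀ f : M → ℝ, MDifferentiableAt (𝓡 n) 𝓘(ℝ, ℝ) f x →
      HasDerivAt (f ∘ γ) (mfderiv (𝓡 n) 𝓘(ℝ, ℝ) f x (V x) : ℝ) 0 := by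
  set e := chartAt (EuclideanSpace ℝ (Fin n)) x
  have he : e ∈ atlas (EuclideanSpace ℝ (Fin n)) M := chart_mem_atlas _ x
  have hx : x ∈ e.source := mem_chart_source _ x
  set w := chartField e V (e x)
  have h0 : e.symm (e x + (0 : ℝ) • w) = x := by simp [e.left_inv hx]
  refine ⟨fun t => e.symm (e x + t • w), h0, fun f hf => ?_⟩
  have h1 := mfderiv_apply_eq_fderiv he V (e.map_source hx) (f := f) (by rwa [e.left_inv hx])
  rw [e.left_inv hx] at h1
  have hd : DifferentiableAt ℝ (f ∘ e.symm) (e x) := by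
    rw [← mdifferentiableAt_iff_differentiableAt]
    refine MDifferentiableAt.comp (I' := 𝓡 n) _ (by rwa [e.left_inv hx]) ?_
    exact (mdifferentiable_atlas he).mdifferentiableAt_symm (e.map_source hx)
  have hl : HasDerivAt (fun t : ℝ => e x + t • w) w 0 := by
    simpa using ((hasDerivAt_id (0 : ℝ)).smul_const w).const_add (e x)
  have h2 := HasFDerivAt.comp_hasDerivAt (0 : ℝ) (l := f ∘ e.symm)
    (f := fun t : ℝ => e x + t • w) (l' := fderiv ℝ (f ∘ e.symm) (e x))
    (by simpa using hd.hasFDerivAt) hl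
  exact h2.congr_deriv h1.symm

/-- The chain rule for the horizontal gradient, for functions of three scalar functions. -/
theorem hgrad_eq_of_hasDerivAt {X : Fin N → VField n M} {ψ f₁ f₂ f₃ : M → ℝ} {x : M}
    {α₁ α₂ α₃ : ℝ}
    (hψ : MDifferentiableAt (𝓡 n) 𝓘(ℝ, ℝ) ψ x) (h₁ : MDifferentiableAt (𝓡 n) 𝓘(ℝ, ℝ) f₁ x)
    (h₂ : MDifferentiableAt (𝓡 n) 𝓘(ℝ, ℝ) f₂ x) (h₃ : MDifferentiableAt (𝓡 n) 𝓘(ℝ, ℝ) f₃ x)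
    (h : ∀ (γ : ℝ → M) (d₁ d₂ d₃ : ℝ), γ 0 = x → HasDerivAt (fun t => f₁ (γ t)) d₁ 0 →
      HasDerivAt (fun t => f₂ (γ t)) d₂ 0 → HasDerivAt (fun t => f₃ (γ t)) d₃ 0 →
      HasDerivAt (fun t => ψ (γ t)) (α₁ * d₁ + α₂ * d₂ + α₃ * d₃) 0) :
    hgrad X ψ x = α₁ • hgrad X f₁ x + α₂ • hgrad X f₂ x + α₃ • hgrad X f₃ x := by
  ext k
  obtain ⟨γ, h0, hγ⟩ := exists_curve (X k) x
  have := (hγ ψ hψ).unique (h γ _ _ _ h0 (hγ f₁ h₁) (hγ f₂ h₂) (hγ f₃ h₃))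
  rw [hgrad_apply, this]
  simp only [PiLp.add_apply, PiLp.smul_apply, hgrad_apply]
  rfl

theorem isC1TestFunction_of_contMDiffOn {Ω : Set M} (hΩ : IsOpen Ω) {f H : M → ℝ}
    (hf : ContMDiffOn (𝓡 n) 𝓘(ℝ, ℝ) 1 f Ω) (hH : IsC1TestFunction n Ω H)
    (h0 : ∀ x, H x = 0 → f x = 0) : IsC1TestFunction n Ω f := by
  have hs : tsupport f ⊆ tsupport H := closure_mono fun x hx h => hx (h0 x h)
  refine ⟨contMDiff_of_tsupport fun x hx => ?_,
    hH.compact.of_isClosed_subset (isClosed_tsupport _) hs, hs.trans hH.support_subset⟩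
  exact hf.contMDiffAt (hΩ.mem_nhds (hH.support_subset (hs hx)))

variable [MeasurableSpace M] [BorelSpace M] [T2Space M] [SecondCountableTopology M]
  {μ : Measure M} {X : Fin N → VField n M} {p : M → ℝ} {Ω : Set M} {P : ℝ}

theorem tendsto_modular_const_mul_add {F : Type*} [NormedAddCommGroup F]
    {ν : Measure M} (hp : IsExponent ν p P) {f g : ℕ → M → F}
    (hf : ∀ i, AEStronglyMeasurable (f i) ν)
    (h1 : Tendsto (fun i => modular ν p (f i)) atTop (𝓝 0))
    (h2 : Tendsto (fun i => modular ν p (g i)) atTop (𝓝 0)) :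
    Tendsto (fun i => modular ν p (fun x => f i x + g i x)) atTop (𝓝 0) := by
  have h3 : Tendsto (fun i => ENNReal.ofReal (2 ^ P) * (modular ν p (f i) + modular ν p (g i)))
      atTop (𝓝 0) := by
    have := ENNReal.Tendsto.const_mul (a := ENNReal.ofReal (2 ^ P)) (h1.add h2)
      (Or.inr ENNReal.ofReal_ne_top)
    simpa using this
  exact tendsto_of_tendsto_of_tendsto_of_le_of_le tendsto_const_nhds h3 (fun _ => zero_le)
    fun i => modular_add_le hp (hf i)

/-- Limits of `C¹` functions whose gradients are bounded combinations of convergent ones. -/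
theorem isW0Limit_of_bounded_coeff [IsFiniteMeasure (μ.restrict Ω)]
    (hX : ∀ k, IsSmoothField (X k)) (hΩ : IsOpen Ω) (hp : IsExponent (μ.restrict Ω) p P)
    {G : M → EuclideanSpace ℝ (Fin N)} (hG : AEStronglyMeasurable G (μ.restrict Ω))
    (hGm : modular (μ.restrict Ω) p G < ⊤) {φ : ℕ → M → ℝ} (hφ : ∀ i, IsTestFunction n Ω (φ i))
    (hlim : Tendsto (fun i => modular (μ.restrict Ω) p (fun x => G x - hgrad X (φ i) x))
      atTop (𝓝 0))
    {f c : ℕ → M → ℝ} {b : ℕ → M → EuclideanSpace ℝ (Fin N)}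
    (hf : ∀ i, IsC1TestFunction n Ω (f i))
    (hgr : ∀ i, ∀ x ∈ Ω, hgrad X (f i) x = b i x + c i x • hgrad X (φ i) x)
    (hb : ∀ i, ContinuousOn (b i) Ω) (hc : ∀ i, ContinuousOn (c i) Ω) {C : ℝ} (hC : 1 ≤ C)
    (hfC : ∀ i, ∀ x ∈ Ω, |f i x| ≤ C) (hbC : ∀ i, ∀ x ∈ Ω, ‖b i x‖ ≤ C)
    (hcC : ∀ i, ∀ x ∈ Ω, |c i x| ≤ C)
    {f' c' : M → ℝ} {b' : M → EuclideanSpace ℝ (Fin N)}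
    (hf' : ∀ᵐ x ∂(μ.restrict Ω), Tendsto (fun i => f i x) atTop (𝓝 (f' x)))
    (hb' : ∀ᵐ x ∂(μ.restrict Ω), Tendsto (fun i => b i x) atTop (𝓝 (b' x)))
    (hc' : ∀ᵐ x ∂(μ.restrict Ω), Tendsto (fun i => c i x) atTop (𝓝 (c' x))) :
    IsW0Limit μ X p Ω f' (fun x => b' x + c' x • G x) := by
  have hbm : ∀ i, AEStronglyMeasurable (b i) (μ.restrict Ω) := fun i =>
    (hb i).aestronglyMeasurable hΩ.measurableSet
  have hcm : ∀ i, AEStronglyMeasurable (c i) (μ.restrict Ω) := fun i =>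
    (hc i).aestronglyMeasurable hΩ.measurableSet
  have hf'm := aestronglyMeasurable_of_tendsto_ae atTop (fun i => (hf i).aesm) hf'
  have hb'm := aestronglyMeasurable_of_tendsto_ae atTop hbm hb'
  have hc'm := aestronglyMeasurable_of_tendsto_ae atTop hcm hc'
  have hmem := ae_restrict_mem (μ := μ) hΩ.measurableSet
  have hc'C : ∀ᵐ x ∂(μ.restrict Ω), |c' x| ≤ C := by
    filter_upwards [hmem, hc'] with x hx h
    exact le_of_tendsto h.abs (Eventually.of_forall fun i => hcC i x hx)
  refine IsW0Limit.of_approx hp hf'm (hb'm.add (hc'm.smul hG)) (f := f)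
    (fun i => (hf i).isW0Limit hX hΩ hp) ?_ ?_
  · refine tendsto_modular_zero_of_dominated hp (fun i => hf'm.sub (hf i).aesm)
      (b := fun _ => C + C) (modular_lt_top_of_bounded hp (C := |C + C|) (by simp)) ?_ ?_
    · intro i
      filter_upwards [hmem, hf'] with x hx h
      refine (norm_sub_le _ _).trans (add_le_add ?_ (hfC i x hx))
      exact le_of_tendsto h.norm (Eventually.of_forall fun i => hfC i x hx)
    · filter_upwards [hf'] with x h
      simpa using h.const_sub (f' x)
  -- The gradient error splits as `(b' - b i) + (c' - c i) • G + c i • (G - hgrad X (φ i))`. Bounded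
  -- convergence handles the first piece, domination by a multiple of `‖G‖` the second, and
  -- boundedness of `c i` the third.
  · have t1 : Tendsto (fun i => modular (μ.restrict Ω) p (fun x => b' x - b i x)) atTop (𝓝 0) := by
      refine tendsto_modular_zero_of_dominated hp (fun i => hb'm.sub (hbm i))
        (b := fun _ => C + C) (modular_lt_top_of_bounded hp (C := |C + C|) (by simp)) ?_ ?_
      · intro i
        filter_upwards [hmem, hb'] with x hx h
        refine (norm_sub_le _ _).trans (add_le_add ?_ (hbC i x hx))
        exact le_of_tendsto h.norm (Eventually.of_forall fun i => hbC i x hx)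
      · filter_upwards [hb'] with x h
        simpa using h.const_sub (b' x)
    have t2 : Tendsto (fun i => modular (μ.restrict Ω) p (fun x => (c' x - c i x) • G x))
        atTop (𝓝 0) := by
      have hbd : modular (μ.restrict Ω) p (fun x => (C + C) * ‖G x‖) < ⊤ := by
        have := modular_smul_le hp (c := fun _ => C + C) (C := C + C) (by linarith)
          (Eventually.of_forall fun _ => (abs_of_nonneg (by linarith)).le) (fun x => ‖G x‖)
        refine this.trans_lt (ENNReal.mul_lt_top ENNReal.ofReal_lt_top ?_)
        refine lt_of_eq_of_lt ?_ hGm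
        simp [modular]
      refine tendsto_modular_zero_of_dominated hp (fun i => (hc'm.sub (hcm i)).smul hG) hbd ?_ ?_
      · intro i
        filter_upwards [hmem, hc'C] with x hx h
        rw [norm_smul]
        gcongr
        exact (norm_sub_le _ _).trans (add_le_add h (hcC i x hx))
      · filter_upwards [hc'] with x h
        have : Tendsto (fun i => (c' x - c i x) • G x) atTop (𝓝 ((c' x - c' x) • G x)) :=
          (h.const_sub (c' x)).smul_const (G x)
        simpa using this
    have t3 : Tendsto (fun i => modular (μ.restrict Ω) p
        (fun x => c i x • (G x - hgrad X (φ i) x))) atTop (𝓝 0) := by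
      have h3 : Tendsto (fun i => ENNReal.ofReal (C ^ P) * modular (μ.restrict Ω) p
          (fun x => G x - hgrad X (φ i) x)) atTop (𝓝 0) := by
        have := ENNReal.Tendsto.const_mul (a := ENNReal.ofReal (C ^ P)) hlim
          (Or.inr ENNReal.ofReal_ne_top)
        simpa using this
      refine tendsto_of_tendsto_of_tendsto_of_le_of_le tendsto_const_nhds h3 (fun _ => zero_le)
        fun i => modular_smul_le hp hC ?_ _
      filter_upwards [hmem] with x hx
      exact hcC i x hx
    have t4 := tendsto_modular_const_mul_add hp
      (f := fun i x => (b' x - b i x) + (c' x - c i x) • G x)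
      (g := fun i x => c i x • (G x - hgrad X (φ i) x))
      (fun i => (hb'm.sub (hbm i)).add ((hc'm.sub (hcm i)).smul hG))
      (tendsto_modular_const_mul_add hp (fun i => hb'm.sub (hbm i)) t1 t2) t3
    refine t4.congr fun i => modular_congr ?_
    filter_upwards [hmem] with x hx
    simp only [hgr i x hx, smul_sub, sub_smul]
    abel

end Chain

/-! ### Scalar bounds and derivatives for the Picone test function. -/

section RealBounds

variable {ε v p q P : ℝ}

theorem rpow_one_sub_le (hε : 0 < ε) (hε1 : ε ≤ 1) (hv : ε ≤ v) (hp : 1 < p) (hP : p ≤ P) :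
    v ^ (1 - p) ≤ ε ^ (-P) :=
  (Real.rpow_le_rpow_of_nonpos hε hv (by linarith)).trans
    (Real.rpow_le_rpow_of_exponent_ge hε hε1 (by linarith))

theorem rpow_neg_le (hε : 0 < ε) (hε1 : ε ≤ 1) (hv : ε ≤ v) (hp : 1 < p) (hP : p ≤ P) :
    v ^ (-p) ≤ ε ^ (-P) :=
  (Real.rpow_le_rpow_of_nonpos hε hv (by linarith)).trans
    (Real.rpow_le_rpow_of_exponent_ge hε hε1 (by linarith))

/-- For `v ≤ 1` the logarithm is at most `|log ε|` in absolute value. For `v ≥ 1` it is absorbed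
through `log v ≤ v^(q-1)/(q-1)`, which needs exponents bounded away from 1; this is the purpose of
`q`. -/
theorem abs_rpow_mul_log_le (hε : 0 < ε) (hε1 : ε ≤ 1) (hv : ε ≤ v) (hq : 1 < q) (hqp : q ≤ p)
    (hP : p ≤ P) : |v ^ (1 - p) * Real.log v| ≤ ε ^ (-P) * |Real.log ε| + 1 / (q - 1) := by
  have hv0 : 0 < v := hε.trans_le hv
  have hq1 : 0 < q - 1 := by linarith
  have hB : 0 ≤ ε ^ (-P) := by positivity
  rw [abs_mul, abs_of_pos (Real.rpow_pos_of_pos hv0 _)]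
  rcases le_total v 1 with h | h
  · have h1 : |Real.log v| ≤ |Real.log ε| := by
      rw [abs_of_nonpos (Real.log_nonpos hv0.le h), abs_of_nonpos (Real.log_nonpos hε.le hε1)]
      exact neg_le_neg (Real.log_le_log hε hv)
    have h2 := mul_le_mul (rpow_one_sub_le hε hε1 hv (hq.trans_le hqp) hP) h1 (abs_nonneg _) hB
    have : 0 ≤ 1 / (q - 1) := by positivity
    linarith
  · rw [abs_of_nonneg (Real.log_nonneg h)]
    have h1 := Real.log_le_rpow_div hv0.le hq1
    have h2 : v ^ (1 - p) * Real.log v ≤ v ^ (1 - p) * (v ^ (q - 1) / (q - 1)) :=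
      mul_le_mul_of_nonneg_left h1 (by positivity)
    have h3 : v ^ (1 - p) * (v ^ (q - 1) / (q - 1)) = v ^ (q - p) / (q - 1) := by
      rw [mul_div_assoc', ← Real.rpow_add hv0]; congr 2; ring
    have h4 : v ^ (q - p) ≤ 1 := Real.rpow_le_one_of_one_le_of_nonpos h (by linarith)
    have h5 : v ^ (q - p) / (q - 1) ≤ 1 / (q - 1) := by gcongr
    have : 0 ≤ ε ^ (-P) * |Real.log ε| := by positivity
    linarith

theorem abs_div_sqrt_le (u δ : ℝ) : |u / √(u ^ 2 + δ ^ 2)| ≤ 1 := by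
  rw [abs_div, abs_of_nonneg (Real.sqrt_nonneg _)]
  refine div_le_one_of_le₀ ?_ (Real.sqrt_nonneg _)
  exact Real.abs_le_sqrt (by nlinarith [sq_nonneg δ])

/-- The derivative is grouped by `h'`, `p'` and `u'`, the form in which `hgrad_eq_of_hasDerivAt`
takes its three coefficients. -/
theorem hasDerivAt_mul_sqrt_rpow {H u p : ℝ → ℝ} {h' u' p' : ℝ} {δ : ℝ} (hε : 0 < ε)
    (hδ : 0 < δ) (hH : HasDerivAt H h' 0) (hu : HasDerivAt u u' 0) (hp : HasDerivAt p p' 0) :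
    HasDerivAt (fun t => H t * (ε + √(u t ^ 2 + δ ^ 2)) ^ (1 - p t))
      ((ε + √(u 0 ^ 2 + δ ^ 2)) ^ (1 - p 0) * h'
        + -(H 0 * ((ε + √(u 0 ^ 2 + δ ^ 2)) ^ (1 - p 0) * Real.log (ε + √(u 0 ^ 2 + δ ^ 2)))) * p'
        + H 0 * ((1 - p 0) * (ε + √(u 0 ^ 2 + δ ^ 2)) ^ (-p 0) * (u 0 / √(u 0 ^ 2 + δ ^ 2)))
          * u') 0 := by
  have hpos : 0 < u 0 ^ 2 + δ ^ 2 := by positivity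
  have hs : 0 < √(u 0 ^ 2 + δ ^ 2) := Real.sqrt_pos.2 hpos
  have h1 : HasDerivAt (fun t => ε + √(u t ^ 2 + δ ^ 2))
      (2 * u 0 * u' / (2 * √(u 0 ^ 2 + δ ^ 2))) 0 := by
    have := ((hu.pow 2).add_const (δ ^ 2)).sqrt hpos.ne'
    refine (this.const_add ε).congr_deriv ?_
    simp
  have h2 := h1.rpow ((hasDerivAt_const (0:ℝ) (1:ℝ)).sub hp) (by positivity)
  refine (hH.mul h2).congr_deriv ?_
  have e : (1 - p 0 - 1) = -p 0 := by ring
  simp only [Pi.sub_apply, e]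
  field_simp
  ring

theorem hasDerivAt_sqrt_pow {φ p : ℝ → ℝ} {φ' p' : ℝ} {δ : ℝ} (hδ : 0 < δ)
    (hφ : HasDerivAt φ φ' 0) (hp : HasDerivAt p p' 0) :
    HasDerivAt (fun t => √(φ t ^ 2 + δ ^ 2) ^ p t - δ ^ p t)
      (p 0 * √(φ 0 ^ 2 + δ ^ 2) ^ (p 0 - 1) * (φ 0 / √(φ 0 ^ 2 + δ ^ 2)) * φ'
        + (√(φ 0 ^ 2 + δ ^ 2) ^ p 0 * Real.log (√(φ 0 ^ 2 + δ ^ 2)) - δ ^ p 0 * Real.log δ) * p')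
      0 := by
  have hpos : 0 < φ 0 ^ 2 + δ ^ 2 := by positivity
  have hs : 0 < √(φ 0 ^ 2 + δ ^ 2) := Real.sqrt_pos.2 hpos
  have h1 := ((hφ.pow 2).add_const (δ ^ 2)).sqrt hpos.ne'
  have h2 := h1.rpow hp hs
  have h3 := (hasDerivAt_const (0:ℝ) δ).rpow hp hδ
  refine (h2.sub h3).congr_deriv ?_
  simp
  field_simp
  ring

end RealBounds

/-! ### The regularized test function `|φ|^p u^(1-p)`. -/

section TestFunction

variable {n N : ℕ} {M : Type*} [TopologicalSpace M]
  [ChartedSpace (EuclideanSpace ℝ (Fin n)) M] [IsManifold (𝓡 n) ∞ M]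
  {X : Fin N → VField n M} {p : M → ℝ} {Ω : Set M}

theorem contMDiffOn_comp₃ {Φ : ℝ × ℝ × ℝ → ℝ} (hΦ : ContDiff ℝ 1 Φ) {f g h : M → ℝ}
    (hf : ContMDiffOn (𝓡 n) 𝓘(ℝ, ℝ) 1 f Ω) (hg : ContMDiffOn (𝓡 n) 𝓘(ℝ, ℝ) 1 g Ω)
    (hh : ContMDiffOn (𝓡 n) 𝓘(ℝ, ℝ) 1 h Ω) :
    ContMDiffOn (𝓡 n) 𝓘(ℝ, ℝ) 1 (fun x => Φ (f x, g x, h x)) Ω :=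
  hΦ.contMDiff.comp_contMDiffOn (hf.prodMk_space (hg.prodMk_space hh))

theorem contDiff_mul_sqrt_rpow {ε δ : ℝ} (hε : 0 < ε) (hδ : 0 < δ) :
    ContDiff ℝ 1 fun z : ℝ × ℝ × ℝ => z.1 * (ε + √(z.2.1 ^ 2 + δ ^ 2)) ^ (1 - z.2.2) := by
  have h1 : ContDiff ℝ 1 fun z : ℝ × ℝ × ℝ => √(z.2.1 ^ 2 + δ ^ 2) :=
    ContDiff.sqrt (by fun_prop) fun z => by positivity
  exact contDiff_fst.mul ((contDiff_const.add h1).rpow (by fun_prop) fun z => by positivity)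

theorem contDiff_sqrt_pow {δ : ℝ} (hδ : 0 < δ) :
    ContDiff ℝ 1 fun z : ℝ × ℝ × ℝ => √(z.1 ^ 2 + δ ^ 2) ^ z.2.1 - δ ^ z.2.1 := by
  have h1 : ContDiff ℝ 1 fun z : ℝ × ℝ × ℝ => √(z.1 ^ 2 + δ ^ 2) :=
    ContDiff.sqrt (by fun_prop) fun z => by positivity
  exact (h1.rpow (by fun_prop) fun z => by positivity).sub
    (contDiff_const.rpow (by fun_prop) fun z => hδ.ne')

theorem contMDiffOn_mdifferentiableAt (hΩ : IsOpen Ω) {f : M → ℝ}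
    (hf : ContMDiffOn (𝓡 n) 𝓘(ℝ, ℝ) 1 f Ω) {x : M} (hx : x ∈ Ω) :
    MDifferentiableAt (𝓡 n) 𝓘(ℝ, ℝ) f x :=
  (hf.contMDiffAt (hΩ.mem_nhds hx)).mdifferentiableAt one_ne_zero

/-- The regularized power `(φ² + δ²)^(p/2) - δ^p`. -/
theorem isC1TestFunction_sqrt_pow (hΩ : IsOpen Ω) (hp : ContMDiffOn (𝓡 n) 𝓘(ℝ, ℝ) 1 p Ω)
    {φ : M → ℝ} (hφ : IsC1TestFunction n Ω φ) {δ : ℝ} (hδ : 0 < δ) :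
    IsC1TestFunction n Ω (fun x => √(φ x ^ 2 + δ ^ 2) ^ p x - δ ^ p x) := by
  refine isC1TestFunction_of_contMDiffOn hΩ ?_ hφ fun x hx => ?_
  · exact contMDiffOn_comp₃ (contDiff_sqrt_pow hδ) hφ.smooth.contMDiffOn hp hp
  · simp [hx, Real.sqrt_sq hδ.le]

/-- Only the coefficient of `hgrad X φ` is recorded. The multiple of `hgrad X p` will be annihilated
by orthogonality, so its value never matters. -/
theorem hgrad_sqrt_pow (hΩ : IsOpen Ω) (hp : ContMDiffOn (𝓡 n) 𝓘(ℝ, ℝ) 1 p Ω)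
    {φ : M → ℝ} (hφ : IsC1TestFunction n Ω φ) {δ : ℝ} (hδ : 0 < δ) {x : M} (hx : x ∈ Ω) :
    ∃ c : ℝ, hgrad X (fun x => √(φ x ^ 2 + δ ^ 2) ^ p x - δ ^ p x) x
      = (p x * √(φ x ^ 2 + δ ^ 2) ^ (p x - 1) * (φ x / √(φ x ^ 2 + δ ^ 2))) • hgrad X φ x
        + c • hgrad X p x := by
  have hψ := (isC1TestFunction_sqrt_pow hΩ hp hφ hδ).smooth.mdifferentiable one_ne_zero x
  have h1 := hφ.smooth.mdifferentiable one_ne_zero x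
  have h2 := contMDiffOn_mdifferentiableAt hΩ hp hx
  refine ⟨√(φ x ^ 2 + δ ^ 2) ^ p x * Real.log (√(φ x ^ 2 + δ ^ 2)) - δ ^ p x * Real.log δ, ?_⟩
  have := hgrad_eq_of_hasDerivAt (X := X) hψ h1 h2 h2
    (α₁ := p x * √(φ x ^ 2 + δ ^ 2) ^ (p x - 1) * (φ x / √(φ x ^ 2 + δ ^ 2)))
    (α₂ := √(φ x ^ 2 + δ ^ 2) ^ p x * Real.log (√(φ x ^ 2 + δ ^ 2)) - δ ^ p x * Real.log δ)
    (α₃ := 0) (by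
      intro γ d₁ d₂ d₃ h0 hd1 hd2 _
      refine (hasDerivAt_sqrt_pow hδ hd1 hd2).congr_deriv ?_
      simp only [h0]; ring)
  rw [this, zero_smul, add_zero]

/-- The gradient is arranged as a part free of `hgrad X φ` plus a scalar multiple of it, the roles
of `b` and `c` in `isW0Limit_of_bounded_coeff`. -/
theorem hgrad_mul_sqrt_rpow (hΩ : IsOpen Ω) (hp : ContMDiffOn (𝓡 n) 𝓘(ℝ, ℝ) 1 p Ω)
    {H φ : M → ℝ} (hH : IsC1TestFunction n Ω H) (hφ : IsC1TestFunction n Ω φ) {ε δ : ℝ}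
    (hε : 0 < ε) (hδ : 0 < δ) :
    IsC1TestFunction n Ω (fun x => H x * (ε + √(φ x ^ 2 + δ ^ 2)) ^ (1 - p x)) ∧
    ∀ x ∈ Ω, hgrad X (fun x => H x * (ε + √(φ x ^ 2 + δ ^ 2)) ^ (1 - p x)) x
      = ((ε + √(φ x ^ 2 + δ ^ 2)) ^ (1 - p x) • hgrad X H x
        + -((ε + √(φ x ^ 2 + δ ^ 2)) ^ (1 - p x) * Real.log (ε + √(φ x ^ 2 + δ ^ 2)))
          • (H x • hgrad X p x))
        + (H x * ((1 - p x) * (ε + √(φ x ^ 2 + δ ^ 2)) ^ (-p x) * (φ x / √(φ x ^ 2 + δ ^ 2))))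
          • hgrad X φ x := by
  have hT : IsC1TestFunction n Ω (fun x => H x * (ε + √(φ x ^ 2 + δ ^ 2)) ^ (1 - p x)) := by
    refine isC1TestFunction_of_contMDiffOn hΩ ?_ hH fun x hx => by simp [hx]
    exact contMDiffOn_comp₃ (contDiff_mul_sqrt_rpow hε hδ) hH.smooth.contMDiffOn
      hφ.smooth.contMDiffOn hp
  refine ⟨hT, fun x hx => ?_⟩
  have := hgrad_eq_of_hasDerivAt (X := X) (hT.smooth.mdifferentiable one_ne_zero x)
    (hH.smooth.mdifferentiable one_ne_zero x) (contMDiffOn_mdifferentiableAt hΩ hp hx)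
    (hφ.smooth.mdifferentiable one_ne_zero x)
    (α₁ := (ε + √(φ x ^ 2 + δ ^ 2)) ^ (1 - p x))
    (α₂ := -(H x * ((ε + √(φ x ^ 2 + δ ^ 2)) ^ (1 - p x) * Real.log (ε + √(φ x ^ 2 + δ ^ 2)))))
    (α₃ := H x * ((1 - p x) * (ε + √(φ x ^ 2 + δ ^ 2)) ^ (-p x) * (φ x / √(φ x ^ 2 + δ ^ 2))))
    (by
      intro γ d₁ d₂ d₃ h0 hd1 hd2 hd3
      refine (hasDerivAt_mul_sqrt_rpow hε hδ hd1 hd3 hd2).congr_deriv ?_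
      simp only [h0])
  rw [this, smul_smul]
  congr 3
  ring_nf

variable [MeasurableSpace M] [BorelSpace M] [T2Space M] [SecondCountableTopology M]
  {μ : Measure M} {P : ℝ}

/-- `H (ε + u)^(1-p)` belongs to `W₀` with the gradient given by the chain rule. -/
theorem IsW0Limit.mul_rpow [IsFiniteMeasure (μ.restrict Ω)]
    (hX : ∀ k, IsSmoothField (X k)) (hΩ : IsOpen Ω) (hp : IsExponent (μ.restrict Ω) p P)
    (hpC : ContMDiffOn (𝓡 n) 𝓘(ℝ, ℝ) 1 p Ω) {q : ℝ} (hq : 1 < q) (hqp : ∀ x ∈ Ω, q ≤ p x)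
    (hpP : ∀ x ∈ Ω, p x ≤ P)
    {u : M → ℝ} {G : M → EuclideanSpace ℝ (Fin N)} (hu : IsW0Limit μ X p Ω u G)
    (hpos : ∀ᵐ x ∂(μ.restrict Ω), 0 < u x) {H : M → ℝ} (hH : IsC1TestFunction n Ω H) {ε : ℝ}
    (hε : 0 < ε) (hε1 : ε ≤ 1) :
    IsW0Limit μ X p Ω (fun x => H x * (ε + u x) ^ (1 - p x))
      (fun x => ((ε + u x) ^ (1 - p x) • hgrad X H x
        + -((ε + u x) ^ (1 - p x) * Real.log (ε + u x)) • (H x • hgrad X p x))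
        + (H x * ((1 - p x) * (ε + u x) ^ (-p x))) • G x) := by
  obtain ⟨φ', hφ', hm1', hm2'⟩ := hu.exists_seq
  obtain ⟨ns, hns, hae⟩ := exists_subseq_tendsto_ae_of_modular hp
    (fun i => hu.aesm.sub (hφ' i).isC1.aesm) hm1'
  set φ : ℕ → M → ℝ := fun i => φ' (ns i)
  have hφ : ∀ i, IsTestFunction n Ω (φ i) := fun i => hφ' (ns i)
  have hm2 : Tendsto (fun i => modular (μ.restrict Ω) p (fun x => G x - hgrad X (φ i) x))
      atTop (𝓝 0) := hm2'.comp hns.tendsto_atTop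
  -- The `δ i` smooth the absolute value: the approximants `φ i` of the positive function `u` may
  -- change sign, while `v i` below is `C¹` and stays at least `ε`.
  set δ : ℕ → ℝ := fun i => 1 / ((i : ℝ) + 1)
  have hδ : ∀ i, 0 < δ i := fun i => Nat.one_div_pos_of_nat
  have hδ0 : Tendsto δ atTop (𝓝 0) := tendsto_one_div_add_atTop_nhds_zero_nat
  obtain ⟨A, hA0, hA⟩ : ∃ A, 0 ≤ A ∧ ∀ x, |H x| ≤ A := by
    obtain ⟨A, hA⟩ := hH.exists_norm_le
    exact ⟨|A|, abs_nonneg A, fun x => (hA x).trans (le_abs_self A)⟩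
  obtain ⟨B, hB⟩ := hH.exists_norm_hgrad_le hX
  have hpg : ContinuousOn (hgrad X p) Ω := continuousOn_hgrad hX hΩ hpC
  -- `hgrad X p` need not stay bounded near the boundary of `Ω`; the compact support of `H` makes
  -- the product bounded.
  obtain ⟨D, hD⟩ : ∃ D, ∀ x ∈ Ω, ‖H x • hgrad X p x‖ ≤ D := by
    obtain ⟨D, hD⟩ := hH.compact.isCompact.exists_bound_of_continuousOn
      (f := fun x => H x • hgrad X p x)
      ((hH.smooth.continuous.continuousOn.smul hpg).mono hH.support_subset)
    refine ⟨max D 0, fun x _ => ?_⟩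
    by_cases hx : x ∈ tsupport H
    · exact (hD x hx).trans (le_max_left _ _)
    · simp [image_eq_zero_of_notMem_tsupport hx]
  set v : ℕ → M → ℝ := fun i x => ε + √(φ i x ^ 2 + δ i ^ 2)
  have hv : ∀ i x, ε ≤ v i x := fun i x => le_add_of_nonneg_right (Real.sqrt_nonneg _)
  have hv0 : ∀ i x, 0 < v i x := fun i x => hε.trans_le (hv i x)
  have hvc : ∀ i, Continuous (v i) := fun i =>
    continuous_const.add (((hφ i).isC1.smooth.continuous.pow 2).add continuous_const).sqrt
  have hpc : ContinuousOn p Ω := hpC.continuousOn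
  set E := ε ^ (-P) with hE
  have hE0 : 0 ≤ E := by positivity
  set L := E * |Real.log ε| + 1 / (q - 1)
  have hq1 : 0 < q - 1 := by linarith
  have hL0 : 0 ≤ L := by positivity
  -- The summands bound, in order, the function, the part `b` and the coefficient `c`; the leading 1
  -- meets the requirement `1 ≤ C`.
  set C := 1 + A * E + (E * |B| + L * |D|) + A * ((1 + |P|) * E)
  have hvlim : ∀ᵐ x ∂(μ.restrict Ω), Tendsto (fun i => v i x) atTop (𝓝 (ε + u x)) ∧
      Tendsto (fun i => φ i x / √(φ i x ^ 2 + δ i ^ 2)) atTop (𝓝 1) := by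
    filter_upwards [hae, hpos] with x hx hux
    have h1 : Tendsto (fun i => φ i x) atTop (𝓝 (u x)) := by
      have := hx.const_sub (u x)
      simpa using this
    have h2 : Tendsto (fun i => √(φ i x ^ 2 + δ i ^ 2)) atTop (𝓝 (u x)) := by
      have := ((h1.pow 2).add (hδ0.pow 2)).sqrt
      simpa [Real.sqrt_sq hux.le] using this
    refine ⟨h2.const_add ε, ?_⟩
    have := h1.div h2 hux.ne'
    rwa [div_self hux.ne'] at this
  have hone : ∀ x ∈ Ω, 1 < p x := fun x hx => hq.trans_le (hqp x hx)
  refine isW0Limit_of_bounded_coeff hX hΩ hp hu.aesm_grad (hu.modular_grad_lt_top hX hp) hφ hm2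
    (f := fun i x => H x * v i x ^ (1 - p x))
    (b := fun i x => v i x ^ (1 - p x) • hgrad X H x
        + -(v i x ^ (1 - p x) * Real.log (v i x)) • (H x • hgrad X p x))
    (c := fun i x => H x * ((1 - p x) * v i x ^ (-p x) * (φ i x / √(φ i x ^ 2 + δ i ^ 2))))
    (C := C)
    (fun i => (hgrad_mul_sqrt_rpow (X := X) hΩ hpC hH (hφ i).isC1 hε (hδ i)).1)
    (fun i => (hgrad_mul_sqrt_rpow (X := X) hΩ hpC hH (hφ i).isC1 hε (hδ i)).2)
    ?_ ?_ ?_ ?_ ?_ ?_ ?_ ?_ ?_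
  · intro i
    have c1 : ContinuousOn (fun x => v i x ^ (1 - p x)) Ω :=
      (hvc i).continuousOn.rpow (continuousOn_const.sub hpc) fun x _ => Or.inl (hv0 i x).ne'
    have c2 : ContinuousOn (fun x => Real.log (v i x)) Ω :=
      (hvc i).continuousOn.log fun x _ => (hv0 i x).ne'
    exact (c1.smul (hH.continuous_hgrad hX).continuousOn).add
      ((c1.mul c2).neg.smul (hH.smooth.continuous.continuousOn.smul hpg))
  · intro i
    have c1 : ContinuousOn (fun x => v i x ^ (-p x)) Ω :=
      (hvc i).continuousOn.rpow hpc.neg fun x _ => Or.inl (hv0 i x).ne'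
    have c2 : Continuous fun x => φ i x / √(φ i x ^ 2 + δ i ^ 2) :=
      (hφ i).isC1.smooth.continuous.div
        (((hφ i).isC1.smooth.continuous.pow 2).add continuous_const).sqrt fun x =>
          (Real.sqrt_pos.2 (by have := hδ i; positivity)).ne'
    exact hH.smooth.continuous.continuousOn.mul
      (((continuousOn_const.sub hpc).mul c1).mul c2.continuousOn)
  · have : 0 ≤ A * E + (E * |B| + L * |D|) + A * ((1 + |P|) * E) := by positivity
    simp only [C]; linarith
  · intro i x hx
    rw [abs_mul, abs_of_pos (Real.rpow_pos_of_pos (hv0 i x) _)]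
    have h1 : |H x| * v i x ^ (1 - p x) ≤ A * E := by
      gcongr
      · exact hA x
      · exact rpow_one_sub_le hε hε1 (hv i x) (hone x hx) (hpP x hx)
    have : 0 ≤ (E * |B| + L * |D|) + A * ((1 + |P|) * E) := by positivity
    simp only [C]; linarith
  · intro i x hx
    refine (norm_add_le _ _).trans ?_
    rw [norm_smul, norm_smul, Real.norm_of_nonneg (Real.rpow_pos_of_pos (hv0 i x) _).le,
      norm_neg, Real.norm_eq_abs]
    have h1 : v i x ^ (1 - p x) * ‖hgrad X H x‖ ≤ E * |B| := by
      gcongr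
      · exact rpow_one_sub_le hε hε1 (hv i x) (hone x hx) (hpP x hx)
      · exact (hB x).trans (le_abs_self B)
    have h2 : |v i x ^ (1 - p x) * Real.log (v i x)| * ‖H x • hgrad X p x‖ ≤ L * |D| := by
      gcongr
      · exact abs_rpow_mul_log_le hε hε1 (hv i x) hq (hqp x hx) (hpP x hx)
      · exact (hD x hx).trans (le_abs_self D)
    have : 0 ≤ A * E + A * ((1 + |P|) * E) := by positivity
    simp only [C]; linarith
  · intro i x hx
    have h1 : |H x * ((1 - p x) * v i x ^ (-p x) * (φ i x / √(φ i x ^ 2 + δ i ^ 2)))|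
        ≤ A * ((1 + |P|) * E * 1) := by
      rw [abs_mul, abs_mul, abs_mul, abs_of_pos (Real.rpow_pos_of_pos (hv0 i x) _)]
      gcongr
      · exact hA x
      · have := hone x hx
        have h3 := hpP x hx
        rw [abs_of_neg (by linarith)]
        linarith [le_abs_self P]
      · exact rpow_neg_le hε hε1 (hv i x) (hone x hx) (hpP x hx)
      · exact abs_div_sqrt_le _ _
    have : 0 ≤ A * E + (E * |B| + L * |D|) := by positivity
    simp only [C]; linarith
  · filter_upwards [hvlim, hpos] with x hx hux
    exact (hx.1.rpow_const (Or.inl (by positivity))).const_mul _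
  · filter_upwards [hvlim, hpos] with x hx hux
    have h1 : Tendsto (fun i => v i x ^ (1 - p x)) atTop (𝓝 ((ε + u x) ^ (1 - p x))) :=
      hx.1.rpow_const (Or.inl (by positivity))
    exact (h1.smul_const _).add ((h1.mul (hx.1.log (by positivity))).neg.smul_const _)
  · filter_upwards [hvlim, hpos] with x hx hux
    have h1 : Tendsto (fun i => v i x ^ (-p x)) atTop (𝓝 ((ε + u x) ^ (-p x))) :=
      hx.1.rpow_const (Or.inl (by positivity))
    have h2 := (((h1.const_mul (1 - p x)).mul hx.2).const_mul (H x))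
    rwa [mul_one] at h2

end TestFunction

/-! ### Picone's identity. -/

section PiconeAlgebra

variable {F : Type*} [NormedAddCommGroup F] [InnerProductSpace ℝ F]

theorem norm_rpow_sub_two_mul_inner_self {p : ℝ} (hp : 1 < p) (G : F) :
    ‖G‖ ^ (p - 2) * inner ℝ G G = ‖G‖ ^ p := by
  rcases eq_or_ne G 0 with rfl | hG
  · simp [Real.zero_rpow (show p ≠ 0 by linarith)]
  have hG' : ‖G‖ ≠ 0 := norm_ne_zero_iff.2 hG
  rw [real_inner_self_eq_norm_sq, ← Real.rpow_two,
    ← Real.rpow_add (norm_pos_iff.2 hG)]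
  congr 1; ring

/-- Picone's identity. -/
theorem picone_identity {p v w δ φ c d : ℝ} (hp : 1 < p) (hv : 0 < v) (hw : 0 < w)
    {a G Q : F} (hQ : inner ℝ Q G = 0) :
    ‖G‖ ^ (p - 2) * inner ℝ G ((v ^ (1 - p) • ((p * w ^ (p - 1) * (φ / w)) • a + c • Q)
        + d • ((w ^ p - δ ^ p) • Q)) + ((w ^ p - δ ^ p) * ((1 - p) * v ^ (-p))) • G)
      = ‖a‖ ^ p + (p - 1) * (δ ^ p * v ^ (-p)) * ‖G‖ ^ p
        - piconeRemainder p (w / v) (φ / w) a G := by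
  have hQ' : inner ℝ G Q = 0 := by rw [real_inner_comm]; exact hQ
  have e1 : (w / v) ^ (p - 1) = w ^ (p - 1) * v ^ (1 - p) := by
    rw [Real.div_rpow hw.le hv.le, div_eq_mul_inv, ← Real.rpow_neg hv.le]
    congr 2; ring
  have e2 : (w / v * ‖G‖) ^ p = w ^ p * v ^ (-p) * ‖G‖ ^ p := by
    rw [Real.mul_rpow (by positivity) (norm_nonneg _), Real.div_rpow hw.le hv.le, div_eq_mul_inv,
      ← Real.rpow_neg hv.le]
  -- Every multiple of `Q`, which stands for the gradient of the exponent, disappears here because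
  -- `Q` is orthogonal to `G`.
  simp only [inner_add_right, inner_smul_right, hQ', mul_zero, add_zero]
  rw [mul_add, show ‖G‖ ^ (p - 2) * ((w ^ p - δ ^ p) * ((1 - p) * v ^ (-p)) * inner ℝ G G)
    = (w ^ p - δ ^ p) * ((1 - p) * v ^ (-p)) * (‖G‖ ^ (p - 2) * inner ℝ G G) by ring,
    norm_rpow_sub_two_mul_inner_self hp, piconeRemainder, e1, e2]
  ring

theorem norm_rpow_mul_inner_le_add {p : ℝ} (hp : 1 < p) (a b : F) :
    |‖b‖ ^ (p - 2) * inner ℝ b a| ≤ ‖b‖ ^ p + ‖a‖ ^ p := by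
  refine (norm_rpow_mul_inner_le hp a b).trans ?_
  have ha := norm_nonneg a
  have hb := norm_nonneg b
  rcases le_total ‖a‖ ‖b‖ with h | h
  · calc ‖b‖ ^ (p - 1) * ‖a‖ ≤ ‖b‖ ^ (p - 1) * ‖b‖ := by gcongr
      _ = ‖b‖ ^ p := by
        rcases hb.eq_or_lt with h0 | h0
        · rw [← h0, mul_zero, Real.zero_rpow (by linarith)]
        · rw [← Real.rpow_add_one h0.ne']; congr 1; ring
      _ ≤ _ := by linarith [Real.rpow_nonneg ha p]
  · calc ‖b‖ ^ (p - 1) * ‖a‖ ≤ ‖a‖ ^ (p - 1) * ‖a‖ := by gcongr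
      _ = ‖a‖ ^ p := by
        rcases ha.eq_or_lt with h0 | h0
        · rw [← h0, mul_zero, Real.zero_rpow (by linarith)]
        · rw [← Real.rpow_add_one h0.ne']; congr 1; ring
      _ ≤ _ := by linarith [Real.rpow_nonneg hb p]

end PiconeAlgebra

/-! ### The integral Picone inequality for test functions. -/

section Picone

variable {n N : ℕ} {M : Type*} [TopologicalSpace M]
  [ChartedSpace (EuclideanSpace ℝ (Fin n)) M] [IsManifold (𝓡 n) ∞ M]
  [MeasurableSpace M] [BorelSpace M] [T2Space M] [SecondCountableTopology M]
  {μ : Measure M} {X : Fin N → VField n M} {p g : M → ℝ} {Ω : Set M} {P : ℝ}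

theorem integrable_norm_rpow_of_modular {F : Type*} [NormedAddCommGroup F] {ν : Measure M}
    (hp : IsExponent ν p P) {f : M → F}
    (hf : AEStronglyMeasurable f ν) (h : modular ν p f < ⊤) :
    Integrable (fun x => ‖f x‖ ^ p x) ν := by
  refine ⟨(hf.norm.aemeasurable.pow hp.aemeasurable).aestronglyMeasurable, ?_⟩
  refine lt_of_eq_of_lt (lintegral_congr fun x => ?_) h
  rw [Real.enorm_eq_ofReal (by positivity)]

theorem le_sqrt_sq_add_sq {a δ : ℝ} : δ ≤ √(a ^ 2 + δ ^ 2) :=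
  Real.le_sqrt_of_sq_le (by nlinarith [sq_nonneg a])

/-- The integral form of Picone's inequality, for a positive solution `u` and a test function. -/
theorem picone_inequality [IsFiniteMeasure (μ.restrict Ω)] (hμ : IsSmoothVolume n μ)
    (hX : ∀ k, IsSmoothField (X k)) (hΩ : IsOpen Ω) (hp : IsExponent (μ.restrict Ω) p P)
    (hpC : ContMDiffOn (𝓡 n) 𝓘(ℝ, ℝ) 1 p Ω) {q : ℝ} (hq : 1 < q) (hqp : ∀ x ∈ Ω, q ≤ p x)
    (hpP : ∀ x ∈ Ω, p x ≤ P) (hg : AEMeasurable g (μ.restrict Ω)) (hg0 : ∀ x ∈ Ω, 0 < g x)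
    {C : ℝ} (hgC : ∀ x ∈ Ω, g x ≤ C)
    {u : M → ℝ} {lam : ℝ} (hu : IsWeakSolution μ X p g Ω u lam)
    (hpos : ∀ᵐ x ∂(μ.restrict Ω), 0 < u x)
    (horth : ∀ᵐ x ∂(μ.restrict Ω), inner ℝ (hgrad X p x) (weakGrad μ X Ω u x) = 0)
    {φ : M → ℝ} (hφ : IsTestFunction n Ω φ) {ε : ℝ} (hε : 0 < ε) (hε1 : ε ≤ 1) :
    ∫⁻ x in Ω, ENNReal.ofReal (piconeRemainder (p x) (√(φ x ^ 2 + (ε ^ 2) ^ 2) / (ε + u x))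
        (φ x / √(φ x ^ 2 + (ε ^ 2) ^ 2)) (hgrad X φ x) (weakGrad μ X Ω u x)) ∂μ
      + ∫⁻ x in Ω, ENNReal.ofReal (lam * (g x * u x ^ (p x - 1)
        * ((√(φ x ^ 2 + (ε ^ 2) ^ 2) ^ p x - (ε ^ 2) ^ p x) * (ε + u x) ^ (1 - p x)))) ∂μ
      ≤ modular (μ.restrict Ω) p (hgrad X φ)
        + ENNReal.ofReal (P * ε) * modular (μ.restrict Ω) p (weakGrad μ X Ω u) := by
  set ν := μ.restrict Ω
  set G := weakGrad μ X Ω u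
  -- This choice gives `δ / (ε + u) ≤ ε` wherever `u > 0`, so the error caused by subtracting `δ ^
  -- p` is at most `P ε ‖G‖ ^ p`.
  set δ := ε ^ 2
  have hδ : 0 < δ := by positivity
  set w : M → ℝ := fun x => √(φ x ^ 2 + δ ^ 2) with hw
  have hw0 : ∀ x, 0 < w x := fun x => Real.sqrt_pos.2 (by positivity)
  set H : M → ℝ := fun x => w x ^ p x - δ ^ p x with hH
  have hHT : IsC1TestFunction n Ω H := isC1TestFunction_sqrt_pow hΩ hpC hφ.isC1 hδ
  have huL := hu.memW0.isW0Limit hX hp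
  have hψ := huL.mul_rpow hX hΩ hp hpC hq hqp hpP hpos hHT hε hε1
  set ψ : M → ℝ := fun x => H x * (ε + u x) ^ (1 - p x)
  set Gψ : M → EuclideanSpace ℝ (Fin N) := fun x => ((ε + u x) ^ (1 - p x) • hgrad X H x
        + -((ε + u x) ^ (1 - p x) * Real.log (ε + u x)) • (H x • hgrad X p x))
        + (H x * ((1 - p x) * (ε + u x) ^ (-p x))) • G x
  -- The test function regularizes `|φ|^p u^(1-p)`: the shift by `ε` removes the singularity where
  -- `u` is small, and subtracting `δ ^ p` restores compact support in `Ω`.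
  have heqn := hu.eqn ψ (hψ.memW0 hμ hX hΩ hp)
  have hmem := ae_restrict_mem (μ := μ) hΩ.measurableSet
  have hae := hψ.weakGrad_ae_eq hμ hX hΩ hp
  have hGm : modular ν p G < ⊤ := huL.modular_grad_lt_top hX hp
  have hφm : modular ν p (hgrad X φ) < ⊤ := hφ.isC1.modular_hgrad_lt_top hX hp
  have iG := integrable_norm_rpow_of_modular hp huL.aesm_grad hGm
  have iφ := integrable_norm_rpow_of_modular hp (hφ.isC1.aesm_hgrad hX) hφm
  have iψ := integrable_norm_rpow_of_modular hp hψ.aesm_grad (hψ.modular_grad_lt_top hX hp)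
  -- the two sides of the equation
  set A : M → ℝ := fun x => ‖G x‖ ^ (p x - 2) * inner ℝ (G x) (Gψ x) with hA
  set B : M → ℝ := fun x => lam * (g x * u x ^ (p x - 1) * ψ x) with hB
  have hum := huL.aesm.aemeasurable
  have hone : ∀ x ∈ Ω, 1 < p x := fun x hx => hq.trans_le (hqp x hx)
  have iA : Integrable A ν := by
    refine (iG.add iψ).mono' ?_ ?_
    · exact ((huL.aesm_grad.norm.aemeasurable.pow
        (hp.aemeasurable.sub_const 2)).aestronglyMeasurable).mul
        (huL.aesm_grad.inner hψ.aesm_grad)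
    · filter_upwards [hmem] with x hx
      exact norm_rpow_mul_inner_le_add (hone x hx) _ _
  have hH0 : ∀ x ∈ Ω, 0 ≤ H x := fun x hx => by
    have : δ ^ p x ≤ w x ^ p x :=
      Real.rpow_le_rpow hδ.le le_sqrt_sq_add_sq (by linarith [hone x hx])
    simp only [H]; linarith
  obtain ⟨D, hD⟩ := hHT.exists_norm_le
  have iB : Integrable B ν := by
    refine Integrable.const_mul ?_ lam
    refine Integrable.of_bound (C := C * D) ?_ ?_
    · exact ((hg.mul (hum.pow (hp.aemeasurable.sub_const 1))).mul
        hψ.aesm.aemeasurable).aestronglyMeasurable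
    · filter_upwards [hmem, hpos] with x hx hux
      -- This cancellation makes the integrand `B` bounded, whatever the size of `u`.
      have h1 : u x ^ (p x - 1) * (ε + u x) ^ (1 - p x) ≤ 1 := by
        rw [show 1 - p x = -(p x - 1) by ring, Real.rpow_neg (by linarith), ← div_eq_mul_inv]
        refine div_le_one_of_le₀ ?_ (by positivity)
        exact Real.rpow_le_rpow hux.le (by linarith) (by linarith [hone x hx])
      have h2 : |H x| ≤ D := hD x
      rw [abs_of_nonneg (hH0 x hx)] at h2
      have hg1 := hg0 x hx
      have hg2 := hgC x hx
      have hv : 0 < ε + u x := by linarith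
      have hE : g x * u x ^ (p x - 1) * ψ x
          = (g x * H x) * (u x ^ (p x - 1) * (ε + u x) ^ (1 - p x)) := by simp only [ψ]; ring
      have hH1 := hH0 x hx
      rw [hE, Real.norm_of_nonneg (by positivity)]
      calc _ ≤ (g x * H x) * 1 := by gcongr
        _ ≤ C * D := by rw [mul_one]; gcongr; linarith
  have hAB : ∫ x, A x ∂ν = ∫ x, B x ∂ν := by
    have e1 : ∫ x in Ω, ‖weakGrad μ X Ω u x‖ ^ (p x - 2)
        * inner ℝ (weakGrad μ X Ω u x) (weakGrad μ X Ω ψ x) ∂μ = ∫ x, A x ∂ν := by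
      refine integral_congr_ae ?_
      filter_upwards [hae] with x hx
      rw [hx]
    have e2 : lam * ∫ x in Ω, g x * |u x| ^ (p x - 2) * u x * ψ x ∂μ = ∫ x, B x ∂ν := by
      rw [← integral_const_mul]
      refine integral_congr_ae ?_
      filter_upwards [hpos] with x hx
      simp only [B]
      rw [abs_of_pos hx, mul_assoc (g x), ← Real.rpow_add_one hx.ne',
        show p x - 2 + 1 = p x - 1 by ring]
    rw [e1, e2] at heqn
    linarith
  set R : M → ℝ := fun x => (p x - 1) * (δ ^ p x * (ε + u x) ^ (-p x)) * ‖G x‖ ^ p x with hR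
  set L : M → ℝ := fun x => piconeRemainder (p x) (w x / (ε + u x)) (φ x / w x)
    (hgrad X φ x) (G x) with hL
  have hid : ∀ᵐ x ∂ν, A x = ‖hgrad X φ x‖ ^ p x + R x - L x := by
    filter_upwards [hmem, hpos, horth] with x hx hux ho
    obtain ⟨c, hc⟩ := hgrad_sqrt_pow (X := X) hΩ hpC hφ.isC1 hδ hx
    simp only [A, Gψ, R, L]
    rw [show hgrad X H x = _ from hc]
    exact picone_identity (hone x hx) (by linarith) (hw0 x) ho
  have hRb : ∀ᵐ x ∂ν, 0 ≤ R x ∧ R x ≤ P * ε * ‖G x‖ ^ p x := by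
    filter_upwards [hmem, hpos] with x hx hux
    have h1 := hone x hx
    have hv : 0 < ε + u x := by linarith
    have hp1 : 0 ≤ p x - 1 := by linarith
    have h2 : δ ^ p x * (ε + u x) ^ (-p x) ≤ ε := by
      rw [Real.rpow_neg hv.le, ← div_eq_mul_inv, ← Real.div_rpow hδ.le hv.le]
      have h3 : δ / (ε + u x) ≤ ε := by
        rw [div_le_iff₀ hv]; simp only [δ]; nlinarith
      exact (Real.rpow_le_rpow (by positivity) h3 (by linarith)).trans
        (Real.rpow_le_self_of_le_one hε.le hε1 h1.le)
    refine ⟨by positivity, ?_⟩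
    have h4 : p x - 1 ≤ P := by linarith [hpP x hx]
    have h5 : 0 ≤ δ ^ p x * (ε + u x) ^ (-p x) := by positivity
    have hP0 : 0 ≤ P := by linarith
    simp only [R]
    gcongr
  have hv : AEMeasurable (fun x => ε + u x) ν := hum.const_add ε
  have iR : Integrable R ν := by
    refine (iG.const_mul (P * ε)).mono' ?_ ?_
    · exact (((hp.aemeasurable.sub_const 1).mul ((aemeasurable_const.pow hp.aemeasurable).mul
        (hv.pow hp.aemeasurable.neg))).mul
        (huL.aesm_grad.norm.aemeasurable.pow hp.aemeasurable)).aestronglyMeasurable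
    · filter_upwards [hRb] with x hx
      rw [Real.norm_of_nonneg hx.1]
      exact hx.2
  have hLeq : L =ᵐ[ν] fun x => ‖hgrad X φ x‖ ^ p x + R x - A x := by
    filter_upwards [hid] with x hx
    rw [hx]; ring
  have iL : Integrable L ν := ((iφ.add iR).sub iA).congr hLeq.symm
  have hL0 : 0 ≤ᵐ[ν] L := by
    filter_upwards [hmem, hpos] with x hx hux
    refine piconeRemainder_nonneg (hone x hx) (div_nonneg (hw0 x).le (by linarith)) ?_ _ _
    exact abs_div_sqrt_le _ _
  have hB0 : 0 ≤ᵐ[ν] B := by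
    filter_upwards [hmem, hpos] with x hx hux
    have h1 := hH0 x hx
    have h2 := hg0 x hx
    have h3 := hu.pos
    have hv : 0 < ε + u x := by linarith
    simp only [B, ψ, Pi.zero_apply]
    positivity
  have hsum : ∫ x, L x ∂ν + ∫ x, B x ∂ν = ∫ x, ‖hgrad X φ x‖ ^ p x ∂ν + ∫ x, R x ∂ν := by
    have h1 : ∫ x, ‖hgrad X φ x‖ ^ p x + R x - A x ∂ν
        = ∫ x, ‖hgrad X φ x‖ ^ p x + R x ∂ν - ∫ x, A x ∂ν := integral_sub (iφ.add iR) iA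
    have h2 : ∫ x, ‖hgrad X φ x‖ ^ p x + R x ∂ν
        = ∫ x, ‖hgrad X φ x‖ ^ p x ∂ν + ∫ x, R x ∂ν := integral_add iφ iR
    rw [integral_congr_ae hLeq, h1, h2, hAB]
    ring
  have hiφ : ENNReal.ofReal (∫ x, ‖hgrad X φ x‖ ^ p x ∂ν) = modular ν p (hgrad X φ) :=
    ofReal_integral_eq_lintegral_ofReal iφ (Eventually.of_forall fun x => by positivity)
  calc _ = ENNReal.ofReal (∫ x, L x ∂ν) + ENNReal.ofReal (∫ x, B x ∂ν) := by
        rw [ofReal_integral_eq_lintegral_ofReal iL hL0,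
          ofReal_integral_eq_lintegral_ofReal iB hB0]
    _ = ENNReal.ofReal (∫ x, ‖hgrad X φ x‖ ^ p x ∂ν + ∫ x, R x ∂ν) := by
        rw [← ENNReal.ofReal_add (integral_nonneg_of_ae hL0) (integral_nonneg_of_ae hB0), hsum]
    _ ≤ modular ν p (hgrad X φ) + ENNReal.ofReal (∫ x, R x ∂ν) := by
        rw [← hiφ]; exact ENNReal.ofReal_add_le
    _ ≤ _ := by
        gcongr
        rw [ofReal_integral_eq_lintegral_ofReal iR (hRb.mono fun x hx => hx.1), modular,
          ← lintegral_const_mul' _ _ ENNReal.ofReal_ne_top]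
        refine lintegral_mono_ae ?_
        filter_upwards [hRb] with x hx
        rw [← ENNReal.ofReal_mul' (by positivity)]
        exact ENNReal.ofReal_le_ofReal hx.2

end Picone

/-! ### Limits of modulars and of the Picone remainder. -/

section ModularLimit

variable {α : Type*} [MeasurableSpace α] {ν : Measure α} {p : α → ℝ} {P : ℝ}
  {F : Type*} [NormedAddCommGroup F]

/-- Convexity of the power at the points `a/(1-t)` and `b/t`, with weights `1-t` and `t`. -/
theorem add_rpow_le_weighted {a b p t : ℝ} (ha : 0 ≤ a) (hb : 0 ≤ b) (hp : 1 ≤ p) (ht : 0 < t)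
    (ht1 : t < 1) : (a + b) ^ p ≤ (1 - t) ^ (1 - p) * a ^ p + t ^ (1 - p) * b ^ p := by
  have h1 : 0 < 1 - t := by linarith
  have h := (convexOn_rpow hp).2 (x := a / (1 - t)) (y := b / t) (mem_Ici.2 (by positivity))
    (mem_Ici.2 (by positivity)) h1.le ht.le (by ring)
  have e : ∀ {s c : ℝ}, 0 < s → 0 ≤ c → s * (c / s) ^ p = s ^ (1 - p) * c ^ p :=
    fun {s c} hs hc => by
      rw [Real.div_rpow hc hs.le, Real.rpow_sub hs, Real.rpow_one]
      ring
  simp only [smul_eq_mul] at h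
  rwa [e h1 ha, e ht hb, mul_div_cancel₀ _ h1.ne', mul_div_cancel₀ _ ht.ne'] at h

/-- In contrast to `modular_add_le`, the constant before the main term tends to 1 as `t → 0`. A
factor such as `2^P` would ruin the comparison of eigenvalues. -/
theorem modular_le_weighted (hp : IsExponent ν p P) {f g : α → F}
    (hf : AEStronglyMeasurable f ν) {t : ℝ} (ht : 0 < t) (ht1 : t < 1) :
    modular ν p g ≤ ENNReal.ofReal ((1 - t) ^ (1 - P)) * modular ν p f
      + ENNReal.ofReal (t ^ (1 - P)) * modular ν p (fun x => f x - g x) := by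
  unfold modular
  rw [← lintegral_const_mul' _ _ ENNReal.ofReal_ne_top,
    ← lintegral_const_mul' _ _ ENNReal.ofReal_ne_top, ← lintegral_add_left'
      ((aemeasurable_norm_rpow hp.aemeasurable hf).const_mul _)]
  refine lintegral_mono_ae ?_
  filter_upwards [hp.one_lt, hp.le] with x h1 h2
  have h3 : 0 < 1 - t := by linarith
  rw [← ENNReal.ofReal_mul (by positivity), ← ENNReal.ofReal_mul (by positivity),
    ← ENNReal.ofReal_add (by positivity) (by positivity)]
  refine ENNReal.ofReal_le_ofReal ?_
  calc ‖g x‖ ^ p x ≤ (‖f x‖ + ‖f x - g x‖) ^ p x := by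
        refine Real.rpow_le_rpow (norm_nonneg _) ?_ (by linarith)
        simpa using norm_sub_le (f x) (f x - g x)
    _ ≤ _ := add_rpow_le_weighted (norm_nonneg _) (norm_nonneg _) h1.le ht ht1
    _ ≤ _ := by
      gcongr ?_ * _ + ?_ * _
      · exact Real.rpow_le_rpow_of_exponent_ge h3 (by linarith) (by linarith)
      · exact Real.rpow_le_rpow_of_exponent_ge ht (by linarith) (by linarith)

/-- For fixed `t` the limit in `i` removes the error term; then `t → 0` brings the remaining
constant down to 1. -/
theorem le_modular_of_tendsto (hp : IsExponent ν p P) {f : α → F} {fi : ℕ → α → F}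
    (hf : AEStronglyMeasurable f ν)
    (h : Tendsto (fun i => modular ν p (fun x => f x - fi i x)) atTop (𝓝 0))
    {c : ℕ → ℝ≥0∞} (hc : Tendsto c atTop (𝓝 0)) :
    liminf (fun i => modular ν p (fi i) + c i) atTop ≤ modular ν p f := by
  have key : ∀ t : ℝ, 0 < t → t < 1 → liminf (fun i => modular ν p (fi i) + c i) atTop
      ≤ ENNReal.ofReal ((1 - t) ^ (1 - P)) * modular ν p f := fun t ht ht1 => by
    have hl : Tendsto (fun i => ENNReal.ofReal ((1 - t) ^ (1 - P)) * modular ν p f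
        + ENNReal.ofReal (t ^ (1 - P)) * modular ν p (fun x => f x - fi i x) + c i) atTop
        (𝓝 (ENNReal.ofReal ((1 - t) ^ (1 - P)) * modular ν p f)) := by
      simpa using ((ENNReal.Tendsto.const_mul h
        (.inr (ENNReal.ofReal_ne_top (r := t ^ (1 - P))))).const_add
        (ENNReal.ofReal ((1 - t) ^ (1 - P)) * modular ν p f)).add hc
    rw [← hl.liminf_eq]
    exact liminf_le_liminf (Eventually.of_forall fun i =>
      add_le_add (modular_le_weighted hp hf ht ht1) le_rfl)
  rcases eq_or_ne (modular ν p f) ⊤ with htop | htop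
  · rw [htop]; exact le_top
  have hc : Tendsto (fun t : ℝ => ENNReal.ofReal ((1 - t) ^ (1 - P)) * modular ν p f) (𝓝[>] 0)
      (𝓝 (ENNReal.ofReal ((1 - 0) ^ (1 - P)) * modular ν p f)) := by
    refine ENNReal.Tendsto.mul_const (ENNReal.tendsto_ofReal ?_) (.inr htop)
    refine tendsto_nhdsWithin_of_tendsto_nhds (ContinuousAt.tendsto ?_)
    exact ContinuousAt.rpow_const (by fun_prop) (by simp)
  simp only [sub_zero, Real.one_rpow, ENNReal.ofReal_one, one_mul] at hc
  refine ge_of_tendsto hc ?_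
  filter_upwards [Ioo_mem_nhdsGT one_pos] with t ht using key t ht.1 ht.2

theorem aemeasurable_piconeRemainder {F : Type*} [NormedAddCommGroup F] [InnerProductSpace ℝ F]
    {s τ : α → ℝ} {a b : α → F} (hp : AEMeasurable p ν) (hs : AEMeasurable s ν)
    (hτ : AEMeasurable τ ν) (ha : AEStronglyMeasurable a ν) (hb : AEStronglyMeasurable b ν) :
    AEMeasurable (fun x => piconeRemainder (p x) (s x) (τ x) (a x) (b x)) ν := by
  have hbn := hb.norm.aemeasurable
  have hba : AEMeasurable (fun x => (inner ℝ (b x) (a x) : ℝ)) ν := (hb.inner ha).aemeasurable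
  unfold piconeRemainder
  exact ((ha.norm.aemeasurable.pow hp).sub (((hp.mul (hs.pow (hp.sub_const 1))).mul hτ).mul
    ((hbn.pow (hp.sub_const 2)).mul hba))).add ((hp.sub_const 1).mul ((hs.mul hbn).pow hp))

theorem tendsto_piconeRemainder {F : Type*} [NormedAddCommGroup F] [InnerProductSpace ℝ F]
    {p s τ : ℝ} {a b : F} (hp : 1 < p) (hs : 0 < s) {si τi : ℕ → ℝ} {ai : ℕ → F}
    (hsi : Tendsto si atTop (𝓝 s)) (hτi : Tendsto τi atTop (𝓝 τ))
    (hai : Tendsto ai atTop (𝓝 a)) :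
    Tendsto (fun i => piconeRemainder p (si i) (τi i) (ai i) b) atTop
      (𝓝 (piconeRemainder p s τ a b)) := by
  unfold piconeRemainder
  have h1 := hai.norm.rpow_const (p := p) (.inr (by linarith))
  have h2 := hsi.rpow_const (p := p - 1) (.inl hs.ne')
  have h3 : Tendsto (fun i => (inner ℝ b (ai i) : ℝ)) atTop (𝓝 (inner ℝ b a)) :=
    tendsto_const_nhds.inner hai
  have h4 := (hsi.mul_const ‖b‖).rpow_const (p := p) (.inr (by linarith))
  exact (h1.sub (((h2.const_mul p).mul hτi).mul (h3.const_mul _))).add (h4.const_mul _)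

end ModularLimit

/-! ### Comparison of two solutions and the logarithmic gradient estimate. -/

section PiconeLimit

variable {n N : ℕ} {M : Type*} [TopologicalSpace M]
  [ChartedSpace (EuclideanSpace ℝ (Fin n)) M] [IsManifold (𝓡 n) ∞ M]
  [MeasurableSpace M] [BorelSpace M] [T2Space M] [SecondCountableTopology M]
  {μ : Measure M} {X : Fin N → VField n M} {p g : M → ℝ} {Ω Ω' : Set M} {P : ℝ}

theorem modular_hgrad_restrict {φ : M → ℝ} (hφ : IsTestFunction n Ω' φ) (hΩ' : IsOpen Ω')
    (hΩ : MeasurableSet Ω) (hsub : Ω' ⊆ Ω) (hp : ∀ x ∈ Ω, 1 < p x) :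
    modular (μ.restrict Ω) p (hgrad X φ) = modular (μ.restrict Ω') p (hgrad X φ) := by
  unfold modular
  have h := lintegral_inter_add_sdiff (μ := μ)
    (fun x => ENNReal.ofReal (‖hgrad X φ x‖ ^ p x)) Ω hΩ'.measurableSet
  rw [inter_eq_right.2 hsub] at h
  rw [← h, setLIntegral_congr_fun (g := fun _ => 0) (hΩ.diff hΩ'.measurableSet), lintegral_zero,
    add_zero]
  intro x hx
  have h0 := hp x hx.1
  have : hgrad X φ x = 0 :=
    hgrad_eq_zero_of_notMem_tsupport fun hx' => hx.2 (hφ.support_subset hx')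
  simp only [this, norm_zero]
  rw [Real.zero_rpow (by linarith), ENNReal.ofReal_zero]

/-- Once the regularizations are gone, `u^(p-1) u^(1-p) = 1` and the eigenvalue term no longer
refers to `u`. -/
theorem tendsto_picone_eigen {p g U u lam : ℝ} (hp : 1 < p) (hu : 0 < u)
    {w ε δ : ℕ → ℝ} (hw : Tendsto w atTop (𝓝 U)) (hε : Tendsto ε atTop (𝓝 0))
    (hδ : Tendsto δ atTop (𝓝 0)) :
    Tendsto (fun i => lam * (g * u ^ (p - 1) * ((w i ^ p - δ i ^ p) * (ε i + u) ^ (1 - p)))) atTop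
      (𝓝 (lam * (g * U ^ p))) := by
  have h1 := hw.rpow_const (p := p) (.inr (by linarith))
  have h2 := hδ.rpow_const (p := p) (.inr (by linarith))
  have h3 : Tendsto (fun i => ε i + u) atTop (𝓝 u) := by simpa using hε.add_const u
  have h4 := h3.rpow_const (p := 1 - p) (.inl hu.ne')
  convert (((h1.sub h2).mul h4).const_mul (g * u ^ (p - 1))).const_mul lam using 3
  rw [Real.zero_rpow (by linarith), sub_zero, mul_assoc]
  congr 1
  rw [mul_left_comm, ← Real.rpow_add hu]
  simp

theorem tendsto_one_div_succ : Tendsto (fun i : ℕ => 1 / ((i : ℝ) + 1)) atTop (𝓝 0) :=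
  tendsto_one_div_add_atTop_nhds_zero_nat

/-- The inequality for `u` is applied to test functions approximating `U` on the smaller set, with
`ε → 0`. Fatou's lemma treats the left-hand side, so positivity of `u` almost everywhere is enough
and no local lower bound is needed; `le_modular_of_tendsto` treats the right-hand side. -/
theorem picone_limit [IsFiniteMeasure (μ.restrict Ω)] (hμ : IsSmoothVolume n μ)
    (hX : ∀ k, IsSmoothField (X k)) (hΩ : IsOpen Ω) (hp : IsExponent (μ.restrict Ω) p P)
    (hpC : ContMDiffOn (𝓡 n) 𝓘(ℝ, ℝ) 1 p Ω) {q : ℝ} (hq : 1 < q) (hqp : ∀ x ∈ Ω, q ≤ p x)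
    (hpP : ∀ x ∈ Ω, p x ≤ P) (hg : AEMeasurable g (μ.restrict Ω)) (hg0 : ∀ x ∈ Ω, 0 < g x)
    {C : ℝ} (hgC : ∀ x ∈ Ω, g x ≤ C)
    {u : M → ℝ} {lam : ℝ} (hu : IsWeakSolution μ X p g Ω u lam)
    (hpos : ∀ᵐ x ∂(μ.restrict Ω), 0 < u x)
    (horth : ∀ᵐ x ∂(μ.restrict Ω), inner ℝ (hgrad X p x) (weakGrad μ X Ω u x) = 0)
    (hΩ' : IsOpen Ω') (hsub : Ω' ⊆ Ω) {U : M → ℝ} {G' : M → EuclideanSpace ℝ (Fin N)}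
    (hU : IsW0Limit μ X p Ω' U G') (hUpos : ∀ᵐ x ∂(μ.restrict Ω'), 0 < U x) :
    ∫⁻ x in Ω', ENNReal.ofReal (piconeRemainder (p x) (U x / u x) 1 (G' x)
        (weakGrad μ X Ω u x)) ∂μ
      + ∫⁻ x in Ω', ENNReal.ofReal (lam * (g x * U x ^ p x)) ∂μ
      ≤ modular (μ.restrict Ω') p G' := by
  have hle : μ.restrict Ω' ≤ μ.restrict Ω := Measure.restrict_mono hsub le_rfl
  have hp' := hp.restrict hle
  have huL := hu.memW0.isW0Limit hX hp
  set G := weakGrad μ X Ω u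
  have hGm : modular (μ.restrict Ω) p G < ⊤ := huL.modular_grad_lt_top hX hp
  obtain ⟨φ, hφ, hφ1, hφ2⟩ := hU.exists_seq
  -- Two successive extractions give almost everywhere convergence of the functions and then of
  -- their gradients.
  obtain ⟨ns, hns, hlim1⟩ := exists_subseq_tendsto_ae_of_modular hp'
    (fun i => hU.aesm.sub (hφ i).isC1.aesm) hφ1
  obtain ⟨ms, hms, hlim2⟩ := exists_subseq_tendsto_ae_of_modular hp'
    (fun i => hU.aesm_grad.sub ((hφ (ns i)).isC1.aesm_hgrad hX)) (hφ2.comp hns.tendsto_atTop)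
  set f : ℕ → M → ℝ := fun i => φ (ns (ms i)) with hf
  have hfT : ∀ i, IsTestFunction n Ω' (f i) := fun i => hφ _
  have hfG : Tendsto (fun i => modular (μ.restrict Ω') p (fun x => G' x - hgrad X (f i) x))
      atTop (𝓝 0) := hφ2.comp (hns.tendsto_atTop.comp hms.tendsto_atTop)
  set ε : ℕ → ℝ := fun i => 1 / ((i : ℝ) + 1)
  have hε : Tendsto ε atTop (𝓝 0) := tendsto_one_div_succ
  have hε0 : ∀ i, 0 < ε i := fun i => by positivity
  have hε1 : ∀ i, ε i ≤ 1 := fun i => by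
    rw [div_le_one (by positivity)]; linarith [Nat.cast_nonneg (α := ℝ) i]
  set w : ℕ → M → ℝ := fun i x => √(f i x ^ 2 + (ε i ^ 2) ^ 2) with hw
  set L : ℕ → M → ℝ≥0∞ := fun i x => ENNReal.ofReal (piconeRemainder (p x)
    (w i x / (ε i + u x)) (f i x / w i x) (hgrad X (f i) x) (G x)) with hL
  set B : ℕ → M → ℝ≥0∞ := fun i x => ENNReal.ofReal (lam * (g x * u x ^ (p x - 1)
    * ((w i x ^ p x - (ε i ^ 2) ^ p x) * (ε i + u x) ^ (1 - p x)))) with hB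
  have hineq : ∀ i, ∫⁻ x in Ω', (L i x + B i x) ∂μ ≤ modular (μ.restrict Ω') p (hgrad X (f i))
      + ENNReal.ofReal (P * ε i) * modular (μ.restrict Ω) p G := fun i => by
    have hT : IsTestFunction n Ω (f i) :=
      ⟨(hfT i).smooth, (hfT i).compact, (hfT i).support_subset.trans hsub⟩
    have := picone_inequality hμ hX hΩ hp hpC hq hqp hpP hg hg0 hgC hu hpos horth hT (hε0 i)
      (hε1 i)
    rw [modular_hgrad_restrict (hfT i) hΩ' hΩ.measurableSet hsub
      (fun x hx => hq.trans_le (hqp x hx))] at this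
    refine le_trans ?_ this
    have hum := huL.aesm.aemeasurable
    have hfm := hT.isC1.aesm (μ := μ).aemeasurable
    have hwm : AEMeasurable (w i) (μ.restrict Ω) := ((hfm.pow_const 2).add_const _).sqrt
    have hLm : AEMeasurable (L i) (μ.restrict Ω) :=
      (aemeasurable_piconeRemainder hp.aemeasurable (hwm.div (hum.const_add _))
        (hfm.div hwm) (hT.isC1.aesm_hgrad hX) huL.aesm_grad).ennreal_ofReal
    rw [← lintegral_add_left' hLm]
    exact lintegral_mono' hle le_rfl
  have hum := huL.aesm.aemeasurable.mono_measure hle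
  have hUm := hU.aesm.aemeasurable
  have hfm : ∀ i, AEMeasurable (f i) (μ.restrict Ω') := fun i => (hfT i).isC1.aesm.aemeasurable
  have hwm : ∀ i, AEMeasurable (w i) (μ.restrict Ω') := fun i =>
    (((hfm i).pow_const 2).add_const _).sqrt
  have hGsm := huL.aesm_grad.mono_measure hle
  have hLm : ∀ i, AEMeasurable (L i) (μ.restrict Ω') := fun i =>
      (aemeasurable_piconeRemainder hp'.aemeasurable ((hwm i).div (hum.const_add _))
        ((hfm i).div (hwm i)) ((hfT i).isC1.aesm_hgrad hX) hGsm).ennreal_ofReal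
  have hBm : ∀ i, AEMeasurable (B i) (μ.restrict Ω') := fun i =>
    ((((hg.mono_measure hle).mul (hum.pow (hp'.aemeasurable.sub_const 1))).mul
      ((((hwm i).pow hp'.aemeasurable).sub (aemeasurable_const.pow hp'.aemeasurable)).mul
      ((hum.const_add _).pow (hp'.aemeasurable.const_sub 1)))).const_mul lam).ennreal_ofReal
  have hlim : ∀ᵐ x ∂(μ.restrict Ω'), Tendsto (fun i => L i x + B i x) atTop
      (𝓝 (ENNReal.ofReal (piconeRemainder (p x) (U x / u x) 1 (G' x) (G x))
        + ENNReal.ofReal (lam * (g x * U x ^ p x)))) := by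
    filter_upwards [hlim1, hlim2, ae_mono hle hpos, hUpos, hp'.one_lt] with x h1 h2 hux hUx hpx
    have h1' : Tendsto (fun i => f i x) atTop (𝓝 (U x)) := by
      simpa using (h1.comp hms.tendsto_atTop).const_sub (U x)
    have h2' : Tendsto (fun i => hgrad X (f i) x) atTop (𝓝 (G' x)) := by
      simpa using h2.const_sub (G' x)
    have hδ : Tendsto (fun i => ε i ^ 2) atTop (𝓝 0) := by simpa using hε.pow 2
    have hwx : Tendsto (fun i => w i x) atTop (𝓝 (U x)) := by
      have := ((h1'.pow 2).add (hδ.pow 2)).sqrt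
      simpa [Real.sqrt_sq hUx.le] using this
    have hvx : Tendsto (fun i => ε i + u x) atTop (𝓝 (u x)) := by simpa using hε.add_const (u x)
    refine Tendsto.add (ENNReal.tendsto_ofReal ?_) (ENNReal.tendsto_ofReal ?_)
    · refine tendsto_piconeRemainder hpx (div_pos hUx hux) (hwx.div hvx hux.ne') ?_ h2'
      have := h1'.div hwx hUx.ne'
      rwa [div_self hUx.ne'] at this
    · exact tendsto_picone_eigen hpx hux hwx hε hδ
  have hm : AEMeasurable (fun x => ENNReal.ofReal (piconeRemainder (p x) (U x / u x) 1 (G' x)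
      (G x))) (μ.restrict Ω') :=
    (aemeasurable_piconeRemainder hp'.aemeasurable (hUm.div hum)
      aemeasurable_const hU.aesm_grad hGsm).ennreal_ofReal
  rw [← lintegral_add_left' hm]
  calc _ = ∫⁻ x in Ω', liminf (fun i => L i x + B i x) atTop ∂μ :=
        lintegral_congr_ae (hlim.mono fun x hx => hx.liminf_eq.symm)
    _ ≤ liminf (fun i => ∫⁻ x in Ω', (L i x + B i x) ∂μ) atTop :=
        lintegral_liminf_le' fun i => (hLm i).add (hBm i)
    _ ≤ liminf (fun i => modular (μ.restrict Ω') p (hgrad X (f i))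
          + ENNReal.ofReal (P * ε i) * modular (μ.restrict Ω) p G) atTop :=
        liminf_le_liminf (Eventually.of_forall hineq)
    _ ≤ _ := by
        have h0 : Tendsto (fun i => ENNReal.ofReal (P * ε i) * modular (μ.restrict Ω) p G) atTop
            (𝓝 0) := by
          have := ENNReal.Tendsto.mul_const (b := modular (μ.restrict Ω) p G)
            (ENNReal.tendsto_ofReal (hε.const_mul P)) (.inr hGm.ne)
          simpa using this
        exact le_modular_of_tendsto hp' hU.aesm_grad hfG h0

/-- Two positive solutions, the first with the smaller parameter and on the smaller set, have
proportional gradients. -/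
theorem grad_eq_smul_of_le [IsFiniteMeasure (μ.restrict Ω)] (hμ : IsSmoothVolume n μ)
    (hX : ∀ k, IsSmoothField (X k)) (hΩ : IsOpen Ω) (hp : IsExponent (μ.restrict Ω) p P)
    (hpC : ContMDiffOn (𝓡 n) 𝓘(ℝ, ℝ) 1 p Ω) {q : ℝ} (hq : 1 < q) (hqp : ∀ x ∈ Ω, q ≤ p x)
    (hpP : ∀ x ∈ Ω, p x ≤ P) (hg : AEMeasurable g (μ.restrict Ω)) (hg0 : ∀ x ∈ Ω, 0 < g x)
    {C : ℝ} (hgC : ∀ x ∈ Ω, g x ≤ C)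
    {u : M → ℝ} {lam : ℝ} (hu : IsWeakSolution μ X p g Ω u lam)
    (hpos : ∀ᵐ x ∂(μ.restrict Ω), 0 < u x)
    (horth : ∀ᵐ x ∂(μ.restrict Ω), inner ℝ (hgrad X p x) (weakGrad μ X Ω u x) = 0)
    (hΩ' : IsOpen Ω') (hsub : Ω' ⊆ Ω) {U : M → ℝ} {lam' : ℝ}
    (hU : IsWeakSolution μ X p g Ω' U lam') (hUpos : ∀ᵐ x ∂(μ.restrict Ω'), 0 < U x)
    (hlam : lam' ≤ lam) :
    ∀ᵐ x ∂(μ.restrict Ω'), weakGrad μ X Ω' U x = (U x / u x) • weakGrad μ X Ω u x := by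
  have hle : μ.restrict Ω' ≤ μ.restrict Ω := Measure.restrict_mono hsub le_rfl
  have : IsFiniteMeasure (μ.restrict Ω') := isFiniteMeasure_of_le _ hle
  have hp' := hp.restrict hle
  have hUL := hU.memW0.isW0Limit hX hp'
  have huL := hu.memW0.isW0Limit hX hp
  have hlimit := picone_limit hμ hX hΩ hp hpC hq hqp hpP hg hg0 hgC hu hpos horth hΩ' hsub hUL
    hUpos
  have hmem : ∀ᵐ x ∂(μ.restrict Ω'), x ∈ Ω' := ae_restrict_mem hΩ'.measurableSet
  have iG := integrable_norm_rpow_of_modular hp' hUL.aesm_grad (hUL.modular_grad_lt_top hX hp')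
  have iU := integrable_norm_rpow_of_modular hp' hUL.aesm (hUL.modular_lt_top hp')
  have igU : Integrable (fun x => g x * U x ^ p x) (μ.restrict Ω') := by
    refine (iU.const_mul C).mono' ((hg.mono_measure hle).mul
      (hUL.aesm.aemeasurable.pow hp'.aemeasurable)).aestronglyMeasurable ?_
    filter_upwards [hmem, hUpos] with x hx hUx
    have h1 := hg0 x (hsub hx)
    rw [Real.norm_of_nonneg (by positivity), Real.norm_of_nonneg hUx.le]
    gcongr
    exact hgC x (hsub hx)
  -- Testing the equation of `U` with `U` itself gives the energy identity, which turns the upper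
  -- bound of `hlimit` into `lam'` times the integral of `g U^p`.
  have heq := hU.eqn U hU.memW0
  have h1 : modular (μ.restrict Ω') p (weakGrad μ X Ω' U)
      = ENNReal.ofReal (∫ x in Ω', ‖weakGrad μ X Ω' U x‖ ^ p x ∂μ) :=
    (ofReal_integral_eq_lintegral_ofReal iG (Eventually.of_forall fun x => by positivity)).symm
  have h2 : ∫ x in Ω', ‖weakGrad μ X Ω' U x‖ ^ p x ∂μ
      = ∫ x in Ω', lam' * (g x * U x ^ p x) ∂μ := by
    rw [integral_const_mul]
    rw [sub_eq_zero] at heq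
    convert heq using 1
    · refine integral_congr_ae ?_
      filter_upwards [hp'.one_lt] with x hx
      exact (norm_rpow_sub_two_mul_inner_self hx _).symm
    · congr 1
      refine integral_congr_ae ?_
      filter_upwards [hUpos] with x hx
      rw [abs_of_pos hx, mul_assoc, mul_assoc, ← mul_assoc (U x ^ _), ← Real.rpow_add_one hx.ne',
        ← Real.rpow_add_one hx.ne']
      congr 2; ring
  have hgU0 : ∀ᵐ x ∂(μ.restrict Ω'), 0 ≤ g x * U x ^ p x := by
    filter_upwards [hmem, hUpos] with x hx hUx
    have h1 := hg0 x (hsub hx)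
    positivity
  have h3 : ENNReal.ofReal (∫ x in Ω', lam' * (g x * U x ^ p x) ∂μ)
      = ∫⁻ x in Ω', ENNReal.ofReal (lam' * (g x * U x ^ p x)) ∂μ :=
    ofReal_integral_eq_lintegral_ofReal (igU.const_mul lam')
      (hgU0.mono fun x hx => mul_nonneg hU.pos.le hx)
  have h4 : ∫⁻ x in Ω', ENNReal.ofReal (lam' * (g x * U x ^ p x)) ∂μ
      ≤ ∫⁻ x in Ω', ENNReal.ofReal (lam * (g x * U x ^ p x)) ∂μ := by
    refine lintegral_mono_ae ?_
    filter_upwards [hgU0] with x hx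
    exact ENNReal.ofReal_le_ofReal (mul_le_mul_of_nonneg_right hlam hx)
  -- Cancellation in `ℝ≥0∞` is legitimate only because this term is finite; it leaves a vanishing
  -- integral of the remainder.
  have h5 : ∫⁻ x in Ω', ENNReal.ofReal (lam * (g x * U x ^ p x)) ∂μ ≠ ⊤ :=
    (igU.const_mul lam).lintegral_lt_top.ne
  have h6 : ∫⁻ x in Ω', ENNReal.ofReal (piconeRemainder (p x) (U x / u x) 1
      (weakGrad μ X Ω' U x) (weakGrad μ X Ω u x)) ∂μ = 0 := by
    rw [h1, h2, h3] at hlimit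
    have h7 := hlimit.trans h4
    by_contra h0
    exact absurd h7 (not_le.2 (by
      rw [add_comm]; exact ENNReal.lt_add_right h5 h0))
  have hm : AEMeasurable (fun x => piconeRemainder (p x) (U x / u x) 1
      (weakGrad μ X Ω' U x) (weakGrad μ X Ω u x)) (μ.restrict Ω') :=
    aemeasurable_piconeRemainder hp'.aemeasurable
    (hUL.aesm.aemeasurable.div (huL.aesm.aemeasurable.mono_measure hle))
    aemeasurable_const hUL.aesm_grad (huL.aesm_grad.mono_measure hle)
  rw [lintegral_eq_zero_iff' hm.ennreal_ofReal] at h6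
  filter_upwards [h6, hUpos, ae_mono hle hpos, hp'.one_lt] with x hx hUx hux hpx
  have hs : 0 < U x / u x := div_pos hUx hux
  refine eq_smul_of_piconeRemainder_eq_zero hpx hs (le_antisymm ?_
    (piconeRemainder_nonneg hpx hs.le (by simp) _ _))
  exact ENNReal.ofReal_eq_zero.1 hx

/-- Local integrability of the logarithmic gradient of a positive solution. -/
theorem lintegral_norm_div_lt_top [IsFiniteMeasure (μ.restrict Ω)] (hμ : IsSmoothVolume n μ)
    (hX : ∀ k, IsSmoothField (X k)) (hΩ : IsOpen Ω) (hp : IsExponent (μ.restrict Ω) p P)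
    (hpC : ContMDiffOn (𝓡 n) 𝓘(ℝ, ℝ) 1 p Ω) {q : ℝ} (hq : 1 < q) (hqp : ∀ x ∈ Ω, q ≤ p x)
    (hpP : ∀ x ∈ Ω, p x ≤ P) (hg : AEMeasurable g (μ.restrict Ω)) (hg0 : ∀ x ∈ Ω, 0 < g x)
    {C : ℝ} (hgC : ∀ x ∈ Ω, g x ≤ C)
    {u : M → ℝ} {lam : ℝ} (hu : IsWeakSolution μ X p g Ω u lam)
    (hpos : ∀ᵐ x ∂(μ.restrict Ω), 0 < u x)
    (horth : ∀ᵐ x ∂(μ.restrict Ω), inner ℝ (hgrad X p x) (weakGrad μ X Ω u x) = 0)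
    {φ : M → ℝ} (hφ : IsTestFunction n Ω φ) {K : Set M} (hK : MeasurableSet K) (hKΩ : K ⊆ Ω)
    (hφK : ∀ x ∈ K, φ x = 1) :
    ∫⁻ x in K, ENNReal.ofReal (‖weakGrad μ X Ω u x‖ / u x) ∂μ < ⊤ := by
  have hle : μ.restrict K ≤ μ.restrict Ω := Measure.restrict_mono hKΩ le_rfl
  have : IsFiniteMeasure (μ.restrict K) := isFiniteMeasure_of_le _ hle
  have huL := hu.memW0.isW0Limit hX hp
  set G := weakGrad μ X Ω u
  have hGm : modular (μ.restrict Ω) p G < ⊤ := huL.modular_grad_lt_top hX hp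
  have hφm : modular (μ.restrict Ω) p (hgrad X φ) < ⊤ := hφ.isC1.modular_hgrad_lt_top hX hp
  -- `C1` and `C2` bound `(2p/(p-1))^p` and `2/(p-1)` uniformly through `q ≤ p ≤ P`; the maximum
  -- with 1 allows the exponent to be raised to `P`.
  set C1 : ℝ := (max 1 (2 * P / (q - 1))) ^ P
  set C2 : ℝ := 2 / (q - 1)
  have hq1 : 0 < q - 1 := by linarith
  set T : ℝ≥0∞ := 1 * μ K + (ENNReal.ofReal C1 * modular (μ.restrict Ω) p (hgrad X φ)
    + ENNReal.ofReal C2 * (modular (μ.restrict Ω) p (hgrad X φ)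
      + ENNReal.ofReal |P| * modular (μ.restrict Ω) p G)) with hT
  have hTtop : T < ⊤ := by
    have hK : μ K < ⊤ := by simpa using measure_lt_top (μ.restrict K) univ
    refine ENNReal.add_lt_top.2 ⟨ENNReal.mul_lt_top ENNReal.one_lt_top hK, ENNReal.add_lt_top.2
      ⟨ENNReal.mul_lt_top ENNReal.ofReal_lt_top hφm, ENNReal.mul_lt_top ENNReal.ofReal_lt_top
        (ENNReal.add_lt_top.2 ⟨hφm, ENNReal.mul_lt_top ENNReal.ofReal_lt_top hGm⟩)⟩⟩
  have hum := huL.aesm.aemeasurable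
  have hfm := hφ.isC1.aesm (μ := μ).aemeasurable
  have key : ∀ ε : ℝ, 0 < ε → ε ≤ 1 →
      ∫⁻ x in K, ENNReal.ofReal (‖G x‖ / (ε + u x)) ∂μ ≤ T := fun ε hε hε1 => by
    have h := picone_inequality hμ hX hΩ hp hpC hq hqp hpP hg hg0 hgC hu hpos horth hφ hε hε1
    set w : M → ℝ := fun x => √(φ x ^ 2 + (ε ^ 2) ^ 2) with hw
    set L : M → ℝ := fun x => piconeRemainder (p x)
      (w x / (ε + u x)) (φ x / w x) (hgrad X φ x) (G x) with hL
    have hwm : AEMeasurable w (μ.restrict Ω) := ((hfm.pow_const 2).add_const _).sqrt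
    have hLm : AEMeasurable L (μ.restrict Ω) :=
      aemeasurable_piconeRemainder hp.aemeasurable (hwm.div (hum.const_add _))
        (hfm.div hwm) (hφ.isC1.aesm_hgrad hX) huL.aesm_grad
    have hpt : ∀ᵐ x ∂(μ.restrict K), ENNReal.ofReal (‖G x‖ / (ε + u x))
        ≤ 1 + (ENNReal.ofReal C1 * ENNReal.ofReal (‖hgrad X φ x‖ ^ p x)
          + ENNReal.ofReal C2 * ENNReal.ofReal (L x)) := by
      filter_upwards [ae_restrict_mem hK, ae_mono hle hpos] with x hx hux
      have hqx := hqp x (hKΩ hx)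
      have hPx := hpP x (hKΩ hx)
      have hpx : 1 < p x := hq.trans_le hqx
      have hv : 0 < ε + u x := by linarith
      have hw0 : 0 ≤ w x := Real.sqrt_nonneg _
      have hL0 : 0 ≤ L x := piconeRemainder_nonneg hpx (div_nonneg hw0 hv.le)
        (abs_div_sqrt_le _ _) _ _
      have hC1 : 0 ≤ C1 := by positivity
      have hC2 : 0 ≤ C2 := by positivity
      rw [← ENNReal.ofReal_mul hC1, ← ENNReal.ofReal_mul hC2, ← ENNReal.ofReal_add
        (by positivity) (by positivity), ← ENNReal.ofReal_one, ← ENNReal.ofReal_add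
        (by positivity) (by positivity)]
      refine ENNReal.ofReal_le_ofReal ?_
      -- On `K` the cutoff equals 1, so `w ≥ 1` and the quotient is dominated by the quantity that
      -- the coercivity of the Picone remainder controls.
      have h1 : ‖G x‖ / (ε + u x) ≤ w x / (ε + u x) * ‖G x‖ := by
        have : 1 ≤ w x := by
          refine Real.le_sqrt_of_sq_le ?_
          rw [hφK x hx]; nlinarith [sq_nonneg (ε ^ 2)]
        rw [div_mul_eq_mul_div]
        gcongr
        nlinarith [norm_nonneg (G x)]
      have h2 : ∀ a : ℝ, 0 ≤ a → a ≤ 1 + a ^ p x := fun a ha => by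
        rcases le_total a 1 with h | h
        · have := Real.rpow_nonneg ha (p x); linarith
        · have := Real.self_le_rpow_of_one_le h hpx.le; linarith
      have h3 := rpow_le_piconeRemainder hpx (div_nonneg hw0 hv.le)
        (abs_div_sqrt_le (φ x) (ε ^ 2)) (hgrad X φ x) (G x)
      have h4 : (2 * p x / (p x - 1)) ^ p x ≤ C1 := by
        have hp1 : 0 < p x - 1 := by linarith
        calc (2 * p x / (p x - 1)) ^ p x ≤ (max 1 (2 * P / (q - 1))) ^ p x := by
              refine Real.rpow_le_rpow (by positivity) ?_ (by linarith)
              refine le_trans ?_ (le_max_right _ _)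
              have hP : 0 ≤ P := by linarith
              gcongr
          _ ≤ C1 := Real.rpow_le_rpow_of_exponent_le (le_max_left _ _) hPx
      have h5 : 2 / (p x - 1) ≤ C2 := by
        simp only [C2]; gcongr
      calc _ ≤ _ := h1
        _ ≤ _ := h2 _ (by positivity)
        _ ≤ _ := by
          gcongr 1 + ?_
          refine h3.trans ?_
          exact add_le_add (by gcongr) (mul_le_mul_of_nonneg_right h5 hL0)
    refine (lintegral_mono_ae hpt).trans ?_
    rw [lintegral_add_left measurable_const, lintegral_const, Measure.restrict_apply_univ]
    refine add_le_add le_rfl ?_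
    refine (lintegral_mono' hle le_rfl).trans ?_
    rw [lintegral_add_left' ((aemeasurable_norm_rpow hp.aemeasurable
      (hφ.isC1.aesm_hgrad hX)).const_mul _), lintegral_const_mul' _ _ ENNReal.ofReal_ne_top,
      lintegral_const_mul' _ _ ENNReal.ofReal_ne_top]
    refine add_le_add le_rfl (mul_le_mul_right ((le_self_add.trans h).trans ?_) _)
    refine add_le_add le_rfl (mul_le_mul_left (ENNReal.ofReal_le_ofReal ?_) _)
    calc P * ε ≤ |P| * ε := by gcongr; exact le_abs_self P
      _ ≤ |P| := mul_le_of_le_one_right (abs_nonneg P) hε1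
  have hum' := hum.mono_measure hle
  have hGm' := (huL.aesm_grad.mono_measure hle).norm.aemeasurable
  refine lt_of_le_of_lt ?_ hTtop
  set ε : ℕ → ℝ := fun i => 1 / ((i : ℝ) + 1)
  have hε : Tendsto ε atTop (𝓝 0) := tendsto_one_div_succ
  -- The bound `T` does not depend on `ε`, so Fatou's lemma carries it to the limit `ε → 0`.
  calc _ = ∫⁻ x in K, liminf (fun i => ENNReal.ofReal (‖G x‖ / (ε i + u x))) atTop ∂μ := by
        refine lintegral_congr_ae ?_
        filter_upwards [ae_mono hle hpos] with x hx
        refine (Tendsto.liminf_eq (ENNReal.tendsto_ofReal ?_)).symm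
        exact tendsto_const_nhds.div (by simpa using hε.add_const (u x)) hx.ne'
    _ ≤ liminf (fun i => ∫⁻ x in K, ENNReal.ofReal (‖G x‖ / (ε i + u x)) ∂μ) atTop :=
        lintegral_liminf_le' fun i => (hGm'.div (hum'.const_add _)).ennreal_ofReal
    _ ≤ liminf (fun _ : ℕ => T) atTop := by
        refine liminf_le_liminf (Eventually.of_forall fun i => key _ (by positivity) ?_)
        rw [div_le_one (by positivity)]; linarith [Nat.cast_nonneg (α := ℝ) i]
    _ = T := liminf_const _

end PiconeLimit

/-! ### Saturations, extension by zero and the gradient of an indicator. -/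

section Saturation

/-- `F_κ(s) = s²/(s²+κ)` is a bounded smooth approximation of the indicator of `s ≠ 0`. Two features
are used: `s F_κ'(s) ≤ 2` uniformly in `κ`, and `F_κ'(s) → 0` for every `s`. -/
theorem hasDerivAt_saturation {κ : ℝ} (hκ : 0 < κ) (s : ℝ) :
    HasDerivAt (fun s : ℝ => s ^ 2 / (s ^ 2 + κ)) (2 * κ * s / (s ^ 2 + κ) ^ 2) s := by
  have h : HasDerivAt (fun s : ℝ => s ^ 2) (2 * s) s := by simpa using hasDerivAt_pow 2 s
  have h1 : s ^ 2 + κ ≠ 0 := by positivity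
  refine (h.div (h.add_const κ) h1).congr_deriv ?_
  ring

theorem saturation_le_one {κ : ℝ} (hκ : 0 < κ) (s : ℝ) : |s ^ 2 / (s ^ 2 + κ)| ≤ 1 := by
  rw [abs_of_nonneg (by positivity), div_le_one (by positivity)]
  linarith

/-- A crude bound that may blow up as `κ → 0`; it serves only the chain rule at fixed `κ`. -/
theorem abs_deriv_saturation_le {κ : ℝ} (hκ : 0 < κ) (hκ1 : κ ≤ 1) (s : ℝ) :
    |2 * κ * s / (s ^ 2 + κ) ^ 2| ≤ 1 / κ := by
  have h1 : 0 < s ^ 2 + κ := by positivity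
  rw [abs_div, abs_of_pos (pow_pos h1 2), div_le_div_iff₀ (by positivity) hκ, abs_mul,
    abs_of_pos (by positivity : 0 < 2 * κ)]
  have h2 : 2 * |s| * κ ≤ s ^ 2 + κ := by
    have : 2 * |s| ≤ s ^ 2 + 1 := by nlinarith [sq_nonneg (|s| - 1), sq_abs s]
    nlinarith [sq_nonneg s, mul_le_mul_of_nonneg_right this hκ.le,
      mul_le_mul_of_nonneg_left hκ1 (sq_nonneg s)]
  nlinarith [mul_le_mul h2 (show κ ≤ s ^ 2 + κ by nlinarith [sq_nonneg s]) hκ.le h1.le]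

/-- Expanding the square gives `2κs² ≤ 2(s²+κ)²`. Uniformity in `κ` is what yields a dominating
function when `‖∇_X U‖ ≤ U h`. -/
theorem deriv_saturation_mul_le {κ s : ℝ} (hκ : 0 < κ) :
    2 * κ * s / (s ^ 2 + κ) ^ 2 * s ≤ 2 := by
  rw [div_mul_eq_mul_div, div_le_iff₀ (by positivity)]
  nlinarith [sq_nonneg (s ^ 2), sq_nonneg κ, mul_nonneg (sq_nonneg s) hκ.le]

theorem tendsto_saturation {s : ℝ} (hs : s ≠ 0) {κ : ℕ → ℝ} (hκ : Tendsto κ atTop (𝓝 0)) :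
    Tendsto (fun i => s ^ 2 / (s ^ 2 + κ i)) atTop (𝓝 1) := by
  have h : Tendsto (fun i => s ^ 2 + κ i) atTop (𝓝 (s ^ 2)) := by simpa using hκ.const_add (s ^ 2)
  have h1 := (tendsto_const_nhds (x := s ^ 2)).div h (by positivity)
  rwa [div_self (by positivity)] at h1

theorem tendsto_deriv_saturation {s : ℝ} {κ : ℕ → ℝ} (hκ : Tendsto κ atTop (𝓝 0)) :
    Tendsto (fun i => 2 * κ i * s / (s ^ 2 + κ i) ^ 2) atTop (𝓝 0) := by
  rcases eq_or_ne s 0 with rfl | hs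
  · simp
  have h : Tendsto (fun i => s ^ 2 + κ i) atTop (𝓝 (s ^ 2)) := by simpa using hκ.const_add (s ^ 2)
  have h1 := ((hκ.const_mul 2).mul_const s).div (h.pow 2) (by positivity)
  simp only [mul_zero, zero_mul, zero_div] at h1
  exact h1

variable {n N : ℕ} {M : Type*} [TopologicalSpace M]
  [ChartedSpace (EuclideanSpace ℝ (Fin n)) M]

/-- On a manifold there are cutoff functions between compact and open sets. -/
theorem exists_isTestFunction_eq_one [T2Space M] [SecondCountableTopology M]
    [IsManifold (𝓡 n) ∞ M] {K Ω : Set M} (hK : IsCompact K) (hΩ : IsOpen Ω) (h : K ⊆ Ω) :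
    ∃ φ : M → ℝ, IsTestFunction n Ω φ ∧ ∀ x ∈ K, φ x = 1 := by
  have : LocallyCompactSpace M := ChartedSpace.locallyCompactSpace (EuclideanSpace ℝ (Fin n)) M
  obtain ⟨L, hL, hKL, hLΩ⟩ := exists_compact_between hK hΩ h
  obtain ⟨f, h0, h1, -⟩ := exists_contMDiffMap_zero_one_of_isClosed (n := (⊤ : ℕ∞)) (𝓡 n)
    (isOpen_interior (s := L)).isClosed_compl hK.isClosed
    (disjoint_compl_left_iff_subset.2 hKL)
  have hs : tsupport f ⊆ L := closure_minimal (fun x hx => by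
    by_contra hxL
    exact hx (h0 fun hx' => hxL (interior_subset hx'))) hL.isClosed
  exact ⟨f, ⟨f.contMDiff, hL.of_isClosed_subset (isClosed_tsupport _) hs, hs.trans hLΩ⟩,
    fun x hx => h1 hx⟩

variable [MeasurableSpace M] [BorelSpace M] [IsManifold (𝓡 n) ∞ M]
  [T2Space M] [SecondCountableTopology M]
  {μ : Measure M} {X : Fin N → VField n M} {p : M → ℝ} {Ω Ω' : Set M} {P : ℝ}
  {U : M → ℝ} {G : M → EuclideanSpace ℝ (Fin N)}

theorem modular_indicator {F : Type*} [NormedAddCommGroup F] (hΩ : MeasurableSet Ω)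
    (hΩ' : MeasurableSet Ω') (hsub : Ω' ⊆ Ω) (hp : ∀ x ∈ Ω, 1 < p x) {f : M → F} :
    modular (μ.restrict Ω) p (Ω'.indicator f) = modular (μ.restrict Ω') p f := by
  unfold modular
  have h : ∀ x ∈ Ω, ENNReal.ofReal (‖Ω'.indicator f x‖ ^ p x)
      = Ω'.indicator (fun x => ENNReal.ofReal (‖f x‖ ^ p x)) x := fun x hx => by
    by_cases h : x ∈ Ω'
    · simp [h]
    · simp [h, Real.zero_rpow (by linarith [hp x hx] : p x ≠ 0)]
  rw [setLIntegral_congr_fun hΩ h, lintegral_indicator hΩ', Measure.restrict_restrict hΩ',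
    inter_eq_left.2 hsub]

/-- Extension by zero. -/
theorem IsW0Limit.indicator (hΩ : IsOpen Ω) (hΩ' : IsOpen Ω') (hsub : Ω' ⊆ Ω)
    (hp : ∀ x ∈ Ω, 1 < p x) (h : IsW0Limit μ X p Ω' U G) :
    IsW0Limit μ X p Ω (Ω'.indicator U) (Ω'.indicator G) := by
  have hm := hΩ'.measurableSet
  have hr : (μ.restrict Ω).restrict Ω' = μ.restrict Ω' := by
    rw [Measure.restrict_restrict hm, inter_eq_left.2 hsub]
  refine ⟨?_, ?_, fun ε hε => ?_⟩
  · rw [aestronglyMeasurable_indicator_iff hm, hr]; exact h.aesm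
  · rw [aestronglyMeasurable_indicator_iff hm, hr]; exact h.aesm_grad
  -- The same test functions serve on the larger set, since they and their gradients vanish off
  -- `Ω'`; no regularity of the boundary is involved.
  obtain ⟨φ, hφ, h1, h2⟩ := h.approx ε hε
  refine ⟨φ, ⟨hφ.smooth, hφ.compact, hφ.support_subset.trans hsub⟩, ?_, ?_⟩
  · have e : (fun x => Ω'.indicator U x - φ x) = Ω'.indicator (fun x => U x - φ x) := by
      ext x
      by_cases hx : x ∈ Ω'
      · simp [hx]
      · have : φ x = 0 := image_eq_zero_of_notMem_tsupport fun h => hx (hφ.support_subset h)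
        simp [hx, this]
    rwa [e, modular_indicator hΩ.measurableSet hm hsub hp]
  · have e : (fun x => Ω'.indicator G x - hgrad X φ x)
        = Ω'.indicator (fun x => G x - hgrad X φ x) := by
      ext1 x
      by_cases hx : x ∈ Ω'
      · simp [hx]
      · have : hgrad X φ x = 0 :=
          hgrad_eq_zero_of_notMem_tsupport fun h => hx (hφ.support_subset h)
        simp [hx, this]
    rwa [e, modular_indicator hΩ.measurableSet hm hsub hp]

/-- At fixed `κ` the saturation is smooth with bounded derivative and vanishes at zero, so
`isW0Limit_of_bounded_coeff` applies with `b = 0`. -/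
theorem IsW0Limit.saturation [IsFiniteMeasure (μ.restrict Ω)] (hX : ∀ k, IsSmoothField (X k))
    (hΩ : IsOpen Ω) (hp : IsExponent (μ.restrict Ω) p P) (h : IsW0Limit μ X p Ω U G) {κ : ℝ}
    (hκ : 0 < κ) (hκ1 : κ ≤ 1) :
    IsW0Limit μ X p Ω (fun x => U x ^ 2 / (U x ^ 2 + κ))
      (fun x => (2 * κ * U x / (U x ^ 2 + κ) ^ 2) • G x) := by
  obtain ⟨φ, hφ, h1, h2⟩ := h.exists_seq
  obtain ⟨ns, hns, hlim⟩ := exists_subseq_tendsto_ae_of_modular hp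
    (fun i => h.aesm.sub (hφ i).isC1.aesm) h1
  have hlim' : ∀ᵐ x ∂(μ.restrict Ω), Tendsto (fun i => φ (ns i) x) atTop (𝓝 (U x)) := by
    filter_upwards [hlim] with x hx
    simpa using hx.const_sub (U x)
  have hF : ContDiff ℝ ∞ (fun s : ℝ => s ^ 2 / (s ^ 2 + κ)) :=
    (contDiff_id.pow 2).div ((contDiff_id.pow 2).add contDiff_const) fun s => by
      positivity
  have hFc : Continuous (fun s : ℝ => 2 * κ * s / (s ^ 2 + κ) ^ 2) :=
    (continuous_const.mul continuous_id).div₀ (by fun_prop) fun s => by positivity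
  have hT : ∀ i, IsC1TestFunction n Ω (fun x => φ (ns i) x ^ 2 / (φ (ns i) x ^ 2 + κ)) :=
    fun i => isC1TestFunction_of_contMDiffOn hΩ
      ((hF.of_le (by simp)).comp_contMDiff (hφ (ns i)).isC1.smooth).contMDiffOn (hφ (ns i)).isC1
      fun x hx => by rw [hx]; simp
  have key := isW0Limit_of_bounded_coeff hX hΩ hp h.aesm_grad (h.modular_grad_lt_top hX hp)
    (φ := fun i => φ (ns i)) (fun i => hφ (ns i)) (h2.comp hns.tendsto_atTop)
    (b := fun _ _ => 0) (c := fun i x => 2 * κ * φ (ns i) x / (φ (ns i) x ^ 2 + κ) ^ 2)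
    (C := 1 / κ) (b' := fun _ => 0) hT ?_ (fun i => continuousOn_const)
    (fun i => (hFc.comp (hφ (ns i)).smooth.continuous).continuousOn)
    ((one_le_div hκ).2 hκ1) (fun i x _ => (saturation_le_one hκ _).trans ((one_le_div hκ).2 hκ1))
    (fun i x _ => by simp [hκ.le]) (fun i x _ => abs_deriv_saturation_le hκ hκ1 _)
    (f' := fun x => U x ^ 2 / (U x ^ 2 + κ)) (c' := fun x => 2 * κ * U x / (U x ^ 2 + κ) ^ 2)
    (hlim'.mono fun x hx => (hF.continuous.tendsto _).comp hx)
    (Eventually.of_forall fun x => tendsto_const_nhds)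
    (hlim'.mono fun x hx => (hFc.tendsto _).comp hx)
  · simpa using key
  · intro i x hx
    have hd : MDifferentiableAt (𝓡 n) 𝓘(ℝ, ℝ) (φ (ns i)) x :=
      (hφ (ns i)).smooth.mdifferentiableAt (by simp)
    have := hgrad_eq_of_hasDerivAt (X := X) (f₁ := φ (ns i)) (f₂ := φ (ns i)) (f₃ := φ (ns i))
      (ψ := fun x => φ (ns i) x ^ 2 / (φ (ns i) x ^ 2 + κ))
      (α₁ := 2 * κ * φ (ns i) x / (φ (ns i) x ^ 2 + κ) ^ 2) (α₂ := 0) (α₃ := 0)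
      ((hT i).smooth.mdifferentiableAt (by simp)) hd hd hd ?_
    · simpa using this
    · intro γ d₁ d₂ d₃ h0 hd1 _ _
      have := (h0 ▸ hasDerivAt_saturation hκ (φ (ns i) x) :
        HasDerivAt (fun s : ℝ => s ^ 2 / (s ^ 2 + κ)) (2 * κ * φ (ns i) x
          / (φ (ns i) x ^ 2 + κ) ^ 2) (φ (ns i) (γ 0))).comp 0 hd1
      simp only [zero_mul, add_zero]
      exact this

/-- If `|∇_X U| ≤ U h` with `h` locally integrable, the indicator of the set where `U` is positive
has vanishing weak horizontal gradient. -/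
theorem isWeakDeriv_indicator_one [IsFiniteMeasure (μ.restrict Ω)] (hμ : IsSmoothVolume n μ)
    (hX : ∀ k, IsSmoothField (X k)) (hΩ : IsOpen Ω) (hp : IsExponent (μ.restrict Ω) p P)
    (hΩ' : MeasurableSet Ω') (hU : IsW0Limit μ X p Ω U G)
    (hpos : ∀ᵐ x ∂(μ.restrict Ω), x ∈ Ω' → 0 < U x)
    (hzero : ∀ᵐ x ∂(μ.restrict Ω), x ∉ Ω' → U x = 0) {h : M → ℝ}
    (hh : ∀ K ⊆ Ω, IsCompact K → ∫⁻ x in K, ENNReal.ofReal (h x) ∂μ < ⊤)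
    (hG : ∀ᵐ x ∂(μ.restrict Ω), ‖G x‖ ≤ U x * h x) (k : Fin N) :
    IsWeakDeriv (X k) Ω (Ω'.indicator 1) 0 := by
  set κ : ℕ → ℝ := fun i => 1 / ((i : ℝ) + 1)
  have hκ : Tendsto κ atTop (𝓝 0) := tendsto_one_div_succ
  have hκ0 : ∀ i, 0 < κ i := fun i => by positivity
  have hκ1 : ∀ i, κ i ≤ 1 := fun i => by
    rw [div_le_one (by positivity)]; linarith [Nat.cast_nonneg (α := ℝ) i]
  have hW := fun i => hU.saturation hX hΩ hp (hκ0 i) (hκ1 i)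
  have hWG := fun i => (hW i).isWeakGrad hμ hX hΩ hp
  set ui : ℕ → M → ℝ := fun i x => U x ^ 2 / (U x ^ 2 + κ i)
  set Gi : ℕ → M → EuclideanSpace ℝ (Fin N) := fun i x =>
    (2 * κ i * U x / (U x ^ 2 + κ i) ^ 2) • G x
  have hproj : ∀ i, AEStronglyMeasurable (fun x => Gi i x k) (μ.restrict Ω) := fun i =>
    (EuclideanSpace.proj (𝕜 := ℝ) k).continuous.comp_aestronglyMeasurable (hW i).aesm_grad
  have hk : ∀ v : EuclideanSpace ℝ (Fin N), ‖v k‖ ≤ ‖v‖ := fun v => PiLp.norm_apply_le v k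
  have h1m : AEStronglyMeasurable (Ω'.indicator (1 : M → ℝ)) (μ.restrict Ω) :=
    (stronglyMeasurable_one.indicator hΩ').aestronglyMeasurable
  have h1i : IntegrableOn (Ω'.indicator (1 : M → ℝ)) Ω μ :=
    (integrable_const (1 : ℝ)).indicator hΩ'
  have hlimU : ∀ᵐ x ∂(μ.restrict Ω), Tendsto (fun i => ui i x) atTop
      (𝓝 (Ω'.indicator (1 : M → ℝ) x)) := by
    filter_upwards [hpos, hzero] with x h1 h2
    by_cases hx : x ∈ Ω'
    · simpa [hx] using tendsto_saturation (h1 hx).ne' hκ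
    · simp [ui, hx, h2 hx]
  -- Let `κ → 0`: the saturations converge boundedly to the indicator, while their gradients tend to
  -- zero under the bound `2 h`, integrable on compact sets.
  refine IsWeakDeriv.of_tendsto hμ (hX k) hΩ h1m aestronglyMeasurable_zero
    h1i.locallyIntegrableOn locallyIntegrableOn_zero (ui := ui) (wi := fun i x => Gi i x k)
    (fun i => (hW i).aesm) hproj (fun i => (hWG i).locInt) (fun i => ?_)
    (fun i => (hWG i).weak k) (fun K hKΩ hK => ?_) (fun K hKΩ hK => ?_)
  · exact fun x hx => by
      obtain ⟨t, ht, hi⟩ := (hWG i).locInt_grad x hx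
      exact ⟨t, ht, (EuclideanSpace.proj (𝕜 := ℝ) k).integrable_comp hi⟩
  · have hle : μ.restrict K ≤ μ.restrict Ω := Measure.restrict_mono hKΩ le_rfl
    have : IsFiniteMeasure (μ.restrict K) := isFiniteMeasure_of_le _ hle
    have := tendsto_lintegral_of_dominated_convergence' (μ := μ.restrict K) (f := fun _ => 0)
      (F := fun i x => ‖ui i x - Ω'.indicator (1 : M → ℝ) x‖ₑ) (fun _ => 2)
      (fun i => ((hW i).aesm.sub h1m).enorm.mono_measure hle) ?_ ?_ ?_
    · simpa using this
    · intro i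
      refine Eventually.of_forall fun x => ?_
      change ‖ui i x - Ω'.indicator (1 : M → ℝ) x‖ₑ ≤ 2
      rw [← ofReal_norm, ← ENNReal.ofReal_ofNat 2]
      refine ENNReal.ofReal_le_ofReal ((norm_sub_le _ _).trans ?_)
      have h1 : ‖ui i x‖ ≤ 1 := saturation_le_one (hκ0 i) _
      have h2 : ‖Ω'.indicator (1 : M → ℝ) x‖ ≤ 1 := by
        by_cases hx : x ∈ Ω' <;> simp [hx]
      linarith
    · simpa using ENNReal.mul_ne_top ENNReal.ofNat_ne_top (measure_ne_top (μ.restrict K) univ)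
    · filter_upwards [ae_mono hle hlimU] with x hx
      have := (hx.sub_const (Ω'.indicator (1 : M → ℝ) x)).enorm
      simpa using this
  · have hle : μ.restrict K ≤ μ.restrict Ω := Measure.restrict_mono hKΩ le_rfl
    have := tendsto_lintegral_of_dominated_convergence' (μ := μ.restrict K) (f := fun _ => 0)
      (F := fun i x => ‖Gi i x k - (0 : M → ℝ) x‖ₑ)
      (fun x => ENNReal.ofReal 2 * ENNReal.ofReal (h x))
      (fun i => ((hproj i).sub aestronglyMeasurable_zero).enorm.mono_measure hle) ?_ ?_ ?_
    · simpa using this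
    · intro i
      filter_upwards [ae_mono hle hG, ae_mono hle hpos, ae_mono hle hzero] with x hGx h1 h2
      rw [← ofReal_norm, ← ENNReal.ofReal_mul (by norm_num)]
      have hU0 : 0 ≤ U x := by
        by_cases hx : x ∈ Ω'
        · exact (h1 hx).le
        · exact (h2 hx).ge
      rcases hU0.eq_or_lt with h0 | h0
      · simp [Gi, ← h0]
      refine ENNReal.ofReal_le_ofReal ?_
      have hh0 : 0 ≤ h x := nonneg_of_mul_nonneg_right ((norm_nonneg _).trans hGx) h0
      have hk' := hκ0 i
      simp only [Pi.zero_apply, sub_zero]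
      refine (hk _).trans ?_
      simp only [Gi]
      rw [norm_smul, Real.norm_of_nonneg (by positivity)]
      calc _ ≤ 2 * κ i * U x / (U x ^ 2 + κ i) ^ 2 * (U x * h x) := by gcongr
        _ = (2 * κ i * U x / (U x ^ 2 + κ i) ^ 2 * U x) * h x := by ring
        _ ≤ 2 * h x := by gcongr; exact deriv_saturation_mul_le hk'
    · rw [lintegral_const_mul' _ _ ENNReal.ofReal_ne_top]
      exact (ENNReal.mul_lt_top ENNReal.ofReal_lt_top (hh K hKΩ hK)).ne
    · refine Eventually.of_forall fun x => ?_
      have h1 : Tendsto (fun i => Gi i x) atTop (𝓝 ((0 : ℝ) • G x)) :=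
        (tendsto_deriv_saturation hκ).smul_const (G x)
      have h2 := (((EuclideanSpace.proj (𝕜 := ℝ) k).continuous.tendsto _).comp h1).enorm
      simpa using h2

end Saturation

/-! ### Fields along which a function has zero distributional derivative. -/

section Annihilator

variable {n : ℕ} {O : Set (EuclideanSpace ℝ (Fin n))}
  {a b : EuclideanSpace ℝ (Fin n) → EuclideanSpace ℝ (Fin n)}
  {f φ : EuclideanSpace ℝ (Fin n) → ℝ}

theorem contDiffOn_lieBracket (hO : IsOpen O) (ha : ContDiffOn ℝ ∞ a O)
    (hb : ContDiffOn ℝ ∞ b O) : ContDiffOn ℝ ∞ (VectorField.lieBracket ℝ a b) O :=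
  ((hb.fderiv_of_isOpen hO (m := ∞) (by simp)).clm_apply ha).sub
    ((ha.fderiv_of_isOpen hO (m := ∞) (by simp)).clm_apply hb)

/-- Two integrations by parts: `divMul a` and `divMul b` are minus the adjoints of derivation along
`a` and `b`, so the signs cancel and the order is reversed. -/
theorem integral_mul_divMul_divMul (hO : IsOpen O) (ha : ContDiffOn ℝ ∞ a O)
    (hb : ContDiffOn ℝ ∞ b O) (hφ : ContDiff ℝ ∞ φ) (hc : HasCompactSupport φ)
    (hs : tsupport φ ⊆ O) {ψ : EuclideanSpace ℝ (Fin n) → ℝ} (hψ : ContDiff ℝ ∞ ψ) :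
    ∫ y, ψ y * divMul a (divMul b φ) y
      = ∫ y, fderiv ℝ (fun z => fderiv ℝ ψ z (a z)) y (b y) * φ y := by
  have hΦ := contDiff_divMul hO hb hφ hs
  have hψa : ContDiffOn ℝ ∞ (fun z => fderiv ℝ ψ z (a z)) O :=
    ((hψ.fderiv_right (m := ∞) (by simp)).contDiffOn).clm_apply ha
  have h1 := integral_fderiv_mul_eq_neg_divMul hO (ha.of_le (by simp))
    (hψ.of_le (by simp)).contDiffOn (hΦ.of_le (by simp)) (hasCompactSupport_divMul hc)
    (tsupport_divMul_subset.trans hs)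
  have h2 := integral_fderiv_mul_eq_neg_divMul hO (hb.of_le (by simp))
    (hψa.of_le (by simp)) (hφ.of_le (by simp)) hc hs
  rw [h2, ← neg_eq_iff_eq_neg.2 h1, h1]

/-- The second-order parts agree by symmetry of the second derivative, and the first-order terms
left over form the bracket. -/
theorem fderiv_fderiv_apply_sub (hO : IsOpen O) (ha : ContDiffOn ℝ ∞ a O)
    (hb : ContDiffOn ℝ ∞ b O) {ψ : EuclideanSpace ℝ (Fin n) → ℝ} (hψ : ContDiff ℝ ∞ ψ)
    {y : EuclideanSpace ℝ (Fin n)} (hy : y ∈ O) :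
    fderiv ℝ (fun z => fderiv ℝ ψ z (a z)) y (b y) - fderiv ℝ (fun z => fderiv ℝ ψ z (b z)) y (a y)
      = -fderiv ℝ ψ y (VectorField.lieBracket ℝ a b y) := by
  have hψ' : DifferentiableAt ℝ (fderiv ℝ ψ) y :=
    (hψ.fderiv_right (m := ∞) (by simp)).differentiable (by simp) y
  have ha' := (ha.contDiffAt (hO.mem_nhds hy)).differentiableAt (by simp)
  have hb' := (hb.contDiffAt (hO.mem_nhds hy)).differentiableAt (by simp)
  have hsymm := (hψ.contDiffAt (x := y)).isSymmSndFDerivAt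
    (by simpa using two_le_smooth)
  rw [fderiv_clm_apply hψ' ha', fderiv_clm_apply hψ' hb', VectorField.lieBracket]
  simp only [add_apply, ContinuousLinearMap.comp_apply,
    ContinuousLinearMap.flip_apply, map_sub]
  rw [hsymm.eq (a y) (b y)]
  ring

/-- The identity is checked weakly, against every `ψ`, where it becomes the commutator of two
derivations acting on `ψ`. This avoids expanding second derivatives of the coefficients. -/
theorem divMul_divMul_sub_ae (hO : IsOpen O) (ha : ContDiffOn ℝ ∞ a O)
    (hb : ContDiffOn ℝ ∞ b O) (hφ : ContDiff ℝ ∞ φ) (hc : HasCompactSupport φ)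
    (hs : tsupport φ ⊆ O) :
    ∀ᵐ y, divMul a (divMul b φ) y - divMul b (divMul a φ) y
      = divMul (VectorField.lieBracket ℝ a b) φ y := by
  have hA := contDiff_divMul hO ha (contDiff_divMul hO hb hφ hs) (tsupport_divMul_subset.trans hs)
  have hB := contDiff_divMul hO hb (contDiff_divMul hO ha hφ hs) (tsupport_divMul_subset.trans hs)
  have hl := contDiffOn_lieBracket hO ha hb
  have hC := contDiff_divMul hO hl hφ hs
  refine ae_eq_of_integral_contDiff_smul_eq (hA.continuous.sub hB.continuous).locallyIntegrable
    hC.continuous.locallyIntegrable fun ψ hψ hψc => ?_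
  have i1 : Integrable (fun y => ψ y * divMul a (divMul b φ) y) :=
    (hψ.continuous.mul hA.continuous).integrable_of_hasCompactSupport hψc.mul_right
  have i2 : Integrable (fun y => ψ y * divMul b (divMul a φ) y) :=
    (hψ.continuous.mul hB.continuous).integrable_of_hasCompactSupport hψc.mul_right
  have h3 := integral_fderiv_mul_eq_neg_divMul hO (hl.of_le (by simp))
    (hψ.of_le (by simp)).contDiffOn (hφ.of_le (by simp)) hc hs
  have hda : ContDiffOn ℝ ∞ (fun z => fderiv ℝ ψ z (a z)) O :=
    ((hψ.fderiv_right (m := ∞) (by simp)).contDiffOn).clm_apply ha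
  have hdb : ContDiffOn ℝ ∞ (fun z => fderiv ℝ ψ z (b z)) O :=
    ((hψ.fderiv_right (m := ∞) (by simp)).contDiffOn).clm_apply hb
  have int : ∀ {h c}, ContDiffOn ℝ ∞ h O → ContDiffOn ℝ ∞ c O →
      Integrable (fun y => fderiv ℝ h y (c y) * φ y) := fun {h c} hh hc' =>
    (continuous_mul_of_tsupport_subset hO (((hh.fderiv_of_isOpen hO (m := ∞)
      (by simp)).clm_apply hc').continuousOn) hφ.continuous hs).integrable_of_hasCompactSupport
      hc.mul_left
  simp only [smul_eq_mul, mul_sub]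
  rw [integral_sub i1 i2, integral_mul_divMul_divMul hO ha hb hφ hc hs hψ,
    integral_mul_divMul_divMul hO hb ha hφ hc hs hψ, ← integral_sub (int hda hb) (int hdb ha),
    ← neg_eq_iff_eq_neg.2 h3, ← integral_neg]
  refine integral_congr_ae (Eventually.of_forall fun y => ?_)
  by_cases hy : y ∈ O
  · simp only [← sub_mul]
    rw [fderiv_fderiv_apply_sub hO ha hb hψ hy, neg_mul]
  · have : φ y = 0 := image_eq_zero_of_notMem_tsupport fun h => hy (hs h)
    simp [this]

theorem divMul_congr (hO : IsOpen O) (h : EqOn a b O) (hs : tsupport φ ⊆ O) :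
    divMul a φ = divMul b φ := by
  ext y
  by_cases hy : y ∈ O
  · refine Finset.sum_congr rfl fun j _ => ?_
    have : (fun z => a z j * φ z) =ᶠ[𝓝 y] fun z => b z j * φ z := by
      filter_upwards [hO.mem_nhds hy] with z hz
      rw [h hz]
    rw [this.fderiv_eq]
  · have h0 : ∀ c : EuclideanSpace ℝ (Fin n) → EuclideanSpace ℝ (Fin n), divMul c φ y = 0 :=
      fun c => image_eq_zero_of_notMem_tsupport
        fun h' => hy (hs (tsupport_divMul_subset h'))
    rw [h0, h0]

/-- The derivative of `f` along `a` vanishes on `O`, in the sense of distributions. -/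
def Annihilates (O : Set (EuclideanSpace ℝ (Fin n))) (f : EuclideanSpace ℝ (Fin n) → ℝ)
    (a : EuclideanSpace ℝ (Fin n) → EuclideanSpace ℝ (Fin n)) : Prop :=
  ∀ φ : EuclideanSpace ℝ (Fin n) → ℝ, ContDiff ℝ ∞ φ → HasCompactSupport φ → tsupport φ ⊆ O →
    ∫ y, f y * divMul a φ y = 0

theorem Annihilates.congr (hO : IsOpen O) (h : Annihilates O f a) (hab : EqOn a b O) :
    Annihilates O f b := fun φ hφ hc hs => by
  rw [← divMul_congr hO hab hs]
  exact h φ hφ hc hs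

theorem Annihilates.mono {O' : Set (EuclideanSpace ℝ (Fin n))} (h : Annihilates O f a)
    (hsub : O' ⊆ O) : Annihilates O' f a := fun φ hφ hc hs => h φ hφ hc (hs.trans hsub)

theorem integrable_mul_divMul (hO : IsOpen O) (hf : LocallyIntegrable f)
    (ha : ContDiffOn ℝ ∞ a O) (hφ : ContDiff ℝ ∞ φ) (hc : HasCompactSupport φ)
    (hs : tsupport φ ⊆ O) : Integrable (fun y => f y * divMul a φ y) := by
  have := hf.integrable_smul_right_of_hasCompactSupport
    (contDiff_divMul hO ha hφ hs).continuous (hasCompactSupport_divMul hc)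
  simpa [smul_eq_mul] using this

/-- The divergence operator of the bracket is the commutator of the two divergence operators, and
each of these maps test functions in `O` to test functions in `O`. -/
theorem Annihilates.lieBracket (hO : IsOpen O) (hf : LocallyIntegrable f)
    (ha : ContDiffOn ℝ ∞ a O) (hb : ContDiffOn ℝ ∞ b O) (h1 : Annihilates O f a)
    (h2 : Annihilates O f b) : Annihilates O f (VectorField.lieBracket ℝ a b) :=
  fun φ hφ hc hs => by
  have hA := contDiff_divMul hO ha hφ hs
  have hB := contDiff_divMul hO hb hφ hs
  have sA := (tsupport_divMul_subset (a := a) (φ := φ)).trans hs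
  have sB := (tsupport_divMul_subset (a := b) (φ := φ)).trans hs
  have cA := hasCompactSupport_divMul (a := a) hc
  have cB := hasCompactSupport_divMul (a := b) hc
  calc ∫ y, f y * divMul (VectorField.lieBracket ℝ a b) φ y
      = ∫ y, (f y * divMul a (divMul b φ) y - f y * divMul b (divMul a φ) y) := by
        refine integral_congr_ae ?_
        filter_upwards [divMul_divMul_sub_ae hO ha hb hφ hc hs] with y hy
        rw [← hy, mul_sub]
    _ = 0 := by
        rw [integral_sub (integrable_mul_divMul hO hf ha hB cB sB)
          (integrable_mul_divMul hO hf hb hA cA sA), h1 _ hB cB sB, h2 _ hA cA sA, sub_zero]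

/-- The class of annihilated fields is closed under combinations with smooth coefficients. -/
theorem Annihilates.sum_smul (hO : IsOpen O) (hf : LocallyIntegrable f) {ι : Type*} [Fintype ι]
    {a : ι → EuclideanSpace ℝ (Fin n) → EuclideanSpace ℝ (Fin n)}
    {h : ι → EuclideanSpace ℝ (Fin n) → ℝ}
    (ha : ∀ i, ContDiffOn ℝ ∞ (a i) O) (hh : ∀ i, ContDiffOn ℝ ∞ (h i) O)
    (hA : ∀ i, Annihilates O f (a i)) : Annihilates O f (fun y => ∑ i, h i y • a i y) :=
  fun φ hφ hc hs => by
  have hφi := fun i => contDiff_mul_of_tsupport_subset hO (hh i) hφ hs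
  have hsi : ∀ i, tsupport (fun z => h i z * φ z) ⊆ O := fun i =>
    (closure_mono (Function.support_mul_subset_right _ φ)).trans hs
  have hci : ∀ i, HasCompactSupport (fun z => h i z * φ z) := fun i => hc.mul_left
  -- The smooth coefficients are absorbed into the test function, one product `h i φ` for each
  -- field.
  have e : ∀ y, divMul (fun y => ∑ i, h i y • a i y) φ y
      = ∑ i, divMul (a i) (fun z => h i z * φ z) y := fun y => by
    unfold divMul
    rw [Finset.sum_comm]
    refine Finset.sum_congr rfl fun j _ => ?_
    have e1 : (fun z => (∑ i, h i z • a i z) j * φ z)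
        = fun z => ∑ i, a i z j * (h i z * φ z) := by
      ext z
      simp only [WithLp.ofLp_sum, Finset.sum_apply, PiLp.smul_apply, smul_eq_mul, Finset.sum_mul]
      exact Finset.sum_congr rfl fun i _ => by ring
    rw [e1, fderiv_fun_sum fun i _ => (contDiff_mul_of_tsupport_subset hO
      (contDiffOn_coord (ha i) j) (hφi i) (hsi i)).differentiable (by simp) y]
    simp
  simp_rw [e, Finset.mul_sum]
  rw [integral_finsetSum _ fun i _ => integrable_mul_divMul hO hf (ha i) (hφi i) (hci i) (hsi i)]
  exact Finset.sum_eq_zero fun i _ => hA i _ (hφi i) (hci i) (hsi i)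

/-- If the annihilated fields span at a point, all constant fields are annihilated near it. -/
theorem exists_annihilates_const (hO : IsOpen O) (hf : LocallyIntegrable f)
    {S : Set (EuclideanSpace ℝ (Fin n) → EuclideanSpace ℝ (Fin n))}
    (hS : ∀ a ∈ S, ContDiffOn ℝ ∞ a O ∧ Annihilates O f a) {y₀ : EuclideanSpace ℝ (Fin n)}
    (hy₀ : y₀ ∈ O) (hspan : Submodule.span ℝ ((fun a => a y₀) '' S) = ⊤) :
    ∃ R > 0, ∀ v, Annihilates (Metric.ball y₀ R) f (fun _ => v) := by
  obtain ⟨B, hBS, hB, hBi⟩ := exists_linearIndependent ℝ ((fun a => a y₀) '' S)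
  rw [hspan] at hB
  have : Fintype B := hBi.setFinite.fintype
  choose a haS hay using fun i : B => hBS i.2
  have hbi : LinearIndependent ℝ (fun i : B => a i y₀) := by
    simpa only [hay] using hBi
  have hbs : ⊤ ≤ Submodule.span ℝ (range fun i : B => a i y₀) := by
    simp only [hay, Subtype.range_coe_subtype, hB, ofPred_mem_eq, le_refl]
  set bs := Module.Basis.mk hbi hbs
  -- `A y` sends coefficients to the combination of the selected fields at `y`. It is invertible at
  -- `y₀`, hence nearby because invertible maps form an open set, and its inverse depends smoothly
  -- on `y`; the inverse supplies smooth coefficients for a constant field.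
  set A : EuclideanSpace ℝ (Fin n) → (B → ℝ) →L[ℝ] EuclideanSpace ℝ (Fin n) := fun y =>
    ∑ i, (ContinuousLinearMap.proj (R := ℝ) (φ := fun _ : B => ℝ) i).smulRight (a i y) with hA
  have hAapp : ∀ y v, A y v = ∑ i, v i • a i y := fun y v => by simp [A]
  have hAc : ContDiffOn ℝ ∞ A O := ContDiffOn.sum fun i _ =>
    ((ContinuousLinearMap.smulRightL ℝ (B → ℝ) (EuclideanSpace ℝ (Fin n))
      (ContinuousLinearMap.proj i)).contDiff).comp_contDiffOn (hS _ (haS i)).1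
  have hA0 : A y₀ ∈ range ((↑) : ((B → ℝ) ≃L[ℝ] EuclideanSpace ℝ (Fin n)) → _) := by
    refine ⟨bs.equivFun.symm.toContinuousLinearEquiv, ?_⟩
    ext1 v
    rw [hAapp]
    simp [bs, Module.Basis.equivFun_symm_apply]
  set O' := O ∩ A ⁻¹' range ((↑) : ((B → ℝ) ≃L[ℝ] EuclideanSpace ℝ (Fin n)) → _)
  have hO' : IsOpen O' := hAc.continuousOn.isOpen_inter_preimage hO ContinuousLinearEquiv.isOpen
  obtain ⟨R, hR, hball⟩ := Metric.isOpen_iff.1 hO' y₀ ⟨hy₀, hA0⟩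
  refine ⟨R, hR, fun v => ?_⟩
  have hinv : ContDiffOn ℝ ∞ (fun y => (A y).inverse v) O' := fun y hy => by
    obtain ⟨T, hT⟩ := hy.2
    have h1 : ContDiffAt ℝ ∞ ContinuousLinearMap.inverse (A y) := hT ▸ contDiffAt_map_inverse T
    exact ((h1.comp y (hAc.contDiffAt (hO.mem_nhds hy.1))).clm_apply
      contDiffAt_const).contDiffWithinAt
  refine ((Annihilates.sum_smul hO' hf (a := a) (h := fun i y => (A y).inverse v i)
    (fun i => (hS _ (haS i)).1.mono inter_subset_left) (fun i => ?_)
    (fun i => (hS _ (haS i)).2.mono inter_subset_left)).congr hO' ?_).mono hball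
  · exact contDiffOn_pi.1 hinv i
  · rintro y ⟨-, T, hT⟩
    have hi : (A y).IsInvertible := ⟨T, hT⟩
    have := hi.self_apply_inverse v
    rwa [hAapp] at this

/-- A function all of whose directional derivatives vanish on a ball cannot take the values `0` and
`1` on nonempty open subsets of the concentric ball of half the radius. -/
theorem Annihilates.eq_empty_of_const (hf : LocallyIntegrable f) {y₀ : EuclideanSpace ℝ (Fin n)}
    {R : ℝ} (h : ∀ v, Annihilates (Metric.ball y₀ R) f (fun _ => v))
    {V₀ V₁ : Set (EuclideanSpace ℝ (Fin n))} (hV₀ : IsOpen V₀) (hV₁ : IsOpen V₁)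
    (hf₀ : ∀ y ∈ V₀, f y = 0) (hf₁ : ∀ y ∈ V₁, f y = 1) {y₁ y₂ : EuclideanSpace ℝ (Fin n)}
    (hy₁ : y₁ ∈ V₀) (hy₂ : y₂ ∈ V₁) (hb₁ : y₁ ∈ Metric.ball y₀ (R / 2))
    (hb₂ : y₂ ∈ Metric.ball y₀ (R / 2)) : False := by
  obtain ⟨r₁, hr₁, hB₁⟩ := Metric.isOpen_iff.1 hV₀ y₁ hy₁
  obtain ⟨r₂, hr₂, hB₂⟩ := Metric.isOpen_iff.1 hV₁ y₂ hy₂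
  have hR : 0 < R / 2 := (dist_nonneg.trans_lt hb₁)
  -- This scale keeps the mollifier inside the ball of radius `R` from every point of the half ball,
  -- and inside the regions of known value around `y₁` and `y₂`.
  set δ := min (R / 2) (min r₁ r₂) / 2
  have hδ : 0 < δ := by positivity
  have hδR : δ < R / 2 := (half_lt_self (by positivity)).trans_le (min_le_left _ _)
  have hδ₁ : δ < r₁ :=
    (half_lt_self (by positivity)).trans_le ((min_le_right _ _).trans (min_le_left _ _))
  have hδ₂ : δ < r₂ :=
    (half_lt_self (by positivity)).trans_le ((min_le_right _ _).trans (min_le_right _ _))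
  let η : ContDiffBump (0 : EuclideanSpace ℝ (Fin n)) := ⟨δ / 2, δ, by positivity, by linarith⟩
  have hη : ContDiff ℝ ∞ η := η.contDiff
  have hηδ : ∀ x, δ ≤ ‖x‖ → η x = 0 := fun x hx => η.zero_of_le_dist (by simpa using hx)
  have hts : ∀ x, tsupport (fun t => η (x - t)) ⊆ Metric.closedBall x δ := fun x =>
    closure_minimal (fun t ht => by
      by_contra h'
      refine ht (hηδ _ ?_)
      rw [Metric.mem_closedBall, not_le, dist_comm, dist_eq_norm] at h'
      exact h'.le) Metric.isClosed_closedBall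
  set L := ContinuousLinearMap.mul ℝ ℝ
  have hd := fun x => η.hasCompactSupport.hasFDerivAt_convolution_right (μ := volume) L hf
    (hη.of_le (by simp)) x
  -- The mollification of `f` has zero derivative on the half ball, so it is constant there; at `y₁`
  -- it sees only the value 0 of `f`, at `y₂` only the value 1.
  set F := MeasureTheory.convolution f η L volume
  have hF : ∀ x, F x = ∫ t, f t * η (x - t) := fun x => rfl
  have hFd : ∀ x ∈ Metric.ball y₀ (R / 2), fderiv ℝ F x = 0 := fun x hx => by
    rw [(hd x).fderiv]
    ext v
    have hci : Integrable (fun t => (L.precompR (EuclideanSpace ℝ (Fin n)) (f t))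
        (fderiv ℝ η (x - t))) :=
      (η.hasCompactSupport.fderiv ℝ).convolutionExists_right _ hf
        (hη.continuous_fderiv (by simp)) x
    rw [MeasureTheory.convolution_def, ContinuousLinearMap.integral_apply hci]
    have hη' : ContDiff ℝ ∞ (fun t => η (x - t)) := hη.comp (contDiff_const.sub contDiff_id)
    have hsub : tsupport (fun t => η (x - t)) ⊆ Metric.ball y₀ R := by
      refine (hts x).trans fun t ht => ?_
      rw [Metric.mem_closedBall] at ht
      rw [Metric.mem_ball] at hx ⊢
      linarith [dist_triangle t x y₀]
    have h0 := h v _ hη' ((isCompact_closedBall x δ).of_isClosed_subset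
      (isClosed_tsupport _) (hts x)) hsub
    rw [ContinuousLinearMap.zero_apply, ← neg_eq_zero, ← integral_neg, ← h0]
    refine integral_congr_ae (Eventually.of_forall fun t => ?_)
    have e1 : divMul (fun _ => v) (fun t => η (x - t)) t = -fderiv ℝ η (x - t) v := by
      have hdiff : DifferentiableAt ℝ (fun t => η (x - t)) t := hη'.differentiable (by simp) t
      unfold divMul
      simp_rw [fderiv_const_mul hdiff, smul_apply, smul_eq_mul]
      rw [sum_coord_mul_fderiv]
      have h3 : HasFDerivAt (fun t => η (x - t)) ((fderiv ℝ η (x - t)).comp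
          (-ContinuousLinearMap.id ℝ _)) t :=
        ((hη.differentiable (by simp) (x - t)).hasFDerivAt).comp t
          ((hasFDerivAt_id t).const_sub x)
      rw [h3.fderiv]
      simp
    simp only [e1]
    simp [L, ContinuousLinearMap.precompR_apply]
  have hconst : F y₁ = F y₂ := Metric.isOpen_ball.is_const_of_fderiv_eq_zero (𝕜 := ℝ)
    (convex_ball y₀ (R / 2)).isPreconnected
    (fun x _ => (hd x).differentiableAt.differentiableWithinAt) (fun x hx => hFd x hx) hb₁ hb₂
  have hη0 : ∀ {x t}, t ∉ Metric.ball x δ → η (x - t) = 0 := fun {x t} ht => by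
    refine hηδ _ ?_
    rw [Metric.mem_ball, not_lt, dist_comm, dist_eq_norm] at ht
    exact ht
  have hF₁ : F y₁ = 0 := by
    rw [hF]
    refine (integral_congr_ae (Eventually.of_forall fun t => ?_)).trans (integral_zero _ _)
    by_cases ht : t ∈ Metric.ball y₁ δ
    · simp [hf₀ t (hB₁ (Metric.ball_subset_ball hδ₁.le ht))]
    · simp [hη0 ht]
  have hF₂ : F y₂ = ∫ t, η t := by
    rw [hF, ← integral_sub_left_eq_self (fun t => η t) volume y₂]
    refine integral_congr_ae (Eventually.of_forall fun t => ?_)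
    by_cases ht : t ∈ Metric.ball y₂ δ
    · simp [hf₁ t (hB₂ (Metric.ball_subset_ball hδ₂.le ht))]
    · simp [hη0 ht]
  have := η.integral_pos (μ := (volume : Measure (EuclideanSpace ℝ (Fin n))))
  rw [← hF₂, ← hconst, hF₁] at this
  exact lt_irrefl _ this

end Annihilator

/-! ### Hörmander's condition at a smooth boundary point. -/

section Boundary

variable {n N : ℕ} {M : Type*} [TopologicalSpace M]
  [ChartedSpace (EuclideanSpace ℝ (Fin n)) M] [IsManifold (𝓡 n) ∞ M]

/-- The differential of the chart is surjective and carries the spanning set of commutators at the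
point onto the values of their coordinate fields. -/
theorem span_chartField_eq_top {e : OpenPartialHomeomorph M (EuclideanSpace ℝ (Fin n))}
    (he : e ∈ atlas (EuclideanSpace ℝ (Fin n)) M) {X : Fin N → VField n M} {Ω : Set M}
    (hX : HormanderOn X Ω) {y : EuclideanSpace ℝ (Fin n)} (hy : y ∈ e.target)
    (hyΩ : e.symm y ∈ Ω) :
    Submodule.span ℝ ((fun a : EuclideanSpace ℝ (Fin n) → EuclideanSpace ℝ (Fin n) => a y) ''
      (chartField e '' {V | IsCommutator X V})) = ⊤ := by
  have h := hX _ hyΩ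
  set T : TangentSpace (𝓡 n) (e.symm y) →L[ℝ] EuclideanSpace ℝ (Fin n) :=
    mfderiv (𝓡 n) (𝓡 n) e (e.symm y)
  have hT : Function.Surjective T := fun v => by
    have h1 := (mdifferentiable_atlas (M := M) he).comp_symm_deriv hy
    exact ⟨mfderiv (𝓡 n) (𝓡 n) e.symm y v, DFunLike.congr_fun h1 v⟩
  have h2 := congrArg (Submodule.map T.toLinearMap) h
  rw [Submodule.map_span, Submodule.map_top, LinearMap.range_eq_top.2 hT] at h2
  rw [← h2]
  congr 1
  ext v
  constructor
  · rintro ⟨-, ⟨V, hV, rfl⟩, rfl⟩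
    exact ⟨V (e.symm y), ⟨V, hV, rfl⟩, rfl⟩
  · rintro ⟨-, ⟨V, hV, rfl⟩, rfl⟩
    exact ⟨chartField e V, ⟨V, hV, rfl⟩, rfl⟩

/-- A locally integrable function with vanishing derivatives along fields satisfying Hörmander's
condition has, near every point, vanishing derivatives in all directions. -/
theorem exists_annihilates_const_of_hormander {X : Fin N → VField n M}
    (hX : ∀ k, IsSmoothField (X k)) {Ω : Set M} (hΩ : IsOpen Ω) (hH : HormanderOn X Ω)
    {u : M → ℝ} (hu : ∀ k, IsWeakDeriv (X k) Ω u 0)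
    {e : OpenPartialHomeomorph M (EuclideanSpace ℝ (Fin n))}
    (he : e ∈ atlas (EuclideanSpace ℝ (Fin n)) M) {f : EuclideanSpace ℝ (Fin n) → ℝ}
    (hf : LocallyIntegrable f) (hfu : ∀ y ∈ e.target, f y = u (e.symm y))
    {y : EuclideanSpace ℝ (Fin n)} (hy : y ∈ e.target) (hyΩ : e.symm y ∈ Ω) :
    ∃ R > 0, ∀ v, Annihilates (Metric.ball y R) f (fun _ => v) := by
  have hO := isOpen_target_inter (e := e) hΩ
  have hs : ∀ {V}, IsCommutator X V →
      ContDiffOn ℝ ∞ (chartField e V) (e.target ∩ e.symm ⁻¹' Ω) := fun hV =>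
    (contDiffOn_chartField he (hV.isSmoothField hX)).mono inter_subset_left
  -- The class of annihilating fields is closed under brackets, so the hypothesis on the `X k`
  -- spreads to all iterated commutators.
  have hA : ∀ {V}, IsCommutator X V →
      Annihilates (e.target ∩ e.symm ⁻¹' Ω) f (chartField e V) := fun {V} hV => by
    induction hV with
    | field k =>
      intro φ hφ hc hsφ
      have h := hu k e he φ hφ hc hsφ
      simp only [Pi.zero_apply, zero_mul, integral_zero] at h
      rw [← neg_eq_zero, ← integral_neg, h]
      refine integral_congr_ae (Eventually.of_forall fun z => ?_)
      simp only [formalAdjoint_eq_neg_divMul]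
      by_cases hz : z ∈ e.target
      · rw [hfu z hz]; ring
      · have : divMul (chartField e (X k)) φ z = 0 := image_eq_zero_of_notMem_tsupport
          fun h' => hz (hsφ (tsupport_divMul_subset h')).1
        simp [this]
    | bracket hV hW h1 h2 =>
      refine (h1.lieBracket hO hf (hs hV) (hs hW) h2).congr hO fun z hz => ?_
      exact (chartField_mlieBracket he (hV.isSmoothField hX) (hW.isSmoothField hX) hz.1).symm
  refine exists_annihilates_const hO hf (S := chartField e '' {V | IsCommutator X V}) ?_
    ⟨hy, hyΩ⟩ (span_chartField_eq_top he hH hy hyΩ)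
  rintro - ⟨V, hV, rfl⟩
  exact ⟨hs hV, hA hV⟩

theorem mfderiv_eq_zero_of_isLocalMax {r : M → ℝ} {x : M}
    (hr : MDifferentiableAt (𝓡 n) 𝓘(ℝ, ℝ) r x) (hmax : IsLocalMax r x) :
    mfderiv (𝓡 n) 𝓘(ℝ, ℝ) r x = 0 := by
  set e := chartAt (EuclideanSpace ℝ (Fin n)) x
  have he : e ∈ atlas (EuclideanSpace ℝ (Fin n)) M := chart_mem_atlas _ x
  have hx : x ∈ e.source := mem_chart_source _ x
  have hl : IsLocalMax (r ∘ e.symm) (e x) := by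
    have h1 : Tendsto e.symm (𝓝 (e x)) (𝓝 x) := e.tendsto_symm hx
    have h2 := h1.eventually hmax
    refine h2.mono fun z hz => ?_
    simpa [e.left_inv hx] using hz
  have h0 := hl.fderiv_eq_zero
  ext v
  have h1 := mfderiv_apply_eq_fderiv he (fun _ => v) (e.map_source hx) (f := r)
    (by rwa [e.left_inv hx])
  rw [e.left_inv hx, h0] at h1
  exact h1

/-- A domain with smooth boundary does not lie on both sides of its boundary. -/
theorem HasSmoothBoundary.notMem_interior_closure {Ω : Set M} (h : HasSmoothBoundary n Ω)
    (hΩ : IsOpen Ω) {x : M} (hx : x ∈ frontier Ω) : x ∉ interior (closure Ω) := fun hxi => by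
  obtain ⟨U, r, hU, hxU, hr, hdr, hiff⟩ := h x hx
  have hrx : ContMDiffAt (𝓡 n) 𝓘(ℝ, ℝ) ∞ r x := hr.contMDiffAt (hU.mem_nhds hxU)
  -- A point near `x` with `r > 0` would have a neighbourhood free of `Ω`, yet lie in the closure.
  -- Hence `r ≤ 0 ≤ r x` near `x`: a local maximum, against the nonzero differential.
  refine hdr (mfderiv_eq_zero_of_isLocalMax (hrx.mdifferentiableAt (by simp)) ?_)
  have hx0 : 0 ≤ r x := not_lt.1 fun hlt => by
    rw [hΩ.frontier_eq] at hx
    exact hx.2 ((hiff x hxU).2 hlt)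
  filter_upwards [hU.mem_nhds hxU, isOpen_interior.mem_nhds hxi] with y hyU hyi
  refine le_trans ?_ hx0
  by_contra! hlt
  have hc : ContinuousAt r y := hr.continuousOn.continuousAt (hU.mem_nhds hyU)
  have hn : ∀ᶠ z in 𝓝 y, z ∈ U ∧ 0 < r z :=
    (hU.eventually_mem hyU).and (hc.eventually (lt_mem_nhds hlt))
  obtain ⟨z, ⟨hzU, hz⟩, hzΩ⟩ := mem_closure_iff_nhds.1 (interior_subset hyi) _ hn
  exact lt_asymm hz ((hiff z hzU).1 hzΩ)

/-- Otherwise `Ω₁` and the complement of its closure would be disjoint open sets covering `Ω₂`, and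
connectedness would force equality. -/
theorem exists_mem_frontier_inter {Ω₁ Ω₂ : Set M} (h₁ : IsOpen Ω₁) (hne₁ : Ω₁.Nonempty)
    (h₂ : IsPreconnected Ω₂) (hsub : Ω₁ ⊆ Ω₂) (hne : Ω₁ ≠ Ω₂) :
    ∃ x ∈ frontier Ω₁, x ∈ Ω₂ := by
  by_contra! hcon
  refine hne (hsub.antisymm (h₂.subset_left_of_subset_union h₁ isClosed_closure.isOpen_compl
    (disjoint_compl_right_iff_subset.2 subset_closure) (fun x hx => ?_)
    (hne₁.mono fun x hx => ⟨hsub hx, hx⟩)))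
  by_cases hxc : x ∈ closure Ω₁
  · left
    by_contra hx1
    exact hcon x (by rw [h₁.frontier_eq]; exact ⟨hxc, hx1⟩) hx
  · exact .inr hxc

/-- Under Hörmander's condition the indicator of a proper subdomain with smooth boundary has a
nonzero horizontal gradient. -/
theorem not_isWeakDeriv_indicator {X : Fin N → VField n M} (hX : ∀ k, IsSmoothField (X k))
    {Ω₁ Ω₂ : Set M} (hΩ₁ : IsSmoothBoundedDomain n Ω₁) (hΩ₂ : IsSmoothBoundedDomain n Ω₂)
    (hsub : Ω₁ ⊆ Ω₂) (hne : Ω₁ ≠ Ω₂) (hH : HormanderOn X Ω₂) :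
    ¬ ∀ k, IsWeakDeriv (X k) Ω₂ (Ω₁.indicator 1) 0 := fun hu => by
  obtain ⟨x, hxf, hx₂⟩ := exists_mem_frontier_inter hΩ₁.isOpen hΩ₁.isConnected.nonempty
    hΩ₂.isConnected.isPreconnected hsub hne
  set e := chartAt (EuclideanSpace ℝ (Fin n)) x
  have he : e ∈ atlas (EuclideanSpace ℝ (Fin n)) M := chart_mem_atlas _ x
  have hx : x ∈ e.source := mem_chart_source _ x
  have hV₁ := isOpen_target_inter (e := e) hΩ₁.isOpen
  have hV₀ := isOpen_target_inter (e := e) (isClosed_closure (s := Ω₁)).isOpen_compl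
  set f : EuclideanSpace ℝ (Fin n) → ℝ := (e.target ∩ e.symm ⁻¹' Ω₁).indicator 1
  have hf : LocallyIntegrable f :=
    (locallyIntegrable_const (1 : ℝ)).indicator hV₁.measurableSet
  obtain ⟨R, hR, hA⟩ := exists_annihilates_const_of_hormander hX hΩ₂.isOpen hH hu he hf
    (fun y hy => by
      by_cases hy' : e.symm y ∈ Ω₁ <;> simp [f, hy, hy']) (e.map_source hx) (by rwa [e.left_inv hx])
  set W := e.source ∩ e ⁻¹' Metric.ball (e x) (R / 2)
  have hW : W ∈ 𝓝 x := (e.isOpen_inter_preimage Metric.isOpen_ball).mem_nhds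
    ⟨hx, Metric.mem_ball_self (by positivity)⟩
  obtain ⟨z₂, hz₂, hz₂'⟩ := mem_closure_iff_nhds.1 (frontier_subset_closure hxf) _ hW
  -- Smoothness of the boundary enters here. If `Ω₁` were `Ω₂` without a closed null set, its
  -- indicator would have zero gradient and there would be no contradiction.
  obtain ⟨z₁, hz₁, hz₁'⟩ : (W ∩ (closure Ω₁)ᶜ).Nonempty := by
    by_contra hcon
    refine hΩ₁.smoothBoundary.notMem_interior_closure hΩ₁.isOpen hxf
      (mem_interior_iff_mem_nhds.2 (mem_of_superset hW fun z hz => ?_))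
    by_contra hz'
    exact hcon ⟨z, hz, hz'⟩
  refine Annihilates.eq_empty_of_const hf hA hV₀ hV₁ (fun y hy => ?_) (fun y hy => ?_)
    (y₁ := e z₁) (y₂ := e z₂) ⟨e.map_source hz₁.1, ?_⟩ ⟨e.map_source hz₂.1, ?_⟩ hz₁.2 hz₂.2
  · exact indicator_of_notMem (fun h => hy.2 (subset_closure h.2)) _
  · simp [f, indicator_of_mem hy]
  · rw [mem_preimage, e.left_inv hz₁.1]; exact hz₁'
  · rw [mem_preimage, e.left_inv hz₂.1]; exact hz₂'

end Boundary

end SubLaplacian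

end

/-! ### Assembly of the contradiction. -/

theorem mainTheorem5 {n N : ℕ} {M : Type*} [TopologicalSpace M] [T2Space M]
    [SecondCountableTopology M] [ChartedSpace (EuclideanSpace ℝ (Fin n)) M]
    [IsManifold (𝓡 n) ∞ M] [MeasurableSpace M] [BorelSpace M]
    (μ : Measure M) (hμ : SubLaplacian.IsSmoothVolume n μ)
    (X : Fin N → SubLaplacian.VField n M) (hX : ∀ k, SubLaplacian.IsSmoothField (X k))
    (Ω₁ Ω₂ : Set M) (hΩ₁ : SubLaplacian.IsSmoothBoundedDomain n Ω₁)
    (hΩ₂ : SubLaplacian.IsSmoothBoundedDomain n Ω₂)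
    (hsub : Ω₁ ⊆ Ω₂) (hne : Ω₁ ≠ Ω₂)
    (hXΩ : SubLaplacian.HormanderOn X Ω₂)
    (p : M → ℝ) (hp_cont : ContinuousOn p (closure Ω₂))
    (hp_C1 : ContMDiffOn (𝓡 n) 𝓘(ℝ, ℝ) 1 p Ω₂) (hp_one : ∀ x ∈ closure Ω₂, 1 < p x)
    (g : M → ℝ) (hg_meas : AEMeasurable g (μ.restrict Ω₂)) (hg_pos : ∀ x ∈ Ω₂, 0 < g x)
    (hg_bdd : ∃ C : ℝ, ∀ x ∈ Ω₂, g x ≤ C)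
    (u₁ u₂ : M → ℝ)
    (hu₁ : SubLaplacian.IsPrincipalEigenfunction μ X p g Ω₁ u₁)
    (hu₂ : SubLaplacian.IsPrincipalEigenfunction μ X p g Ω₂ u₂)
    (horth₁ : ∀ᵐ x ∂(μ.restrict Ω₁),
      inner ℝ (SubLaplacian.hgrad X p x) (SubLaplacian.weakGrad μ X Ω₁ u₁ x) = 0)
    (horth₂ : ∀ᵐ x ∂(μ.restrict Ω₂),
      inner ℝ (SubLaplacian.hgrad X p x) (SubLaplacian.weakGrad μ X Ω₂ u₂ x) = 0) :
    SubLaplacian.principalEigenvalue μ X p g Ω₁ > SubLaplacian.principalEigenvalue μ X p g Ω₂ := by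
  open SubLaplacian in
  by_contra! hlam
  obtain ⟨C, hgC⟩ := hg_bdd
  have hcne : (closure Ω₂).Nonempty := hΩ₂.isConnected.nonempty.closure
  -- Compactness of the closure provides the uniform bounds `1 < p a ≤ p ≤ p b` required throughout.
  obtain ⟨a, ha, hmin⟩ := hΩ₂.isCompact_closure.exists_isMinOn hcne hp_cont
  obtain ⟨b, -, hmax⟩ := hΩ₂.isCompact_closure.exists_isMaxOn hcne hp_cont
  have hqp : ∀ x ∈ Ω₂, p a ≤ p x := fun x hx => hmin (subset_closure hx)
  have hpP : ∀ x ∈ Ω₂, p x ≤ p b := fun x hx => hmax (subset_closure hx)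
  have hone : ∀ x ∈ Ω₂, 1 < p x := fun x hx => hp_one x (subset_closure hx)
  have : IsLocallyFiniteMeasure μ := isLocallyFiniteMeasure_of_isSmoothVolume hμ
  have : IsFiniteMeasure (μ.restrict Ω₂) := ⟨by
    rw [Measure.restrict_apply_univ]
    exact (measure_mono subset_closure).trans_lt hΩ₂.isCompact_closure.measure_lt_top⟩
  have hmeas := hΩ₂.isOpen.measurableSet
  have hmem : ∀ᵐ x ∂(μ.restrict Ω₂), x ∈ Ω₂ := ae_restrict_mem hmeas
  have hp : IsExponent (μ.restrict Ω₂) p (p b) :=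
    ⟨(hp_cont.mono subset_closure).aemeasurable hmeas, hmem.mono hone, hmem.mono hpP⟩
  have hle : μ.restrict Ω₁ ≤ μ.restrict Ω₂ := Measure.restrict_mono hsub le_rfl
  have : IsFiniteMeasure (μ.restrict Ω₁) := isFiniteMeasure_of_le _ hle
  -- The negated conclusion is exactly the comparison of parameters that forces equality in Picone's
  -- inequality.
  have hgrad := grad_eq_smul_of_le hμ hX hΩ₂.isOpen hp hp_C1 (hp_one a ha) hqp hpP hg_meas hg_pos
    hgC hu₂.solution hu₂.positive horth₂ hΩ₁.isOpen hsub hu₁.solution hu₁.positive hlam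
  have hU := (hu₁.solution.memW0.isW0Limit hX (hp.restrict hle)).indicator hΩ₂.isOpen hΩ₁.isOpen
    hsub hone
  have h₁ : ∀ᵐ x ∂(μ.restrict Ω₂), x ∈ Ω₁ → 0 < u₁ x
      ∧ weakGrad μ X Ω₁ u₁ x = (u₁ x / u₂ x) • weakGrad μ X Ω₂ u₂ x := by
    rw [ae_restrict_iff' hmeas]
    have := (ae_restrict_iff' hΩ₁.isOpen.measurableSet).1 (hu₁.positive.and hgrad)
    filter_upwards [this] with x hx _ using hx
  -- With `h = ‖∇_X u₂‖/u₂`, proportionality of the gradients gives `‖∇_X U‖ = U h` in `Ω₁`, and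
  -- outside `Ω₁` both sides vanish.
  refine not_isWeakDeriv_indicator hX hΩ₁ hΩ₂ hsub hne hXΩ fun k =>
    isWeakDeriv_indicator_one hμ hX hΩ₂.isOpen hp hΩ₁.isOpen.measurableSet hU
      (h := fun x => ‖weakGrad μ X Ω₂ u₂ x‖ / u₂ x) ?_ ?_ ?_ ?_ k
  · filter_upwards [h₁] with x hx hx₁
    simpa [hx₁] using (hx hx₁).1
  · exact Eventually.of_forall fun x hx => indicator_of_notMem hx _
  · intro K hKΩ hK
    obtain ⟨φ, hφ, hφK⟩ := exists_isTestFunction_eq_one (n := n) hK hΩ₂.isOpen hKΩ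
    exact lintegral_norm_div_lt_top hμ hX hΩ₂.isOpen hp hp_C1 (hp_one a ha) hqp hpP hg_meas hg_pos
      hgC hu₂.solution hu₂.positive horth₂ hφ hK.measurableSet hKΩ hφK
  · filter_upwards [h₁, hu₂.positive] with x hx hx₂
    by_cases hx₁ : x ∈ Ω₁
    · obtain ⟨h0, hg⟩ := hx hx₁
      simp only [indicator_of_mem hx₁, hg, norm_smul]
      rw [Real.norm_of_nonneg (by positivity)]
      exact (by ring : _ = _).le
    · simp [hx₁]
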